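/- **Strichartz estimates on $\mathbb{R}\times\mathbb{T}^3$.** Let $\mathbb{T}=\mathbb{R}/2\pi\mathbb{Z}$. For $f\in L^2(\mathbb{R}\times\mathbb{T}^3)$ (complex-valued) let $\mathcal{F}f$ be its Fourier transform, $(\mathcal{F}f)(\xi)=\int_{\mathbb{R}\times\mathbb{T}^3}f(x)e^{-ix\cdot\xi}\,dx$, $\xi=(\xi_1,\dots,\xi_4)\in\mathbb{R}\times\mathbb{Z}^3$ (extended to $L^2$ in the usual way), and define $e^{it\Delta}$ on $L^2(\mathbb{R}\times\mathbb{T}^3)$ by $(\mathcal{F}e^{it\Delta}f)(\xi)=e^{-it|\xi|^2}(\mathcal{F}f)(\xi)$. Fix a smooth even function $\eta^1:\mathbb{R}\to[0,1]$ with $\eta^1(y)=1$ for $|y|\le1$ and $\eta^1(y)=0$ for $|y|\ge2$, and let $\eta^4(\xi)=\prod_{k=1}^4\eta^1(\xi_k)^2$. For a dyadic integer $N=2^j\ge1$ let $(\mathcal{F}P_{\le N}f)(\xi)=\eta^4(\xi/N)(\mathcal{F}f)(\xi)$, $P_1f=P_{\le1}f$, and $P_Nf=P_{\le N}f-P_{\le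 N/2}f$ for $N\ge2$. Then for every $p\in(18/5,\infty]$ there is a constant $C$, depending only on $p$ (and on the fixed function $\eta^1$), such that for every dyadic integer $N\ge1$ and every $f\in L^2(\mathbb{R}\times\mathbb{T}^3)$ $$\|e^{it\Delta}P_Nf\|_{L^p(\mathbb{R}\times\mathbb{T}^3\times[-1,1])}\le C\,N^{2-6/p}\,\|f\|_{L^2(\mathbb{R}\times\mathbb{T}^3)},$$ where $6/p=0$ if $p=\infty$. -/

import Mathlib

open MeasureTheory Real
open scoped ENNReal ContDiff FourierTransform BoundedContinuousFunction ComplexConjugate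

noncomputable section

namespace SemiperiodicNLS

instance fact_two_pi_pos : Fact (0 < 2 * π) := ⟨Real.two_pi_pos⟩

/-- The torus `𝕋³ = (ℝ / 2πℤ)³`, with Lebesgue measure of total mass `(2π)³`. -/
abbrev Torus3 : Type := Fin 3 → AddCircle (2 * π)

/-- The semiperiodic space `ℝ × 𝕋³`, with the product Lebesgue measure. -/
abbrev Space : Type := ℝ × Torus3

/-- The complex Hilbert space `L²(ℝ × 𝕋³)`. -/
abbrev L2Space : Type := Lp ℂ 2 (volume : Measure Space)

/-- The complex Hilbert space `L²(ℝ)`. -/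
abbrev L2Line : Type := Lp ℂ 2 (volume : Measure ℝ)

/-- The frequency space `ℝ × ℤ³`. -/
abbrev Freq : Type := ℝ × (Fin 3 → ℤ)

/-- The character `y ↦ e^{i n·y}` of `𝕋³`, for `n ∈ ℤ³`. -/
def mode (n : Fin 3 → ℤ) (y : Torus3) : ℂ := ∏ k, fourier (n k) (y k)

theorem mode_coe (n : Fin 3 → ℤ) (y : Fin 3 → ℝ) :
    mode n (fun k => (y k : AddCircle (2 * π))) = Complex.exp (Complex.I * ∑ k, n k * y k) := by
  have h : ∀ k, (fourier (n k) (y k : AddCircle (2 * π)) : ℂ)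
      = Complex.exp (Complex.I * (n k * y k)) := by
    intro k
    rw [fourier_coe_apply]
    congr 1
    have := Real.pi_ne_zero
    push_cast
    field_simp
  simp only [mode, h, ← Complex.exp_sum]
  push_cast
  rw [Finset.mul_sum]

theorem continuous_mode (n : Fin 3 → ℤ) : Continuous (mode n) := by
  unfold mode
  fun_prop

theorem norm_mode (n : Fin 3 → ℤ) (y : Torus3) : ‖mode n y‖ = 1 := by
  simp only [mode, norm_prod, fourier_apply, Circle.norm_coe, Finset.prod_const_one]

theorem memLp_partialCoeff (f : L2Space) (n : Fin 3 → ℤ) :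
    MemLp (fun x : ℝ => ∫ y : Torus3, conj (mode n y) * f (x, y)) 2 volume := by
  have hf := Lp.memLp f
  have hm : AEStronglyMeasurable (fun z : Space => conj (mode n z.2) * f z) volume := by
    refine AEStronglyMeasurable.mul ?_ hf.1
    have := continuous_mode n
    exact Continuous.aestronglyMeasurable (by fun_prop)
  refine ⟨hm.integral_prod_right', ?_⟩
  have hfin := hf.2
  rw [eLpNorm_lt_top_iff_lintegral_rpow_enorm_lt_top (by simp) (by simp)] at hfin ⊢
  simp only [ENNReal.toReal_ofNat, ENNReal.rpow_ofNat] at hfin ⊢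
  have hsq : AEMeasurable (fun z : Space => ‖f z‖ₑ ^ 2) volume := hf.1.enorm.pow_const 2
  have hprod : ∫⁻ z : Space, ‖f z‖ₑ ^ 2 = ∫⁻ x : ℝ, ∫⁻ y : Torus3, ‖f (x, y)‖ₑ ^ 2 :=
    lintegral_prod _ hsq
  rw [hprod] at hfin
  have hae : ∀ᵐ x : ℝ, AEStronglyMeasurable (fun y : Torus3 => f (x, y)) volume :=
    hf.1.prodMk_left
  have hle : ∀ᵐ x : ℝ, ‖∫ y : Torus3, conj (mode n y) * f (x, y)‖ₑ ^ 2
      ≤ volume (Set.univ : Set Torus3) * ∫⁻ y : Torus3, ‖f (x, y)‖ₑ ^ 2 := by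
    filter_upwards [hae] with x hx
    have h1 : ‖∫ y : Torus3, conj (mode n y) * f (x, y)‖ₑ ≤ ∫⁻ y : Torus3, ‖f (x, y)‖ₑ := by
      refine (enorm_integral_le_lintegral_enorm _).trans (le_of_eq ?_)
      congr 1
      ext y
      rw [enorm_mul]
      have : ‖conj (mode n y)‖ₑ = 1 := by
        rw [← ofReal_norm, RCLike.norm_conj, norm_mode]; simp
      rw [this, one_mul]
    have h2 := eLpNorm_le_eLpNorm_mul_rpow_measure_univ (p := 1) (q := 2) (by norm_num) hx
    rw [eLpNorm_one_eq_lintegral_enorm,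
      eLpNorm_eq_lintegral_rpow_enorm_toReal (by simp) (by simp)] at h2
    simp only [ENNReal.toReal_ofNat, ENNReal.rpow_ofNat, ENNReal.toReal_one] at h2
    calc _ ≤ ((∫⁻ y : Torus3, ‖f (x, y)‖ₑ ^ 2) ^ (1 / 2 : ℝ)
          * volume (Set.univ : Set Torus3) ^ (1 / 1 - 1 / 2 : ℝ)) ^ 2 := by
            gcongr; exact h1.trans h2
      _ = _ := by
        rw [mul_pow, ← ENNReal.rpow_natCast, ← ENNReal.rpow_mul, ← ENNReal.rpow_natCast,
          ← ENNReal.rpow_mul]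
        norm_num
        rw [mul_comm]
  refine (lintegral_mono_ae hle).trans_lt ?_
  rw [lintegral_const_mul'' _ hsq.lintegral_prod_right']
  exact ENNReal.mul_lt_top (measure_lt_top _ _) hfin

/-- Fourier coefficients in the periodic variables:
`x₁ ↦ ∫_{𝕋³} f(x₁, y) e^{-i n·y} dy`, an element of `L²(ℝ)`. -/
def partialCoeff (f : L2Space) (n : Fin 3 → ℤ) : L2Line := (memLp_partialCoeff f n).toLp _

theorem memLp_tensorMode (g : L2Line) (n : Fin 3 → ℤ) :
    MemLp (fun z : Space => g z.1 * mode n z.2) 2 volume := by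
  have h : MemLp (fun z : Space => g z.1) 2 volume := (Lp.memLp g).comp_fst _
  refine h.of_le ?_ ?_
  · refine h.1.mul ?_
    have := continuous_mode n
    exact Continuous.aestronglyMeasurable (by fun_prop)
  · filter_upwards with z
    simp [norm_mode]

/-- The function `(x₁, y) ↦ g(x₁) e^{i n·y}`, an element of `L²(ℝ × 𝕋³)`. -/
def tensorMode (g : L2Line) (n : Fin 3 → ℤ) : L2Space := (memLp_tensorMode g n).toLp _

theorem memLp_symbolMul (m : Freq →ᵇ ℂ) (n : Fin 3 → ℤ) (h : L2Line) :
    MemLp (fun s : ℝ => m (2 * π * s, n) * h s) 2 volume := by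
  refine (Lp.memLp h).of_le_mul (c := ‖m‖) ?_ ?_
  · refine AEStronglyMeasurable.mul ?_ (Lp.memLp h).1
    exact Continuous.aestronglyMeasurable (by fun_prop)
  · filter_upwards with s
    rw [norm_mul]
    gcongr
    exact m.norm_coe_le_norm _

/-- Multiplication by the symbol `m(ξ₁, n)` on `L²(ℝ)`; the variable `s` is the
frequency in Mathlib's normalisation, `ξ₁ = 2π s`. -/
def symbolMul (m : Freq →ᵇ ℂ) (n : Fin 3 → ℤ) (h : L2Line) : L2Line :=
  (memLp_symbolMul m n h).toLp _

/-- The Fourier transform on `L²(ℝ × 𝕋³)`,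
`(ℱ f)(ξ) = ∫ f(x) e^{-i x·ξ} dx` for `ξ ∈ ℝ × ℤ³`: Fourier coefficients in the periodic
variables followed by the Plancherel transform in the first variable. Mathlib's transform on the
line is `(𝓕 h)(s) = ∫ h(x) e^{-2π i x s} dx`, whence the rescaling. -/
def fourierTransform (f : L2Space) (ξ : Freq) : ℂ :=
  (𝓕 (partialCoeff f ξ.2) : L2Line) (ξ.1 / (2 * π))

/-- The Fourier multiplier operator on `L²(ℝ × 𝕋³)` with bounded continuous symbol `m`,
written through Fourier inversion. The series converges unconditionally in `L²`
(`summable_fourierMultiplier`) and `ℱ (T_m f) = m · ℱ f` (`fourierTransform_fourierMultiplier`). -/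
def fourierMultiplier (m : Freq →ᵇ ℂ) (f : L2Space) : L2Space :=
  (((2 * π) ^ 3)⁻¹ : ℂ) • ∑' n : Fin 3 → ℤ,
    tensorMode (𝓕⁻ (symbolMul m n (𝓕 (partialCoeff f n)))) n


theorem inner_tensorMode (g : L2Line) (n : Fin 3 → ℤ) (f : L2Space) :
    inner ℂ (tensorMode g n) f = inner ℂ g (partialCoeff f n) := by
  have h1 : inner ℂ (tensorMode g n) f
      = ∫ z : Space, conj (g z.1 * mode n z.2) * f z := by
    rw [L2.inner_def]
    refine integral_congr_ae ?_
    filter_upwards [(memLp_tensorMode g n).coeFn_toLp] with z hz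
    rw [tensorMode, hz, RCLike.inner_apply, mul_comm]
  have h2 : inner ℂ g (partialCoeff f n)
      = ∫ x : ℝ, conj (g x) * ∫ y : Torus3, conj (mode n y) * f (x, y) := by
    rw [L2.inner_def]
    refine integral_congr_ae ?_
    filter_upwards [(memLp_partialCoeff f n).coeFn_toLp] with x hx
    rw [partialCoeff, hx, RCLike.inner_apply, mul_comm]
  have hint : Integrable (fun z : Space => conj (g z.1 * mode n z.2) * f z) volume := by
    have := (memLp_tensorMode g n).star.integrable_mul (Lp.memLp f)
    exact this
  rw [h1, h2]
  refine (integral_prod _ hint).trans ?_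
  congr 1
  ext x
  rw [← integral_const_mul]
  congr 1
  ext y
  simp only [map_mul]
  ring

theorem integral_mode (n : Fin 3 → ℤ) :
    ∫ y : Torus3, mode n y = if n = 0 then ((2 * π) ^ 3 : ℂ) else 0 := by
  have h1 : ∀ k : ℤ, ∫ y : AddCircle (2 * π), fourier k y = if k = 0 then (2 * π : ℂ) else 0 := by
    intro k
    split_ifs with hk
    · subst hk
      simp [Measure.real, AddCircle.measure_univ, Real.pi_pos.le]
    · have := integral_eq_zero_of_add_right_eq_neg (μ := (volume : Measure (AddCircle (2 * π))))
        (fourier_add_half_inv_index hk Real.two_pi_pos)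
      exact this
  have h2 : ∫ y : Torus3, mode n y = ∏ k, ∫ y : AddCircle (2 * π), fourier (n k) y := by
    simp only [mode]
    exact integral_fintype_prod_volume_eq_prod (fun k => (fourier (n k) : AddCircle (2 * π) → ℂ))
  rw [h2]
  simp only [h1]
  split_ifs with hn
  · subst hn
    simp
  · obtain ⟨k, hk⟩ := Function.ne_iff.mp hn
    exact Finset.prod_eq_zero (Finset.mem_univ k) (if_neg hk)

theorem conj_mode_mul (n k : Fin 3 → ℤ) (y : Torus3) :
    conj (mode n y) * mode k y = mode (k - n) y := by
  simp only [mode, map_prod, ← Finset.prod_mul_distrib]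
  refine Finset.prod_congr rfl fun i _ => ?_
  rw [← fourier_neg, ← fourier_add, Pi.sub_apply, neg_add_eq_sub]

theorem partialCoeff_tensorMode (g : L2Line) (k n : Fin 3 → ℤ) :
    partialCoeff (tensorMode g k) n = if k = n then ((2 * π) ^ 3 : ℂ) • g else 0 := by
  have hz : ∀ᵐ x : ℝ, ∀ᵐ y : Torus3, tensorMode g k (x, y) = g x * mode k y :=
    Measure.ae_ae_of_ae_prod (memLp_tensorMode g k).coeFn_toLp
  have key : ∀ᵐ x : ℝ, partialCoeff (tensorMode g k) n x
      = (if k = n then ((2 * π) ^ 3 : ℂ) else 0) * g x := by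
    filter_upwards [hz, (memLp_partialCoeff (tensorMode g k) n).coeFn_toLp] with x hx hc
    rw [partialCoeff, hc]
    have : ∫ y : Torus3, conj (mode n y) * tensorMode g k (x, y)
        = ∫ y : Torus3, g x * mode (k - n) y := by
      refine integral_congr_ae ?_
      filter_upwards [hx] with y hy
      rw [hy, ← conj_mode_mul]
      ring
    rw [this, integral_const_mul, integral_mode, mul_comm]
    simp only [sub_eq_zero]
  apply Lp.ext
  split_ifs with h
  · filter_upwards [key, Lp.coeFn_smul ((2 * π) ^ 3 : ℂ) g] with x hx hs
    rw [hx, hs, if_pos h]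
    rfl
  · filter_upwards [key, Lp.coeFn_zero ℂ 2 (volume : Measure ℝ)] with x hx hs
    rw [hx, hs, if_neg h]
    simp
theorem inner_tensorMode_tensorMode (g h : L2Line) (n k : Fin 3 → ℤ) :
    inner ℂ (tensorMode g n) (tensorMode h k)
      = if k = n then ((2 * π) ^ 3 : ℂ) * inner ℂ g h else 0 := by
  rw [inner_tensorMode, partialCoeff_tensorMode]
  split_ifs
  · rw [inner_smul_right]
  · rw [inner_zero_right]

theorem norm_sq_sum_tensorMode (g : (Fin 3 → ℤ) → L2Line) (s : Finset (Fin 3 → ℤ)) :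
    ‖∑ n ∈ s, tensorMode (g n) n‖ ^ 2 = (2 * π) ^ 3 * ∑ n ∈ s, ‖g n‖ ^ 2 := by
  have h : inner ℂ (∑ n ∈ s, tensorMode (g n) n) (∑ n ∈ s, tensorMode (g n) n)
      = (((2 * π) ^ 3 * ∑ n ∈ s, ‖g n‖ ^ 2 : ℝ) : ℂ) := by
    rw [sum_inner, Complex.ofReal_mul, Complex.ofReal_sum, Finset.mul_sum]
    refine Finset.sum_congr rfl fun n hn => ?_
    rw [inner_sum, Finset.sum_eq_single_of_mem n hn, inner_tensorMode_tensorMode, if_pos rfl,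
      inner_self_eq_norm_sq_to_K]
    · push_cast
      rfl
    · intro k _ hk
      rw [inner_tensorMode_tensorMode, if_neg hk]
  rw [norm_sq_eq_re_inner (𝕜 := ℂ), h]
  exact Complex.ofReal_re _

/-- Bessel's inequality. -/
theorem summable_norm_sq_partialCoeff (f : L2Space) :
    Summable fun n => ‖partialCoeff f n‖ ^ 2 := by
  refine summable_of_sum_le (c := (2 * π) ^ 3 * ‖f‖ ^ 2) (fun n => sq_nonneg _) fun s => ?_
  set B := ∑ n ∈ s, ‖partialCoeff f n‖ ^ 2 with hB
  set S := ∑ n ∈ s, tensorMode (partialCoeff f n) n with hS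
  have h1 : inner ℂ S f = (B : ℂ) := by
    rw [hS, sum_inner, hB, Complex.ofReal_sum]
    refine Finset.sum_congr rfl fun n _ => ?_
    rw [inner_tensorMode, inner_self_eq_norm_sq_to_K]
    push_cast
    rfl
  have hB0 : 0 ≤ B := Finset.sum_nonneg fun n _ => sq_nonneg _
  have h2 : B ≤ ‖S‖ * ‖f‖ := by
    have := norm_inner_le_norm (𝕜 := ℂ) S f
    rwa [h1, Complex.norm_real, Real.norm_of_nonneg hB0] at this
  have h3 : ‖S‖ ^ 2 = (2 * π) ^ 3 * B := norm_sq_sum_tensorMode _ s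
  have key : ∀ b x y K : ℝ, 0 ≤ b → 0 ≤ K → b ≤ x * y → x ^ 2 = K * b → b ≤ K * y ^ 2 := by
    intro b x y K hb hK hxy hx
    rcases hb.eq_or_lt with h0 | h0
    · rw [← h0]
      positivity
    · have h4 : b * b ≤ (x * y) * (x * y) := mul_self_le_mul_self hb hxy
      have h5 : (x * y) * (x * y) = (K * y ^ 2) * b := by
        linear_combination y ^ 2 * hx
      exact le_of_mul_le_mul_right (h4.trans_eq h5) h0
  exact key B ‖S‖ ‖f‖ _ hB0 (by positivity) h2 h3

theorem summable_tensorMode (g : (Fin 3 → ℤ) → L2Line) (hg : Summable fun n => ‖g n‖ ^ 2) :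
    Summable fun n => tensorMode (g n) n := by
  rw [summable_iff_vanishing_norm]
  intro ε hε
  have hpos : 0 < (2 * π) ^ 3 := by positivity
  obtain ⟨s, hs⟩ := summable_iff_vanishing_norm.mp hg (ε ^ 2 / (2 * π) ^ 3) (by positivity)
  refine ⟨s, fun t ht => ?_⟩
  have h := hs t ht
  rw [Real.norm_of_nonneg (Finset.sum_nonneg fun n _ => sq_nonneg _), lt_div_iff₀ hpos,
    mul_comm, ← norm_sq_sum_tensorMode] at h
  exact lt_of_pow_lt_pow_left₀ 2 hε.le h

theorem norm_symbolMul_le (m : Freq →ᵇ ℂ) (n : Fin 3 → ℤ) (h : L2Line) :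
    ‖symbolMul m n h‖ ≤ ‖m‖ * ‖h‖ := by
  refine Lp.norm_le_mul_norm_of_ae_le_mul ?_
  filter_upwards [(memLp_symbolMul m n h).coeFn_toLp] with s hs
  rw [symbolMul, hs, norm_mul]
  gcongr
  exact m.norm_coe_le_norm _

/-- The series defining `fourierMultiplier` converges unconditionally in `L²(ℝ × 𝕋³)`. -/
theorem summable_fourierMultiplier (m : Freq →ᵇ ℂ) (f : L2Space) :
    Summable fun n : Fin 3 → ℤ =>
      tensorMode (𝓕⁻ (symbolMul m n (𝓕 (partialCoeff f n)))) n := by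
  refine summable_tensorMode _ ?_
  refine Summable.of_nonneg_of_le (fun n => sq_nonneg _) (fun n => ?_)
    ((summable_norm_sq_partialCoeff f).mul_left (‖m‖ ^ 2))
  have h : ‖(𝓕⁻ (symbolMul m n (𝓕 (partialCoeff f n))) : L2Line)‖
      = ‖symbolMul m n (𝓕 (partialCoeff f n))‖ :=
    (Lp.fourierTransformₗᵢ ℝ ℂ).symm.norm_map _
  rw [h, ← mul_pow]
  gcongr
  refine (norm_symbolMul_le _ _ _).trans_eq ?_
  rw [Lp.norm_fourier_eq]

theorem fourier_partialCoeff_fourierMultiplier (m : Freq →ᵇ ℂ) (f : L2Space) (n : Fin 3 → ℤ) :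
    (𝓕 (partialCoeff (fourierMultiplier m f) n) : L2Line)
      = symbolMul m n (𝓕 (partialCoeff f n)) := by
  have h : partialCoeff (fourierMultiplier m f) n
      = 𝓕⁻ (symbolMul m n (𝓕 (partialCoeff f n))) := by
    refine ext_inner_left ℂ fun v => ?_
    rw [← inner_tensorMode, fourierMultiplier, inner_smul_right]
    have hs := (innerSL ℂ (tensorMode v n)).map_tsum (summable_fourierMultiplier m f)
    simp only [innerSL_apply_apply] at hs
    rw [hs, tsum_eq_single n, inner_tensorMode_tensorMode, if_pos rfl, inv_mul_cancel_left₀]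
    · simp [Real.pi_ne_zero]
    · intro k hk
      rw [inner_tensorMode_tensorMode, if_neg hk]
  rw [h]
  exact FourierTransform.fourier_fourierInv_eq _

/-- `ℱ (T_m f) (ξ) = m(ξ) (ℱ f)(ξ)` for almost every `ξ ∈ ℝ × ℤ³`. -/
theorem fourierTransform_fourierMultiplier (m : Freq →ᵇ ℂ) (f : L2Space) (n : Fin 3 → ℤ) :
    ∀ᵐ ξ₁ : ℝ, fourierTransform (fourierMultiplier m f) (ξ₁, n)
      = m (ξ₁, n) * fourierTransform f (ξ₁, n) := by
  have hq : Measure.QuasiMeasurePreserving (fun ξ₁ : ℝ => ξ₁ / (2 * π)) := by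
    refine ⟨by fun_prop, ?_⟩
    have h := Real.map_volume_mul_right (a := (2 * π)⁻¹) (by positivity)
    simp only [div_eq_mul_inv]
    rw [h]
    exact Measure.smul_absolutelyContinuous
  filter_upwards [hq.ae (memLp_symbolMul m n (𝓕 (partialCoeff f n))).coeFn_toLp] with ξ₁ h
  rw [fourierTransform, fourierTransform, fourier_partialCoeff_fourierMultiplier, symbolMul, h]
  congr 3
  field_simp

/-- `|ξ|²` for `ξ ∈ ℝ × ℤ³`. -/
def freqSq (ξ : Freq) : ℝ := ξ.1 ^ 2 + ∑ k, (ξ.2 k : ℝ) ^ 2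

theorem continuous_freqSq : Continuous freqSq := by
  unfold freqSq
  fun_prop

/-- The symbol `e^{-it|ξ|²}`. -/
def schrodingerSymbol (t : ℝ) : Freq →ᵇ ℂ :=
  BoundedContinuousFunction.ofNormedAddCommGroup
    (fun ξ => Complex.exp (-Complex.I * t * freqSq ξ))
    (by have := continuous_freqSq; fun_prop) 1
    (fun ξ => by
      rw [Complex.norm_exp]
      simp)

/-- The free Schrödinger propagator `e^{itΔ}` on `L²(ℝ × 𝕋³)`. -/
def schrodingerPropagator (t : ℝ) (f : L2Space) : L2Space :=
  fourierMultiplier (schrodingerSymbol t) f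

/-- The cutoff functions `η¹ : ℝ → [0, 1]` used for the Littlewood-Paley projections: smooth, even,
equal to `1` for `|y| ≤ 1` and to `0` for `|y| ≥ 2`. -/
structure Cutoff where
  toFun : ℝ → ℝ
  smooth : ContDiff ℝ ∞ toFun
  even : ∀ y, toFun (-y) = toFun y
  nonneg : ∀ y, 0 ≤ toFun y
  le_one : ∀ y, toFun y ≤ 1
  eq_one : ∀ y, |y| ≤ 1 → toFun y = 1
  eq_zero : ∀ y, 2 ≤ |y| → toFun y = 0

/-- `η⁴(ξ) = η¹(ξ₁)² η¹(ξ₂)² η¹(ξ₃)² η¹(ξ₄)²`, rescaled: the function `ξ ↦ η⁴(ξ / M)`. -/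
def Cutoff.lowSymbol (η : Cutoff) (M : ℝ) : Freq →ᵇ ℂ :=
  BoundedContinuousFunction.ofNormedAddCommGroup
    (fun ξ => ((η.toFun (ξ.1 / M) ^ 2 * ∏ k, η.toFun (ξ.2 k / M) ^ 2 : ℝ) : ℂ))
    (by have := η.smooth.continuous; fun_prop) 1
    (fun ξ => by
      have h : ∀ y, 0 ≤ η.toFun y ^ 2 ∧ η.toFun y ^ 2 ≤ 1 := fun y =>
        ⟨sq_nonneg _, pow_le_one₀ (η.nonneg y) (η.le_one y)⟩
      rw [Complex.norm_real, Real.norm_of_nonneg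
        (mul_nonneg (h _).1 (Finset.prod_nonneg fun k _ => (h _).1))]
      exact mul_le_one₀ (h _).2 (Finset.prod_nonneg fun k _ => (h _).1)
        (Finset.prod_le_one (fun k _ => (h _).1) fun k _ => (h _).2))

/-- The Littlewood-Paley operator `P_{≤ M}`. -/
def lowProj (η : Cutoff) (M : ℝ) (f : L2Space) : L2Space :=
  fourierMultiplier (η.lowSymbol M) f

/-- The Littlewood-Paley operator `P_N` for the dyadic integer `N = 2^j`:
`P_1 = P_{≤ 1}` and `P_N = P_{≤ N} - P_{≤ N/2}` for `N ≥ 2`. -/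
def dyadicProj (η : Cutoff) : ℕ → L2Space → L2Space
  | 0, f => lowProj η 1 f
  | j + 1, f => lowProj η (2 ^ (j + 1)) f - lowProj η (2 ^ (j + 1) / 2) f

end SemiperiodicNLS

end

open SemiperiodicNLS

/-!
The proof is a `T T*` argument on level sets, applied to an explicit representative of the evolution.

Let `N = 2 ^ j`. A function with frequencies in a box of size `L = 2N` is a superposition of plane
waves whose amplitude `a` is square integrable for `freqMeasure L`: a Gaussian of width `L` on the
line, counting measure on the integer points of the cube `[-L, L]³`. The evolution is then the
function `waveSum` (`waveSum_amplitude_ae_eq`). For the synthesis operator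
`T : a ↦ waveSum a`, the kernel of `T T*` factors into a complex Gaussian integral on the line and
three one-dimensional quadratic Weyl sums. With `H = 2L`, Weyl differencing bounds it uniformly in
space by a multiple of
`κ(t) = (H⁻² + |t|)^{-1/2} V(t / π)^{3/2}`, where `V(θ) = ∑_{h ≤ H} (1/H + ‖hθ‖)⁻¹`
(`decayBound`, `weylMajorant`, `norm_kernel_le_decayBound`).

For a set `E` on which `|waveSum a| > r`, duality and `T T*` give
`r² |E|² ≤ ‖a‖² ‖T* Θ‖²` with `|Θ| ≤ 1_E`, and `‖T* Θ‖²` is a double integral over pairs of times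
`t, t'` in `[-1, 1]`. Where `κ(t - t') ≤ M` the kernel bound is used, which contributes
`M |E|²`; for the other pairs the Bessel inequality at fixed times contributes
`|{κ > M}| |E|`. With `M = r² / (2‖a‖²)` the first term is absorbed, and the layer cake formula
turns the level set estimate into
`∫ |waveSum a|^p ≲ ‖a‖² ∫_{|t| ≤ 2} (‖a‖² κ(t))^{p/2 - 1} dt`
(`DispersiveSystem.measure_lt_norm_waveSum_le`, `DispersiveSystem.lintegral_rpow_waveSum_le`).
No interpolation is needed.

It remains to bound the moment of `κ` of order `r = p/2 - 1`, where `p > 18/5` means `r > 4/5`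
(`exists_lintegral_decayBound_rpow_le`). For `|t| ≲ 1/H` one has `κ ≲ H^{3/2} (H⁻² + |t|)^{-5/4}`, and
since `5r/4 > 1` the integral is of the size `H^{4r - 2}` given by `|t| ≲ H⁻²`. Elsewhere, Young's
inequality bounds `κ^{4/5}` by `H^{6/5} ((H⁻² + |t|)⁻¹ + V²/H²)`. The second moment of `V` is at most
`H²` up to logarithms, by summing over Dirichlet arcs (`lintegral_weylMajorant_sq_le`), and a part
of the excess of `r` over `4/5` absorbs the logarithms. Since `4r - 2 = 2p - 6`, this is the power
`N^{2 - 6/p}`. The case `p = ∞` is the Cauchy–Schwarz inequality (`norm_waveSum_amplitude_le`).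
-/

/-! ### The Plancherel transform of integrable functions -/

/-- The multiplication formula for the Fourier integral on `L¹`. -/
theorem integral_fourier_mul_eq_of_integrable {f g : ℝ → ℂ} (hf : Integrable f)
    (hg : Integrable g) : ∫ x, 𝓕 f x * g x = ∫ x, f x * 𝓕 g x := by
  have := VectorFourier.integral_bilin_fourierIntegral_eq_flip (ContinuousLinearMap.mul ℂ ℂ)
    (L := innerₗ ℝ) (μ := volume) (ν := volume) Real.continuous_fourierChar
    continuous_inner hf hg
  simpa using! this

theorem continuous_fourier_of_integrable {f : ℝ → ℂ} (hf : Integrable f) :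
    Continuous (𝓕 f) :=
  VectorFourier.fourierIntegral_continuous Real.continuous_fourierChar
    continuous_inner hf

/-- The Plancherel transform of a function in `L¹ ∩ L²` is its Fourier integral: both have the same
pairing with test functions, by duality for the former and the multiplication formula for the
latter. -/
theorem L2Line.fourier_ae_eq (h : L2Line) (hi : Integrable h) :
    (𝓕 h : L2Line) =ᵐ[volume] 𝓕 (h : ℝ → ℂ) := by
  refine ae_eq_of_integral_contDiff_smul_eq
    ((Lp.memLp (𝓕 h : L2Line)).locallyIntegrable (by norm_num))
    (continuous_fourier_of_integrable hi).locallyIntegrable fun g hg hgc => ?_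
  have hc : HasCompactSupport fun x => (g x : ℂ) := hgc.comp_left (g := ((↑) : ℝ → ℂ)) rfl
  have hd : ContDiff ℝ ∞ fun x => (g x : ℂ) := Complex.ofRealCLM.contDiff.comp hg
  set φ := hc.toSchwartzMap hd with hφ
  have h1 := congrArg (fun T => T φ) (Lp.fourier_toTemperedDistribution_eq h)
  simp only [TemperedDistribution.fourier_apply, Lp.toTemperedDistribution_apply] at h1
  have h2 := integral_fourier_mul_eq_of_integrable (f := φ) (g := h) φ.integrable hi
  rw [SchwartzMap.fourier_coe] at h1
  simp only [smul_eq_mul] at h1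
  rw [h2] at h1
  simpa [hφ] using h1.symm

/-- The inverse Plancherel transform of a function in `L¹ ∩ L²` is its inverse Fourier integral. -/
theorem L2Line.fourierInv_ae_eq (h : L2Line) (hi : Integrable h) :
    (𝓕⁻ h : L2Line) =ᵐ[volume] 𝓕⁻ (h : ℝ → ℂ) := by
  have hcont : Continuous (𝓕⁻ (h : ℝ → ℂ)) := by
    have : 𝓕⁻ (h : ℝ → ℂ) = fun x => 𝓕 (h : ℝ → ℂ) (-x) := by
      ext x; rw [Real.fourierInv_eq_fourier_neg]
    rw [this]
    exact (continuous_fourier_of_integrable hi).comp continuous_neg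
  refine ae_eq_of_integral_contDiff_smul_eq
    ((Lp.memLp (𝓕⁻ h : L2Line)).locallyIntegrable (by norm_num))
    hcont.locallyIntegrable fun g hg hgc => ?_
  have hc : HasCompactSupport fun x => (g x : ℂ) := hgc.comp_left (g := ((↑) : ℝ → ℂ)) rfl
  have hd : ContDiff ℝ ∞ fun x => (g x : ℂ) := Complex.ofRealCLM.contDiff.comp hg
  set φ := hc.toSchwartzMap hd with hφ
  have h1 := congrArg (fun T => T φ) (Lp.fourierInv_toTemperedDistribution_eq h)
  simp only [TemperedDistribution.fourierInv_apply, Lp.toTemperedDistribution_apply] at h1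
  have h2 := integral_fourier_mul_eq_of_integrable (f := fun x => φ (-x)) (g := h)
    φ.integrable.comp_neg hi
  rw [SchwartzMap.fourierInv_coe] at h1
  simp only [smul_eq_mul] at h1
  have h3 : ∀ x, 𝓕⁻ (φ : ℝ → ℂ) x = 𝓕 (fun x => φ (-x)) x := by
    intro x
    rw [Real.fourierInv_eq_fourier_comp_neg]
  simp only [h3] at h1
  rw [h2] at h1
  have h4 : ∫ x, φ (-x) * 𝓕 (h : ℝ → ℂ) x = ∫ x, φ x * 𝓕⁻ (h : ℝ → ℂ) x := by
    rw [← integral_neg_eq_self]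
    simp [Real.fourierInv_eq_fourier_neg]
  rw [h4] at h1
  simpa [hφ] using h1.symm

/-! ### Level sets of wave superpositions -/

section LevelSets

section TimePhase

variable {Y : Type*}

/-- The factor `e^{-itφ(y)}` of an evolution with dispersion relation `φ`. -/
noncomputable def timePhase (φ : Y → ℝ) (t : ℝ) (y : Y) : ℂ := Complex.exp (-Complex.I * t * φ y)

theorem norm_timePhase (φ : Y → ℝ) (t : ℝ) (y : Y) : ‖timePhase φ t y‖ = 1 := by
  simp [timePhase, Complex.norm_exp]

theorem timePhase_mul_conj (φ : Y → ℝ) (t t' : ℝ) (y : Y) :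
    timePhase φ t y * conj (timePhase φ t' y) = timePhase φ (t - t') y := by
  simp only [timePhase, ← Complex.exp_conj, ← Complex.exp_add]
  congr 1
  simp
  ring

end TimePhase

variable {X Y Z W : Type*} [MeasurableSpace X] [MeasurableSpace Y] [MeasurableSpace Z]
  [MeasurableSpace W]

/-- Expansion of a product of two superpositions: the integral over `y` is taken innermost, so that
its cancellation can be used. The dominating functions `m` and `n` justify the interchange. -/
theorem enorm_integral_mul_conj_integral_le {ρ : Measure Z} {σ : Measure W} {ν : Measure Y}
    [SFinite ρ] [SFinite σ] [IsFiniteMeasure ν] {b : Z → Y → ℂ} {c : W → Y → ℂ} {w : Y → ℂ}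
    {m : Z → ℝ} {n : W → ℝ}
    (hb : StronglyMeasurable (Function.uncurry b)) (hc : StronglyMeasurable (Function.uncurry c))
    (hw : StronglyMeasurable w) (hw1 : ∀ y, ‖w y‖ ≤ 1)
    (hm : Integrable m ρ) (hn : Integrable n σ)
    (hbm : ∀ᵐ z ∂ρ, ∀ y, ‖b z y‖ ≤ m z) (hcn : ∀ᵐ z ∂σ, ∀ y, ‖c z y‖ ≤ n z) :
    ‖∫ y, (∫ z, b z y ∂ρ) * conj (∫ z, c z y ∂σ) * w y ∂ν‖ₑ
      ≤ ∫⁻ z, ∫⁻ z', ‖∫ y, b z y * conj (c z' y) * w y ∂ν‖ₑ ∂σ ∂ρ := by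
  set F : Y → Z × W → ℂ := fun y z => b z.1 y * conj (c z.2 y) * w y with hF
  have hFm : StronglyMeasurable (Function.uncurry F) := by
    have h1 : StronglyMeasurable fun q : Y × Z × W => b q.2.1 q.1 :=
      hb.comp_measurable (g := fun q : Y × Z × W => (q.2.1, q.1)) (by fun_prop)
    have h2 : StronglyMeasurable fun q : Y × Z × W => c q.2.2 q.1 :=
      hc.comp_measurable (g := fun q : Y × Z × W => (q.2.2, q.1)) (by fun_prop)
    have h3 : StronglyMeasurable fun q : Y × Z × W => w q.1 :=
      hw.comp_measurable (by fun_prop)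
    exact (h1.mul (RCLike.continuous_conj.comp_stronglyMeasurable h2)).mul h3
  have hFi : Integrable (Function.uncurry F) (ν.prod (ρ.prod σ)) := by
    have h0 : Integrable (fun z : Z × W => m z.1 * n z.2) (ρ.prod σ) := hm.mul_prod hn
    refine (h0.comp_snd ν).mono' hFm.aestronglyMeasurable ?_
    have h1 : ∀ᵐ z ∂(ρ.prod σ), ∀ y, ‖b z.1 y‖ ≤ m z.1 := Measure.quasiMeasurePreserving_fst.ae hbm
    have h2 : ∀ᵐ z ∂(ρ.prod σ), ∀ y, ‖c z.2 y‖ ≤ n z.2 := Measure.quasiMeasurePreserving_snd.ae hcn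
    have h3 : ∀ᵐ q ∂(ν.prod (ρ.prod σ)), (∀ y, ‖b q.2.1 y‖ ≤ m q.2.1) ∧
        ∀ y, ‖c q.2.2 y‖ ≤ n q.2.2 :=
      Measure.quasiMeasurePreserving_snd.ae (h1.and h2)
    filter_upwards [h3] with q hq
    simp only [Function.uncurry, hF, norm_mul, RCLike.norm_conj]
    calc _ ≤ ‖b q.2.1 q.1‖ * ‖c q.2.2 q.1‖ * 1 := by gcongr; exact hw1 _
      _ ≤ m q.2.1 * n q.2.2 * 1 := by
        gcongr
        · exact (norm_nonneg _).trans (hq.1 q.1)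
        · exact hq.1 _
        · exact hq.2 _
      _ = _ := mul_one _
  have h1 : ∀ y, (∫ z, b z y ∂ρ) * conj (∫ z, c z y ∂σ) * w y = ∫ z, F y z ∂(ρ.prod σ) := by
    intro y
    rw [← integral_conj, ← integral_prod_mul, ← integral_mul_const]
  simp only [h1]
  rw [integral_integral_swap hFi]
  refine (enorm_integral_le_lintegral_enorm _).trans (le_of_eq ?_)
  refine lintegral_prod _ ?_
  exact hFi.swap.integral_prod_left.1.enorm

/-- The Cauchy–Schwarz inequality. -/
theorem sq_lintegral_mul_le {ν : Measure Y} {f g : Y → ℝ≥0∞} (hf : AEMeasurable f ν)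
    (hg : AEMeasurable g ν) :
    (∫⁻ y, f y * g y ∂ν) ^ 2 ≤ (∫⁻ y, f y ^ 2 ∂ν) * ∫⁻ y, g y ^ 2 ∂ν := by
  have h := ENNReal.lintegral_mul_le_Lp_mul_Lq ν (Real.HolderConjugate.two_two) hf hg
  simp only [Pi.mul_apply, ENNReal.rpow_ofNat] at h
  calc _ ≤ ((∫⁻ y, f y ^ 2 ∂ν) ^ (1 / 2 : ℝ) * (∫⁻ y, g y ^ 2 ∂ν) ^ (1 / 2 : ℝ)) ^ 2 := by gcongr
    _ = _ := by
      rw [mul_pow, ← ENNReal.rpow_natCast, ← ENNReal.rpow_mul, ← ENNReal.rpow_natCast,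
        ← ENNReal.rpow_mul]
      norm_num

theorem measurable_timePhase {φ : Y → ℝ} (hφ : Measurable φ) :
    Measurable (fun q : ℝ × Y => timePhase φ q.1 q.2) := by
  unfold timePhase
  fun_prop

/-- The superposition `∫ a(y) e(x, y) e^{-itφ(y)} dν(y)` of the waves `e(·, y)` with
amplitudes `a`. -/
noncomputable def waveSum (ν : Measure Y) (e : X → Y → ℂ) (φ : Y → ℝ) (a : Y → ℂ) (z : X × ℝ) : ℂ :=
  ∫ y, a y * (e z.1 y * timePhase φ z.2 y) ∂ν

/-- Hypotheses under which a wave superposition obeys a level set estimate. Let `T` be the operator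
`a ↦ waveSum ν e φ a`. The kernel of `T T*` at time difference `t` is bounded by `κ t`, uniformly in
space, and at a fixed time `T*` satisfies a Bessel inequality with constant `B`. The latter is only
asked for functions dominated by an indicator, for which `μ A` replaces the square of the `L²`
norm. -/
structure DispersiveSystem (μ : Measure X) (ν : Measure Y) (e : X → Y → ℂ) (φ : Y → ℝ)
    (κ : ℝ → ℝ) (B : ℝ) : Prop where
  measurable_wave : Measurable (Function.uncurry e)
  norm_wave_le : ∀ x y, ‖e x y‖ ≤ 1
  measurable_phase : Measurable φ
  measurable_decay : Measurable κ
  norm_kernel_le : ∀ x x' t, ‖∫ y, e x y * conj (e x' y) * timePhase φ t y ∂ν‖ ≤ κ t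
  bessel : ∀ (Θ : X → ℂ) (A : Set X), Measurable Θ → MeasurableSet A → μ A < ⊤ →
    (∀ x, ‖Θ x‖ ≤ A.indicator 1 x) → ∫⁻ y, ‖∫ x, Θ x * e x y ∂μ‖ₑ ^ 2 ∂ν ≤ ENNReal.ofReal B * μ A

namespace DispersiveSystem

variable {μ : Measure X} {ν : Measure Y} {e : X → Y → ℂ} {φ : Y → ℝ} {κ : ℝ → ℝ} {B : ℝ}

theorem stronglyMeasurable_waveSum [SFinite ν] (h : DispersiveSystem μ ν e φ κ B) {a : Y → ℂ}
    (ha : AEStronglyMeasurable a ν) : StronglyMeasurable (waveSum ν e φ a) := by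
  have h1 : waveSum ν e φ a = waveSum ν e φ (ha.mk a) := by
    ext z
    refine integral_congr_ae ?_
    filter_upwards [ha.ae_eq_mk] with y hy
    rw [hy]
  rw [h1]
  have h2 : Measurable fun q : (X × ℝ) × Y =>
      ha.mk a q.2 * (e q.1.1 q.2 * timePhase φ q.1.2 q.2) := by
    have e1 : Measurable fun q : (X × ℝ) × Y => e q.1.1 q.2 :=
      h.measurable_wave.comp (g := Function.uncurry e) (f := fun q : (X × ℝ) × Y => (q.1.1, q.2))
        (by fun_prop)
    have e2 : Measurable fun q : (X × ℝ) × Y => timePhase φ q.1.2 q.2 :=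
      (measurable_timePhase h.measurable_phase).comp
        (f := fun q : (X × ℝ) × Y => (q.1.2, q.2)) (by fun_prop)
    have e3 : Measurable fun q : (X × ℝ) × Y => ha.mk a q.2 :=
      ha.stronglyMeasurable_mk.measurable.comp measurable_snd
    exact e3.mul (e1.mul e2)
  exact h2.stronglyMeasurable.integral_prod_right

/-- The slice at time `t` of a function on space-time, tested against the waves. -/
noncomputable def sliceCoeff (μ : Measure X) (e : X → Y → ℂ) (Θ : X × ℝ → ℂ) (t : ℝ) (y : Y) : ℂ :=
  ∫ x, Θ (x, t) * e x y ∂μ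

theorem measurable_sliceCoeff [SFinite μ] (h : DispersiveSystem μ ν e φ κ B) {Θ : X × ℝ → ℂ}
    (hΘ : Measurable Θ) : Measurable fun q : ℝ × Y => sliceCoeff μ e Θ q.1 q.2 := by
  have h2 : Measurable fun q : (ℝ × Y) × X => Θ (q.2, q.1.1) * e q.2 q.1.2 := by
    have e1 : Measurable fun q : (ℝ × Y) × X => e q.2 q.1.2 :=
      h.measurable_wave.comp (g := Function.uncurry e) (f := fun q : (ℝ × Y) × X => (q.2, q.1.2))
        (by fun_prop)
    exact (by fun_prop : Measurable fun q : (ℝ × Y) × X => Θ (q.2, q.1.1)).mul e1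
  exact h2.stronglyMeasurable.integral_prod_right.measurable

theorem enorm_sliceCoeff_le (h : DispersiveSystem μ ν e φ κ B) {Θ : X × ℝ → ℂ} {E : Set (X × ℝ)}
    (hE : MeasurableSet E) (hΘE : ∀ z, ‖Θ z‖ ≤ E.indicator 1 z) (t : ℝ) (y : Y) :
    ‖sliceCoeff μ e Θ t y‖ₑ ≤ μ ((fun x => (x, t)) ⁻¹' E) := by
  refine (enorm_integral_le_lintegral_enorm _).trans ?_
  rw [← lintegral_indicator_one (measurable_prodMk_right hE)]
  refine lintegral_mono fun x => ?_
  rw [enorm_mul]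
  have h1 : ‖e x y‖ₑ ≤ 1 := by
    rw [← ofReal_norm]
    exact (ENNReal.ofReal_le_ofReal (h.norm_wave_le x y)).trans_eq ENNReal.ofReal_one
  have h2 : ‖Θ (x, t)‖ₑ ≤ E.indicator 1 (x, t) := by
    rw [← ofReal_norm]
    refine (ENNReal.ofReal_le_ofReal (hΘE _)).trans (le_of_eq ?_)
    by_cases hx : (x, t) ∈ E <;> simp [hx]
  calc ‖Θ (x, t)‖ₑ * ‖e x y‖ₑ ≤ E.indicator 1 (x, t) * 1 := mul_le_mul' h2 h1
    _ = ((fun x => (x, t)) ⁻¹' E).indicator 1 x := by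
      by_cases hx : (x, t) ∈ E <;> simp [Set.indicator, hx]

/-- The interaction of two slices is controlled both by the dispersive bound and by Bessel's
inequality. -/
theorem enorm_interaction_le [SFinite μ] [IsFiniteMeasure ν]
    (h : DispersiveSystem μ ν e φ κ B) {Θ : X × ℝ → ℂ} {E : Set (X × ℝ)}
    (hE : MeasurableSet E) (hΘ : Measurable Θ) (hΘE : ∀ z, ‖Θ z‖ ≤ E.indicator 1 z) {t t' : ℝ}
    (ht : μ ((fun x => (x, t)) ⁻¹' E) < ⊤) (ht' : μ ((fun x => (x, t')) ⁻¹' E) < ⊤) :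
    ‖∫ y, sliceCoeff μ e Θ t y * conj (sliceCoeff μ e Θ t' y) * timePhase φ (t - t') y ∂ν‖ₑ
      ≤ ENNReal.ofReal (κ (t - t')) *
        (μ ((fun x => (x, t)) ⁻¹' E) * μ ((fun x => (x, t')) ⁻¹' E)) ∧
    ‖∫ y, sliceCoeff μ e Θ t y * conj (sliceCoeff μ e Θ t' y) * timePhase φ (t - t') y ∂ν‖ₑ
      ≤ ENNReal.ofReal B *
        (μ ((fun x => (x, t)) ⁻¹' E) + μ ((fun x => (x, t')) ⁻¹' E)) := by
  have hslice : ∀ s, ∀ x, ‖Θ (x, s)‖ ≤ ((fun x => (x, s)) ⁻¹' E).indicator 1 x := by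
    intro s x
    exact hΘE (x, s)
  have hslicem : ∀ s, Measurable fun x => Θ (x, s) := fun s => hΘ.comp (by fun_prop)
  have hph : ∀ s, Measurable (timePhase φ s) := fun s =>
    (measurable_timePhase h.measurable_phase).comp (f := fun y => (s, y)) (by fun_prop)
  constructor
  · have hmeas : ∀ s, StronglyMeasurable (Function.uncurry fun x y => Θ (x, s) * e x y) := by
      intro s
      refine Measurable.stronglyMeasurable ?_
      exact ((hslicem s).comp measurable_fst).mul h.measurable_wave
    have hbd : ∀ s, ∀ x y, ‖Θ (x, s) * e x y‖ ≤ ((fun x => (x, s)) ⁻¹' E).indicator 1 x := by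
      intro s x y
      rw [norm_mul]
      calc _ ≤ ‖Θ (x, s)‖ * 1 := by gcongr; exact h.norm_wave_le _ _
        _ ≤ _ := by rw [mul_one]; exact hslice s x
    have hint : ∀ s, μ ((fun x => (x, s)) ⁻¹' E) < ⊤ →
        Integrable (((fun x => (x, s)) ⁻¹' E).indicator (1 : X → ℝ)) μ := by
      intro s hs
      exact (integrableOn_const (C := (1 : ℝ)) hs.ne).integrable_indicator
        (measurable_prodMk_right hE)
    have key := enorm_integral_mul_conj_integral_le (ν := ν) (hmeas t) (hmeas t')
      (hph (t - t')).stronglyMeasurable (fun y => (norm_timePhase _ _ _).le)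
      (hint t ht) (hint t' ht') (ae_of_all _ (hbd t)) (ae_of_all _ (hbd t'))
    refine key.trans ?_
    have hpt : ∀ x x', ‖∫ y, Θ (x, t) * e x y * conj (Θ (x', t') * e x' y) *
        timePhase φ (t - t') y ∂ν‖ₑ ≤ ENNReal.ofReal (κ (t - t')) *
          (((fun x => (x, t)) ⁻¹' E).indicator 1 x * ((fun x => (x, t')) ⁻¹' E).indicator 1 x') := by
      intro x x'
      have e1 : ∫ y, Θ (x, t) * e x y * conj (Θ (x', t') * e x' y) * timePhase φ (t - t') y ∂ν
          = Θ (x, t) * conj (Θ (x', t')) *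
            ∫ y, e x y * conj (e x' y) * timePhase φ (t - t') y ∂ν := by
        rw [← integral_const_mul]
        congr 1
        ext y
        simp only [map_mul]
        ring
      have e2 : ∀ s x, ‖Θ (x, s)‖ₑ ≤ ((fun x => (x, s)) ⁻¹' E).indicator 1 x := by
        intro s x
        rw [← ofReal_norm]
        refine (ENNReal.ofReal_le_ofReal (hslice s x)).trans (le_of_eq ?_)
        by_cases hx : (x, s) ∈ E <;> simp [Set.indicator, hx]
      have e3 : ‖∫ y, e x y * conj (e x' y) * timePhase φ (t - t') y ∂ν‖ₑ
          ≤ ENNReal.ofReal (κ (t - t')) := by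
        rw [← ofReal_norm]
        exact ENNReal.ofReal_le_ofReal (h.norm_kernel_le _ _ _)
      have e4 : ‖conj (Θ (x', t'))‖ₑ = ‖Θ (x', t')‖ₑ := by
        rw [← ofReal_norm, RCLike.norm_conj, ofReal_norm]
      rw [e1, enorm_mul, enorm_mul, e4, mul_comm]
      gcongr
      · exact e2 t x
      · exact e2 t' x'
    refine (lintegral_mono fun x => lintegral_mono fun x' => hpt x x').trans (le_of_eq ?_)
    have m1 : Measurable (((fun x => (x, t)) ⁻¹' E).indicator (1 : X → ℝ≥0∞)) :=
      measurable_one.indicator (measurable_prodMk_right hE)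
    have m2 : Measurable (((fun x => (x, t')) ⁻¹' E).indicator (1 : X → ℝ≥0∞)) :=
      measurable_one.indicator (measurable_prodMk_right hE)
    simp only [lintegral_const_mul _ m2, lintegral_const_mul _ (m2.const_mul _)]
    rw [lintegral_const_mul _ (m1.mul_const _), lintegral_mul_const _ m1,
      lintegral_indicator_one (measurable_prodMk_right hE),
      lintegral_indicator_one (measurable_prodMk_right hE)]
  · refine (enorm_integral_le_lintegral_enorm _).trans ?_
    have hb := fun s hs => h.bessel (fun x => Θ (x, s)) _ (hslicem s)
      (measurable_prodMk_right hE) hs (hslice s)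
    calc _ ≤ ∫⁻ y, (‖sliceCoeff μ e Θ t y‖ₑ ^ 2 + ‖sliceCoeff μ e Θ t' y‖ₑ ^ 2) ∂ν := by
          refine lintegral_mono fun y => ?_
          have e1 : ‖timePhase φ (t - t') y‖ₑ = 1 := by
            rw [← ofReal_norm, norm_timePhase]; simp
          have e4 : ‖conj (sliceCoeff μ e Θ t' y)‖ₑ = ‖sliceCoeff μ e Θ t' y‖ₑ := by
            rw [← ofReal_norm, RCLike.norm_conj, ofReal_norm]
          rw [enorm_mul, enorm_mul, e1, e4, mul_one]
          rcases le_total ‖sliceCoeff μ e Θ t y‖ₑ ‖sliceCoeff μ e Θ t' y‖ₑ with hle | hle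
          · refine le_trans ?_ le_add_self
            rw [sq]; gcongr
          · refine le_trans ?_ le_self_add
            rw [sq]; gcongr
      _ = (∫⁻ y, ‖sliceCoeff μ e Θ t y‖ₑ ^ 2 ∂ν) + ∫⁻ y, ‖sliceCoeff μ e Θ t' y‖ₑ ^ 2 ∂ν := by
          refine lintegral_add_left ?_ _
          have := (h.measurable_sliceCoeff hΘ).comp (f := fun y : Y => (t, y)) (by fun_prop)
          exact (Measurable.enorm this).pow_const 2
      _ ≤ ENNReal.ofReal B * μ ((fun x => (x, t)) ⁻¹' E) +
          ENNReal.ofReal B * μ ((fun x => (x, t')) ⁻¹' E) := add_le_add (hb t ht) (hb t' ht')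
      _ = _ := (mul_add _ _ _).symm

/-- Lebesgue measure on the time interval `[-1, 1]`. -/
noncomputable abbrev timeMeasure : Measure ℝ := (volume : Measure ℝ).restrict (Set.Icc (-1) 1)

/-- Differences of two times in `[-1, 1]` lie in `[-2, 2]`. -/
theorem lintegral_lintegral_sub_indicator_le {S : Set ℝ} (hS : MeasurableSet S) (m : ℝ → ℝ≥0∞) :
    ∫⁻ t, (∫⁻ t', S.indicator 1 (t - t') * m t ∂timeMeasure) ∂timeMeasure
      ≤ volume (Set.Icc (-2) 2 ∩ S) * ∫⁻ t, m t ∂timeMeasure := by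
  have hm2 : MeasurableSet (Set.Icc (-2 : ℝ) 2 ∩ S) := measurableSet_Icc.inter hS
  have key : ∀ t ∈ Set.Icc (-1 : ℝ) 1,
      ∫⁻ t', S.indicator 1 (t - t') ∂timeMeasure ≤ volume (Set.Icc (-2) 2 ∩ S) := by
    intro t ht
    rw [← lintegral_indicator_one hm2,
      ← lintegral_sub_left_eq_self ((Set.Icc (-2 : ℝ) 2 ∩ S).indicator (1 : ℝ → ℝ≥0∞)) t,
      ← lintegral_indicator measurableSet_Icc]
    refine lintegral_mono fun t' => ?_
    by_cases h1 : t' ∈ Set.Icc (-1 : ℝ) 1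
    · rw [Set.indicator_of_mem h1]
      by_cases h2 : t - t' ∈ S
      · have h3 : t - t' ∈ Set.Icc (-2 : ℝ) 2 ∩ S := by
          refine ⟨⟨?_, ?_⟩, h2⟩ <;> linarith [ht.1, ht.2, h1.1, h1.2]
        rw [Set.indicator_of_mem h2, Set.indicator_of_mem h3]
      · rw [Set.indicator_of_notMem h2]
        exact zero_le
    · rw [Set.indicator_of_notMem h1]
      exact zero_le
  rw [← lintegral_const_mul' _ _ (measure_ne_top_of_subset Set.inter_subset_left
    (by simp [Real.volume_Icc]))]
  refine lintegral_mono_ae ?_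
  filter_upwards [ae_restrict_mem measurableSet_Icc] with t ht
  have hmt : Measurable fun t' : ℝ => S.indicator (1 : ℝ → ℝ≥0∞) (t - t') :=
    (measurable_one.indicator hS).comp (by fun_prop)
  rw [lintegral_mul_const _ hmt]
  gcongr
  exact key t ht

/-- Bound for `‖T* Θ‖²`: time differences where the kernel is at most `M` are estimated
by the dispersive bound, the others by Bessel's inequality. -/
theorem lintegral_enorm_sq_le [SigmaFinite μ] [IsFiniteMeasure ν]
    (h : DispersiveSystem μ ν e φ κ B) {Θ : X × ℝ → ℂ}
    {E : Set (X × ℝ)} (hE : MeasurableSet E) (hΘ : Measurable Θ)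
    (hΘE : ∀ z, ‖Θ z‖ ≤ E.indicator 1 z) (hfin : (μ.prod timeMeasure) E < ⊤) (M : ℝ) :
    ∫⁻ y, ‖∫ t, sliceCoeff μ e Θ t y * timePhase φ t y ∂timeMeasure‖ₑ ^ 2 ∂ν
      ≤ ENNReal.ofReal M * (μ.prod timeMeasure) E ^ 2 + 2 * ENNReal.ofReal B *
        volume (Set.Icc (-2) 2 ∩ {s | M < κ s}) * (μ.prod timeMeasure) E := by
  set m : ℝ → ℝ≥0∞ := fun t => μ ((fun x => (x, t)) ⁻¹' E) with hm
  have hmm : Measurable m := measurable_measure_prodMk_right hE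
  have hmE : ∫⁻ t, m t ∂timeMeasure = (μ.prod timeMeasure) E := (Measure.prod_apply_symm hE).symm
  have hmfin : ∀ᵐ t ∂timeMeasure, m t < ⊤ := ae_lt_top hmm (by rw [hmE]; exact hfin.ne)
  have hmi : Integrable (fun t => (m t).toReal) timeMeasure :=
    integrable_toReal_of_lintegral_ne_top hmm.aemeasurable (by rw [hmE]; exact hfin.ne)
  set b : ℝ → Y → ℂ := fun t y => sliceCoeff μ e Θ t y * timePhase φ t y with hb
  have hbm : Measurable (Function.uncurry b) :=
    (h.measurable_sliceCoeff hΘ).mul (measurable_timePhase h.measurable_phase)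
  have hble : ∀ᵐ t ∂timeMeasure, ∀ y, ‖b t y‖ ≤ (m t).toReal := by
    filter_upwards [hmfin] with t ht y
    rw [hb, norm_mul, norm_timePhase, mul_one, ← toReal_enorm]
    exact ENNReal.toReal_mono ht.ne (h.enorm_sliceCoeff_le hE hΘE t y)
  have hG : ∀ y, ‖∫ t, b t y ∂timeMeasure‖ ≤ ∫ t, (m t).toReal ∂timeMeasure := by
    intro y
    refine norm_integral_le_of_norm_le hmi ?_
    filter_upwards [hble] with t ht using ht y
  have hGm : StronglyMeasurable fun y => ∫ t, b t y ∂timeMeasure :=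
    hbm.stronglyMeasurable.integral_prod_left
  have hsq : ∫⁻ y, ‖∫ t, b t y ∂timeMeasure‖ₑ ^ 2 ∂ν
      = ‖∫ y, (∫ t, b t y ∂timeMeasure) * conj (∫ t, b t y ∂timeMeasure) * 1 ∂ν‖ₑ := by
    have hi : Integrable (fun y => ‖∫ t, b t y ∂timeMeasure‖ ^ 2) ν := by
      refine Integrable.of_bound (hGm.norm.pow 2).aestronglyMeasurable
        ((∫ t, (m t).toReal ∂timeMeasure) ^ 2) (ae_of_all _ fun y => ?_)
      rw [Real.norm_of_nonneg (sq_nonneg _)]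
      gcongr
      exact hG y
    have e1 : ∀ z : ℂ, z * conj z * 1 = ((‖z‖ ^ 2 : ℝ) : ℂ) := by
      intro z
      rw [mul_one, Complex.mul_conj, Complex.normSq_eq_norm_sq]
    simp only [e1]
    rw [integral_complex_ofReal, ← ofReal_norm]
    have e2 : ‖((∫ y, ‖∫ t, b t y ∂timeMeasure‖ ^ 2 ∂ν : ℝ) : ℂ)‖
        = ∫ y, ‖∫ t, b t y ∂timeMeasure‖ ^ 2 ∂ν := by
      rw [Complex.norm_real, Real.norm_of_nonneg (integral_nonneg fun y => sq_nonneg _)]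
    refine Eq.trans ?_ (congrArg ENNReal.ofReal e2.symm)
    rw [ofReal_integral_eq_lintegral_ofReal hi (ae_of_all _ fun y => sq_nonneg _)]
    refine lintegral_congr fun y => ?_
    rw [← ofReal_norm, ENNReal.ofReal_pow (norm_nonneg _)]
  rw [hsq]
  refine (enorm_integral_mul_conj_integral_le hbm.stronglyMeasurable hbm.stronglyMeasurable
    stronglyMeasurable_const (fun _ => by simp) hmi hmi hble hble).trans ?_
  set S : Set ℝ := {s | M < κ s} with hSdef
  have hS : MeasurableSet S := measurableSet_lt measurable_const h.measurable_decay
  have hptw : ∀ᵐ t ∂timeMeasure, ∀ᵐ t' ∂timeMeasure,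
      ‖∫ y, b t y * conj (b t' y) * 1 ∂ν‖ₑ ≤ ENNReal.ofReal M * m t * m t' +
        ENNReal.ofReal B * (S.indicator 1 (t - t') * m t + S.indicator 1 (t - t') * m t') := by
    filter_upwards [hmfin] with t ht
    filter_upwards [hmfin] with t' ht'
    have e1 : ∀ y, b t y * conj (b t' y) * 1
        = sliceCoeff μ e Θ t y * conj (sliceCoeff μ e Θ t' y) * timePhase φ (t - t') y := by
      intro y
      rw [← timePhase_mul_conj, hb]
      simp only [map_mul]
      ring
    simp only [e1]
    obtain ⟨k1, k2⟩ := h.enorm_interaction_le hE hΘ hΘE ht ht'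
    by_cases hs : t - t' ∈ S
    · refine (k2.trans (le_of_eq ?_)).trans le_add_self
      simp [Set.indicator_of_mem hs, hm]
    · refine (k1.trans ?_).trans le_self_add
      rw [mul_assoc]
      gcongr
      exact not_lt.mp hs
  have hswap : ∫⁻ t, (∫⁻ t', S.indicator 1 (t - t') * m t' ∂timeMeasure) ∂timeMeasure
      ≤ volume (Set.Icc (-2) 2 ∩ S) * ∫⁻ t, m t ∂timeMeasure := by
    have hSm : MeasurableSet (Neg.neg ⁻¹' S) := measurable_neg hS
    rw [lintegral_lintegral_swap]
    · have h2 := lintegral_lintegral_sub_indicator_le hSm m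
      have h3 : volume (Set.Icc (-2) 2 ∩ Neg.neg ⁻¹' S) = volume (Set.Icc (-2) 2 ∩ S) := by
        have : Set.Icc (-2 : ℝ) 2 ∩ Neg.neg ⁻¹' S = Neg.neg ⁻¹' (Set.Icc (-2) 2 ∩ S) := by
          ext s
          simp only [Set.mem_inter_iff, Set.mem_Icc, Set.mem_preimage]
          constructor <;> rintro ⟨⟨h1, h2⟩, h3⟩ <;> refine ⟨⟨?_, ?_⟩, h3⟩ <;> linarith
        rw [this]
        exact Measure.measure_preimage_neg _ _
      rw [h3] at h2
      refine le_trans (le_of_eq ?_) h2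
      refine lintegral_congr fun t => lintegral_congr fun t' => ?_
      congr 1
      simp [Set.indicator, neg_sub]
    · refine Measurable.aemeasurable ?_
      exact ((measurable_one.indicator hS).comp
        (by fun_prop : Measurable fun q : ℝ × ℝ => q.1 - q.2)).mul (hmm.comp measurable_snd)
  have hin : ∀ t, Measurable fun t' : ℝ => S.indicator (1 : ℝ → ℝ≥0∞) (t - t') := fun t =>
    (measurable_one.indicator hS).comp (by fun_prop)
  have hin2 : Measurable fun q : ℝ × ℝ => S.indicator (1 : ℝ → ℝ≥0∞) (q.1 - q.2) :=
    (measurable_one.indicator hS).comp (by fun_prop)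
  have hJ1 : Measurable fun t => ∫⁻ t', S.indicator 1 (t - t') * m t ∂timeMeasure :=
    (hin2.mul (hmm.comp measurable_fst)).lintegral_prod_right'
  calc _ ≤ ∫⁻ t, ∫⁻ t', (ENNReal.ofReal M * m t * m t' + ENNReal.ofReal B *
        (S.indicator 1 (t - t') * m t + S.indicator 1 (t - t') * m t')) ∂timeMeasure
        ∂timeMeasure := by
        refine lintegral_mono_ae ?_
        filter_upwards [hptw] with t ht
        exact lintegral_mono_ae ht
    _ = ∫⁻ t, (ENNReal.ofReal M * m t * (μ.prod timeMeasure) E + ENNReal.ofReal B *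
        ((∫⁻ t', S.indicator 1 (t - t') * m t ∂timeMeasure) +
          ∫⁻ t', S.indicator 1 (t - t') * m t' ∂timeMeasure)) ∂timeMeasure := by
        refine lintegral_congr fun t => ?_
        rw [lintegral_add_left (hmm.const_mul _), lintegral_const_mul _ hmm, hmE,
          lintegral_const_mul' _ _ ENNReal.ofReal_ne_top,
          lintegral_add_left ((hin t).mul_const _)]
    _ = ENNReal.ofReal M * (μ.prod timeMeasure) E ^ 2 + ENNReal.ofReal B *
        ((∫⁻ t, (∫⁻ t', S.indicator 1 (t - t') * m t ∂timeMeasure) ∂timeMeasure) +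
          ∫⁻ t, (∫⁻ t', S.indicator 1 (t - t') * m t' ∂timeMeasure) ∂timeMeasure) := by
        rw [lintegral_add_left ((hmm.const_mul _).mul_const _), lintegral_mul_const _
          (hmm.const_mul _), lintegral_const_mul _ hmm, hmE,
          lintegral_const_mul' _ _ ENNReal.ofReal_ne_top, lintegral_add_left hJ1]
        ring
    _ ≤ ENNReal.ofReal M * (μ.prod timeMeasure) E ^ 2 + ENNReal.ofReal B *
        (volume (Set.Icc (-2) 2 ∩ S) * (μ.prod timeMeasure) E +
          volume (Set.Icc (-2) 2 ∩ S) * (μ.prod timeMeasure) E) := by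
        gcongr
        · exact (lintegral_lintegral_sub_indicator_le hS m).trans_eq (by rw [hmE])
        · exact hswap.trans_eq (by rw [hmE])
    _ = _ := by ring

theorem norm_waveSum_le (h : DispersiveSystem μ ν e φ κ B) {a : Y → ℂ} (ha : Integrable a ν)
    (z : X × ℝ) : ‖waveSum ν e φ a z‖ ≤ ∫ y, ‖a y‖ ∂ν := by
  refine norm_integral_le_of_norm_le ha.norm (ae_of_all _ fun y => ?_)
  rw [norm_mul, norm_mul, norm_timePhase, mul_one]
  exact mul_le_of_le_one_right (norm_nonneg _) (h.norm_wave_le _ _)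

/-- Duality between `waveSum` and its adjoint. -/
theorem integral_waveSum_mul [SigmaFinite μ] [SFinite ν]
    (h : DispersiveSystem μ ν e φ κ B) {a : Y → ℂ} (ha : Integrable a ν) {Θ : X × ℝ → ℂ}
    (hΘ : Integrable Θ (μ.prod timeMeasure)) :
    ∫ z, waveSum ν e φ a z * Θ z ∂(μ.prod timeMeasure)
      = ∫ y, a y * ∫ t, sliceCoeff μ e Θ t y * timePhase φ t y ∂timeMeasure ∂ν := by
  have hw : Measurable fun q : (X × ℝ) × Y => e q.1.1 q.2 * timePhase φ q.1.2 q.2 := by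
    have e1 : Measurable fun q : (X × ℝ) × Y => e q.1.1 q.2 :=
      h.measurable_wave.comp (g := Function.uncurry e) (f := fun q : (X × ℝ) × Y => (q.1.1, q.2))
        (by fun_prop)
    have e2 : Measurable fun q : (X × ℝ) × Y => timePhase φ q.1.2 q.2 :=
      (measurable_timePhase h.measurable_phase).comp
        (f := fun q : (X × ℝ) × Y => (q.1.2, q.2)) (by fun_prop)
    exact e1.mul e2
  have hw1 : ∀ q : (X × ℝ) × Y, ‖e q.1.1 q.2 * timePhase φ q.1.2 q.2‖ ≤ 1 := by
    intro q
    rw [norm_mul, norm_timePhase, mul_one]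
    exact h.norm_wave_le _ _
  have hint : Integrable (Function.uncurry fun (z : X × ℝ) (y : Y) =>
      a y * (e z.1 y * timePhase φ z.2 y) * Θ z) ((μ.prod timeMeasure).prod ν) := by
    have h0 : Integrable (fun q : (X × ℝ) × Y => Θ q.1 * a q.2) ((μ.prod timeMeasure).prod ν) :=
      hΘ.mul_prod ha
    refine (h0.bdd_mul (c := 1) hw.aestronglyMeasurable (ae_of_all _ hw1)).congr
      (ae_of_all _ fun q => ?_)
    simp only [Function.uncurry]
    ring
  have e1 : ∀ z, waveSum ν e φ a z * Θ z
      = ∫ y, a y * (e z.1 y * timePhase φ z.2 y) * Θ z ∂ν := fun z =>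
    (integral_mul_const _ _).symm
  simp only [e1]
  rw [integral_integral_swap hint]
  congr 1
  ext y
  have hy : Integrable (fun z : X × ℝ => e z.1 y * timePhase φ z.2 y * Θ z)
      (μ.prod timeMeasure) := by
    refine hΘ.bdd_mul (c := 1) ?_ (ae_of_all _ fun z => hw1 (z, y))
    exact (hw.comp (f := fun z : X × ℝ => (z, y)) (by fun_prop)).aestronglyMeasurable
  calc _ = a y * ∫ z, e z.1 y * timePhase φ z.2 y * Θ z ∂(μ.prod timeMeasure) := by
        rw [← integral_const_mul]
        congr 1
        ext z
        ring
    _ = _ := by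
        rw [integral_prod_symm _ hy]
        congr 2
        ext t
        rw [sliceCoeff, ← integral_mul_const]
        congr 1
        ext x
        ring

/-- The `T T*` inequality for a set `E` on which the superposition `u` exceeds `r`: pairing `u` with
the phase of `u` on `E` gives at least `r |E|`, and at most `‖a‖ ‖T* Θ‖`. -/
theorem sq_measure_le [SigmaFinite μ] [IsFiniteMeasure ν]
    (h : DispersiveSystem μ ν e φ κ B) {a : Y → ℂ} (ha : MemLp a 2 ν) {r : ℝ}
    (hr : 0 < r) {E : Set (X × ℝ)} (hE : MeasurableSet E) (hfin : (μ.prod timeMeasure) E < ⊤)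
    (hEr : ∀ z ∈ E, r < ‖waveSum ν e φ a z‖) (M : ℝ) :
    (ENNReal.ofReal r * (μ.prod timeMeasure) E) ^ 2 ≤ (∫⁻ y, ‖a y‖ₑ ^ 2 ∂ν) *
      (ENNReal.ofReal M * (μ.prod timeMeasure) E ^ 2 + 2 * ENNReal.ofReal B *
        volume (Set.Icc (-2) 2 ∩ {s | M < κ s}) * (μ.prod timeMeasure) E) := by
  have hai : Integrable a ν := ha.integrable one_le_two
  set u := waveSum ν e φ a with hu
  have hum : Measurable u := (h.stronglyMeasurable_waveSum ha.1).measurable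
  -- `Θ` is the phase of `u` restricted to `E`, so that `u Θ = ‖u‖` there.
  set Θ : X × ℝ → ℂ := E.indicator fun z => conj (u z) / ‖u z‖ with hΘ
  have hΘm : Measurable Θ := by
    refine Measurable.indicator ?_ hE
    exact ((RCLike.continuous_conj.measurable).comp hum).div
      (Complex.measurable_ofReal.comp hum.norm)
  have hΘE : ∀ z, ‖Θ z‖ ≤ E.indicator 1 z := by
    intro z
    by_cases hz : z ∈ E
    · rw [hΘ, Set.indicator_of_mem hz, Set.indicator_of_mem hz, norm_div, RCLike.norm_conj,
        Complex.norm_real, norm_norm]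
      exact div_self_le_one _
    · rw [hΘ, Set.indicator_of_notMem hz, Set.indicator_of_notMem hz, norm_zero]
  have hΘi : Integrable Θ (μ.prod timeMeasure) := by
    refine Integrable.mono' ((integrableOn_const (C := (1 : ℝ)) hfin.ne).integrable_indicator hE)
      hΘm.aestronglyMeasurable (ae_of_all _ hΘE)
  have huΘ : ∀ z, u z * Θ z = ((E.indicator (fun z => ‖u z‖) z : ℝ) : ℂ) := by
    intro z
    by_cases hz : z ∈ E
    · have h0 : (‖u z‖ : ℂ) ≠ 0 := by
        exact_mod_cast (hr.trans (hEr z hz)).ne'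
      rw [hΘ, Set.indicator_of_mem hz, Set.indicator_of_mem hz, ← mul_div_assoc, Complex.mul_conj,
        Complex.normSq_eq_norm_sq]
      field_simp
      push_cast
      ring
    · rw [hΘ, Set.indicator_of_notMem hz, Set.indicator_of_notMem hz, mul_zero, Complex.ofReal_zero]
  have hle : ENNReal.ofReal r * (μ.prod timeMeasure) E
      ≤ ‖∫ z, u z * Θ z ∂(μ.prod timeMeasure)‖ₑ := by
    have hi : Integrable (E.indicator fun z => ‖u z‖) (μ.prod timeMeasure) := by
      refine Integrable.mono' (g := E.indicator fun _ => ∫ y, ‖a y‖ ∂ν)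
        ((integrableOn_const hfin.ne).integrable_indicator hE)
        (hum.norm.indicator hE).aestronglyMeasurable (ae_of_all _ fun z => ?_)
      by_cases hz : z ∈ E
      · rw [Set.indicator_of_mem hz, Set.indicator_of_mem hz, norm_norm]
        exact h.norm_waveSum_le hai z
      · rw [Set.indicator_of_notMem hz, Set.indicator_of_notMem hz, norm_zero]
    have hnn : ∀ z, 0 ≤ E.indicator (fun z => ‖u z‖) z := fun z =>
      Set.indicator_nonneg (fun _ _ => norm_nonneg _) z
    simp only [huΘ]
    rw [integral_complex_ofReal, ← ofReal_norm, Complex.norm_real,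
      Real.norm_of_nonneg (integral_nonneg hnn),
      ofReal_integral_eq_lintegral_ofReal hi (ae_of_all _ hnn), ← setLIntegral_const,
      ← lintegral_indicator hE]
    refine lintegral_mono fun z => ?_
    by_cases hz : z ∈ E
    · rw [Set.indicator_of_mem hz, Set.indicator_of_mem hz]
      exact ENNReal.ofReal_le_ofReal (hEr z hz).le
    · rw [Set.indicator_of_notMem hz]
      exact zero_le
  have hb : Measurable (Function.uncurry fun t y => sliceCoeff μ e Θ t y * timePhase φ t y) :=
    (h.measurable_sliceCoeff hΘm).mul (measurable_timePhase h.measurable_phase)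
  have hGm : StronglyMeasurable fun y =>
      ∫ t, sliceCoeff μ e Θ t y * timePhase φ t y ∂timeMeasure :=
    hb.stronglyMeasurable.integral_prod_left
  calc _ ≤ (∫⁻ y, ‖a y‖ₑ * ‖∫ t, sliceCoeff μ e Θ t y * timePhase φ t y ∂timeMeasure‖ₑ ∂ν) ^ 2 := by
        gcongr
        refine hle.trans ?_
        rw [h.integral_waveSum_mul hai hΘi]
        refine (enorm_integral_le_lintegral_enorm _).trans (le_of_eq ?_)
        simp only [enorm_mul]
    _ ≤ _ := sq_lintegral_mul_le ha.1.enorm hGm.aestronglyMeasurable.enorm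
    _ ≤ _ := by
        gcongr
        exact h.lintegral_enorm_sq_le hE hΘm hΘE hfin M

/-- The level set estimate: in the `T T*` inequality, the threshold `M = r² / (2A²)` makes the
dispersive part half of the left side, so that only the time differences with `κ > M` are left. -/
theorem measure_lt_norm_waveSum_le [SigmaFinite μ] [IsFiniteMeasure ν]
    (h : DispersiveSystem μ ν e φ κ B) (hB : 0 ≤ B) {a : Y → ℂ} (ha : MemLp a 2 ν) {A : ℝ}
    (hA : 0 < A) (haA : ∫⁻ y, ‖a y‖ₑ ^ 2 ∂ν ≤ ENNReal.ofReal (A ^ 2)) {r : ℝ} (hr : 0 < r) :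
    (μ.prod timeMeasure) {z | r < ‖waveSum ν e φ a z‖} ≤ ENNReal.ofReal (4 * A ^ 2 * B / r ^ 2) *
      volume (Set.Icc (-2) 2 ∩ {s | r ^ 2 / (2 * A ^ 2) < κ s}) := by
  set S := Set.Icc (-2 : ℝ) 2 ∩ {s | r ^ 2 / (2 * A ^ 2) < κ s} with hS
  have hSfin : volume S ≠ ⊤ := measure_ne_top_of_subset Set.inter_subset_left
    (by simp [Real.volume_Icc])
  have hum : Measurable (waveSum ν e φ a) := (h.stronglyMeasurable_waveSum ha.1).measurable
  have hmeas : MeasurableSet {z | r < ‖waveSum ν e φ a z‖} :=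
    measurableSet_lt measurable_const hum.norm
  by_contra hcon
  rw [not_le] at hcon
  -- The level set is not known to have finite measure, so a subset of finite measure is used.
  obtain ⟨E, hE, hEs, hE1, hE2⟩ := Measure.exists_subset_measure_lt_top hmeas hcon
  have key := h.sq_measure_le ha hr hE hE2 (fun z hz => hEs hz) (r ^ 2 / (2 * A ^ 2))
  have key2 := key.trans (mul_le_mul_left haA _)
  have hE3 : (μ.prod timeMeasure) E ≠ ⊤ := hE2.ne
  rw [← hS] at key2
  rw [← ENNReal.ofReal_toReal hSfin, ← ENNReal.ofReal_toReal hE3] at key2 hE1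
  set x := ((μ.prod timeMeasure) E).toReal with hx
  set w := (volume S).toReal with hw
  have hx0 : 0 ≤ x := ENNReal.toReal_nonneg
  have hw0 : 0 ≤ w := ENNReal.toReal_nonneg
  have h2 : (2 : ℝ≥0∞) = ENNReal.ofReal 2 := by simp
  rw [h2, ← ENNReal.ofReal_mul hr.le, ← ENNReal.ofReal_pow (by positivity),
    ← ENNReal.ofReal_pow hx0,
    ← ENNReal.ofReal_mul (by positivity), ← ENNReal.ofReal_mul (by positivity),
    ← ENNReal.ofReal_mul (by positivity), ← ENNReal.ofReal_mul (by positivity),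
    ← ENNReal.ofReal_add (by positivity) (by positivity), ← ENNReal.ofReal_mul (by positivity),
    ENNReal.ofReal_le_ofReal_iff (by positivity)] at key2
  rw [← ENNReal.ofReal_mul (by positivity), ENNReal.ofReal_lt_ofReal_iff_of_nonneg
    (by positivity)] at hE1
  have hxpos : 0 < x := lt_of_le_of_lt (by positivity) hE1
  have h3 : 4 * A ^ 2 * B * w < x * r ^ 2 := by
    rw [div_mul_eq_mul_div, div_lt_iff₀ (by positivity)] at hE1
    exact hE1
  have h4 : A ^ 2 * (r ^ 2 / (2 * A ^ 2) * x ^ 2) = r ^ 2 * x ^ 2 / 2 := by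
    field_simp
  nlinarith [mul_lt_mul_of_pos_right h3 hxpos]

/-- The `Lᵖ` estimate: the level set estimate integrated by the layer cake formula. -/
theorem lintegral_rpow_waveSum_le [SigmaFinite μ] [IsFiniteMeasure ν]
    (h : DispersiveSystem μ ν e φ κ B) (hB : 0 ≤ B) {a : Y → ℂ} (ha : MemLp a 2 ν) {A : ℝ}
    (hA : 0 < A) (haA : ∫⁻ y, ‖a y‖ₑ ^ 2 ∂ν ≤ ENNReal.ofReal (A ^ 2)) {p : ℝ} (hp : 2 < p) :
    ∫⁻ z, ENNReal.ofReal (‖waveSum ν e φ a z‖ ^ p) ∂(μ.prod timeMeasure)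
      ≤ ENNReal.ofReal (4 * A ^ 2 * B * p / (p - 2)) *
        ∫⁻ t in Set.Icc (-2) 2, ENNReal.ofReal (√(2 * A ^ 2 * κ t) ^ (p - 2)) := by
  have hum : Measurable (waveSum ν e φ a) := (h.stronglyMeasurable_waveSum ha.1).measurable
  have hp2 : 0 < p - 2 := by linarith
  have hκm : Measurable fun t => √(2 * A ^ 2 * κ t) := by
    have := h.measurable_decay
    fun_prop
  rw [lintegral_rpow_eq_lintegral_meas_lt_mul _ (ae_of_all _ fun z => norm_nonneg _)
    hum.norm.aemeasurable (by linarith : 0 < p),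
    lintegral_rpow_eq_lintegral_meas_lt_mul _ (ae_of_all _ fun t => Real.sqrt_nonneg _)
      hκm.aemeasurable hp2]
  have hpt : ∀ r ∈ Set.Ioi (0 : ℝ),
      (μ.prod timeMeasure) {z | r < ‖waveSum ν e φ a z‖} * ENNReal.ofReal (r ^ (p - 1)) ≤
        ENNReal.ofReal (4 * A ^ 2 * B) *
        ((volume.restrict (Set.Icc (-2) 2)) {t | r < √(2 * A ^ 2 * κ t)} *
          ENNReal.ofReal (r ^ (p - 2 - 1))) := by
    intro r hr
    rw [Set.mem_Ioi] at hr
    have h1 : {t | r < √(2 * A ^ 2 * κ t)} = {s | r ^ 2 / (2 * A ^ 2) < κ s} := by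
      ext t
      simp only [Set.mem_ofPred_eq]
      rw [Real.lt_sqrt hr.le, div_lt_iff₀' (by positivity)]
    rw [h1, Measure.restrict_apply (measurableSet_lt measurable_const h.measurable_decay),
      Set.inter_comm]
    refine (mul_le_mul_left (h.measure_lt_norm_waveSum_le hB ha hA haA hr) _).trans (le_of_eq ?_)
    have h2 : r ^ (p - 1) = r ^ 2 * r ^ (p - 2 - 1) := by
      rw [← Real.rpow_natCast, ← Real.rpow_add hr]
      congr 1
      push_cast
      ring
    have h3 : ENNReal.ofReal (4 * A ^ 2 * B / r ^ 2) * ENNReal.ofReal (r ^ (p - 1))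
        = ENNReal.ofReal (4 * A ^ 2 * B) * ENNReal.ofReal (r ^ (p - 2 - 1)) := by
      rw [← ENNReal.ofReal_mul (by positivity), ← ENNReal.ofReal_mul (by positivity), h2]
      congr 1
      field_simp
    calc _ = ENNReal.ofReal (4 * A ^ 2 * B / r ^ 2) * ENNReal.ofReal (r ^ (p - 1)) *
          volume (Set.Icc (-2) 2 ∩ {s | r ^ 2 / (2 * A ^ 2) < κ s}) := by ring
      _ = _ := by rw [h3]; ring
  calc _ ≤ ENNReal.ofReal p * ∫⁻ r in Set.Ioi 0, ENNReal.ofReal (4 * A ^ 2 * B) *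
        ((volume.restrict (Set.Icc (-2) 2)) {t | r < √(2 * A ^ 2 * κ t)} *
          ENNReal.ofReal (r ^ (p - 2 - 1))) := by
        refine mul_le_mul_right ?_ _
        exact setLIntegral_mono' measurableSet_Ioi hpt
    _ = _ := by
        rw [lintegral_const_mul' _ _ ENNReal.ofReal_ne_top, ← mul_assoc, ← mul_assoc,
          ← ENNReal.ofReal_mul (by linarith), ← ENNReal.ofReal_mul (by positivity)]
        congr 2
        field_simp

end DispersiveSystem

end LevelSets

/-! ### Quadratic Weyl sums -/

/-- Jordan's inequality, `‖·‖` being the distance to the nearest integer. -/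
theorem four_mul_norm_le_norm_exp_sub_one (x : ℝ) :
    4 * ‖(x : UnitAddCircle)‖ ≤ ‖Complex.exp (2 * π * Complex.I * x) - 1‖ := by
  set k : ℤ := round x with hk
  have h1 : Complex.exp (2 * π * Complex.I * x)
      = Complex.exp (Complex.I * ((2 * π * (x - k) : ℝ) : ℂ)) := by
    rw [Complex.exp_eq_exp_iff_exists_int]
    refine ⟨k, ?_⟩
    push_cast
    ring
  have h2 : |π * (x - k)| ≤ π / 2 := by
    rw [abs_mul, abs_of_pos Real.pi_pos]
    have := abs_sub_round x
    nlinarith [Real.pi_pos]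
  have h3 := Real.mul_abs_le_abs_sin h2
  rw [h1, Complex.norm_exp_I_mul_ofReal_sub_one, UnitAddCircle.norm_eq, norm_mul, Real.norm_eq_abs,
    Real.norm_eq_abs, abs_two, show 2 * π * (x - k) / 2 = π * (x - k) by ring]
  rw [abs_mul, abs_of_pos Real.pi_pos] at h3
  have h4 : 2 / π * (π * |x - k|) = 2 * |x - k| := by
    field_simp
  linarith

theorem sum_range_zpow_mul_sub_one {z : ℂ} (hz : z ≠ 0) (a : ℤ) (n : ℕ) :
    (∑ m ∈ Finset.range n, z ^ (a + m)) * (z - 1) = z ^ (a + n) - z ^ a := by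
  induction n with
  | zero => simp
  | succ n ih =>
    rw [Finset.sum_range_succ, add_mul, ih, Nat.cast_succ, ← add_assoc, zpow_add_one₀ hz]
    ring

theorem sum_Icc_int_eq_sum_range {M : Type*} [AddCommMonoid M] (a b : ℤ) (f : ℤ → M) :
    ∑ m ∈ Finset.Icc a b, f m = ∑ m ∈ Finset.range (b + 1 - a).toNat, f (a + m) := by
  refine Finset.sum_nbij' (fun m => (m - a).toNat) (fun m => a + m) ?_ ?_ ?_ ?_ ?_ <;>
    simp only [Finset.mem_Icc, Finset.mem_range] <;> intros <;> first | omega | skip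
  congr 1
  omega

/-- A geometric sum over at most `H + 1` consecutive integers. -/
theorem norm_sum_exp_le {H : ℕ} (hH : 0 < H) (a b : ℤ) (hab : b - a ≤ H) (x : ℝ) :
    ‖∑ m ∈ Finset.Icc a b, Complex.exp (2 * π * Complex.I * (m * x))‖
      ≤ 3 / (1 / H + ‖(x : UnitAddCircle)‖) := by
  have hH1 : (1 : ℝ) ≤ H := by exact_mod_cast hH
  set z := Complex.exp (2 * π * Complex.I * x) with hz
  have hz1 : ‖z‖ = 1 := by
    rw [hz, Complex.norm_exp]
    simp
  have hz0 : z ≠ 0 := Complex.exp_ne_zero _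
  have hterm : ∀ m : ℤ, Complex.exp (2 * π * Complex.I * (m * x)) = z ^ m := by
    intro m
    rw [hz, ← Complex.exp_int_mul]
    congr 1
    ring
  simp only [hterm]
  rw [sum_Icc_int_eq_sum_range]
  set n := (b + 1 - a).toNat with hn
  have hnH : (n : ℝ) ≤ H + 1 := by
    have : n ≤ H + 1 := by omega
    exact_mod_cast this
  set S := ∑ m ∈ Finset.range n, z ^ (a + m) with hS
  have h1 : ‖S‖ ≤ H + 1 := by
    refine (norm_sum_le _ _).trans ?_
    simpa [norm_zpow, hz1] using hnH
  have h2 : ‖S‖ * (4 * ‖(x : UnitAddCircle)‖) ≤ 2 := by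
    calc _ ≤ ‖S‖ * ‖z - 1‖ := by gcongr; exact four_mul_norm_le_norm_exp_sub_one x
      _ = ‖z ^ (a + n) - z ^ a‖ := by rw [← norm_mul, sum_range_zpow_mul_sub_one hz0]
      _ ≤ ‖z ^ (a + (n : ℤ))‖ + ‖z ^ a‖ := norm_sub_le _ _
      _ = 2 := by rw [norm_zpow, norm_zpow, hz1, one_zpow, one_zpow]; norm_num
  rw [le_div_iff₀ (by positivity), mul_add]
  have h3 : ‖S‖ * (1 / H) ≤ 2 := by
    rw [mul_one_div, div_le_iff₀ (by positivity)]
    linarith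
  linarith

/-- The majorant `∑_{h ≤ H} (1/H + ‖hθ‖)⁻¹ ≍ ∑_{h ≤ H} min(H, 1/‖hθ‖)` of the square of a quadratic
Weyl sum, `‖·‖` being the distance to the nearest integer. -/
noncomputable def weylMajorant (H : ℕ) (θ : ℝ) : ℝ :=
  ∑ h ∈ Finset.Icc 1 H, 1 / (1 / (H : ℝ) + ‖((h * θ : ℝ) : UnitAddCircle)‖)

theorem weylMajorant_nonneg (H : ℕ) (θ : ℝ) : 0 ≤ weylMajorant H θ :=
  Finset.sum_nonneg fun _ _ => by positivity

theorem continuous_weylMajorant {H : ℕ} (hH : 0 < H) : Continuous (weylMajorant H) := by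
  refine continuous_finsetSum _ fun h _ => ?_
  refine continuous_const.div ?_ fun θ => ?_
  · exact continuous_const.add (continuous_norm.comp
      ((AddCircle.continuous_mk' 1).comp (by fun_prop : Continuous fun θ : ℝ => (h : ℝ) * θ)))
  · have : (0 : ℝ) < H := by exact_mod_cast hH
    positivity

theorem le_weylMajorant (H : ℕ) (θ : ℝ) : 2 * (H : ℝ) / 3 ≤ weylMajorant H θ := by
  have h1 : ∀ h ∈ Finset.Icc 1 H,
      2 / 3 ≤ 1 / (1 / (H : ℝ) + ‖((h * θ : ℝ) : UnitAddCircle)‖) := by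
    intro h hh
    have hH : (1 : ℝ) ≤ H := by
      have := Finset.mem_Icc.mp hh
      exact_mod_cast this.1.trans this.2
    have h2 : ‖((h * θ : ℝ) : UnitAddCircle)‖ ≤ 1 / 2 := by
      rw [UnitAddCircle.norm_eq]
      exact abs_sub_round _
    have h3 : 1 / (H : ℝ) ≤ 1 := by
      rw [div_le_one (by linarith)]
      exact hH
    rw [le_div_iff₀ (by positivity)]
    linarith
  have := Finset.card_nsmul_le_sum _ _ _ h1
  simp only [Nat.card_Icc, Nat.add_sub_cancel, nsmul_eq_mul] at this
  refine le_trans (le_of_eq ?_) this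
  ring

/-- Weyl differencing for quadratic exponential sums, uniformly in the linear coefficient. The
differences of two points of `[-L, L]` reach `2L`, whence the length of the majorant. -/
theorem norm_sq_sum_quadratic_le {L : ℕ} (hL : 0 < L) (α t : ℝ) :
    ‖∑ n ∈ Finset.Icc (-L : ℤ) L, Complex.exp (Complex.I * (n * α - t * n ^ 2))‖ ^ 2
      ≤ 11 * weylMajorant (2 * L) (t / π) := by
  set I := Finset.Icc (-L : ℤ) L with hI
  set z : ℤ → ℂ := fun n => Complex.exp (Complex.I * (n * α - t * n ^ 2)) with hz
  set K := Finset.Icc (-(2 * L : ℕ) : ℤ) (2 * L : ℕ) with hK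
  set F : ℤ → ℝ := fun h => 3 / (1 / ((2 * L : ℕ) : ℝ) + ‖((h * (t / π) : ℝ) : UnitAddCircle)‖)
    with hF
  -- In the expanded square, put `n = m + h`.
  have hexpand : ((‖∑ n ∈ I, z n‖ ^ 2 : ℝ) : ℂ)
      = ∑ h ∈ K, ∑ m ∈ Finset.Icc (max (-L : ℤ) (-L - h)) (min (L : ℤ) (L - h)),
        z (m + h) * conj (z m) := by
    rw [← Complex.normSq_eq_norm_sq, ← Complex.mul_conj, map_sum, Finset.sum_mul_sum,
      ← Finset.sum_product', ← Finset.sum_fiberwise_of_maps_to (t := K)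
        (g := fun q : ℤ × ℤ => q.1 - q.2)]
    · refine Finset.sum_congr rfl fun h _ => ?_
      refine Finset.sum_nbij' (fun q => q.2) (fun m => (m + h, m)) ?_ ?_ ?_ ?_ ?_
      · rintro ⟨n, m⟩ hq
        simp only [hI, Finset.mem_filter, Finset.mem_product, Finset.mem_Icc] at hq ⊢
        omega
      · intro m hm
        simp only [hI, Finset.mem_filter, Finset.mem_product, Finset.mem_Icc] at hm ⊢
        omega
      · rintro ⟨n, m⟩ hq
        simp only [Finset.mem_filter] at hq
        simp only [Prod.mk.injEq, and_true]
        omega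
      · intro m _
        rfl
      · rintro ⟨n, m⟩ hq
        simp only [Finset.mem_filter] at hq
        have : n = m + h := by omega
        simp only [this]
    · rintro ⟨n, m⟩ hq
      simp only [hI, hK, Finset.mem_product, Finset.mem_Icc] at hq ⊢
      omega
  have hinner : ∀ h ∈ K, ‖∑ m ∈ Finset.Icc (max (-L : ℤ) (-L - h)) (min (L : ℤ) (L - h)),
      z (m + h) * conj (z m)‖ ≤ F h := by
    intro h _
    -- The quadratic part in `m` cancels, which leaves a geometric sum.
    have h1 : ∀ m : ℤ, z (m + h) * conj (z m) = Complex.exp (Complex.I * (h * α - t * h ^ 2)) *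
        Complex.exp (2 * π * Complex.I * (m * ((-(h * (t / π)) : ℝ) : ℂ))) := by
      intro m
      simp only [hz, ← Complex.exp_conj, ← Complex.exp_add]
      congr 1
      have := Real.pi_ne_zero
      simp
      field_simp
      ring
    simp only [h1]
    rw [← Finset.mul_sum, norm_mul]
    have h2 : ‖Complex.exp (Complex.I * (h * α - t * h ^ 2))‖ = 1 := by
      have : (Complex.I * (h * α - t * h ^ 2) : ℂ) = ((h * α - t * h ^ 2 : ℝ) : ℂ) * Complex.I := by
        push_cast
        ring
      rw [this, Complex.norm_exp_ofReal_mul_I]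
    rw [h2, one_mul]
    refine (norm_sum_exp_le (H := 2 * L) (by omega) _ _ ?_ _).trans (le_of_eq ?_)
    · push_cast
      omega
    · rw [hF, AddCircle.coe_neg, norm_neg]
  have hFeven : Function.Even F := by
    intro h
    simp only [hF]
    push_cast
    rw [neg_mul, AddCircle.coe_neg, norm_neg]
  have h1 : ‖∑ n ∈ I, z n‖ ^ 2 ≤ ∑ h ∈ K, F h := by
    have h2 : ‖∑ n ∈ I, z n‖ ^ 2 = ‖((‖∑ n ∈ I, z n‖ ^ 2 : ℝ) : ℂ)‖ := by
      rw [Complex.norm_real, Real.norm_of_nonneg (sq_nonneg _)]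
    rw [h2, hexpand]
    exact (norm_sum_le _ _).trans (Finset.sum_le_sum hinner)
  have h3 : ∑ h ∈ K, F h = F 0 + 6 * weylMajorant (2 * L) (t / π) := by
    rw [hK, Finset.sum_Icc_of_even_eq_range hFeven, Finset.sum_range_succ']
    have h4 : ∑ k ∈ Finset.range (2 * L), F ((k + 1 : ℕ) : ℤ)
        = 3 * weylMajorant (2 * L) (t / π) := by
      have h5 : Finset.Icc 1 (2 * L) = Finset.Ico 1 (2 * L + 1) := by
        ext k
        simp only [Finset.mem_Icc, Finset.mem_Ico]
        omega
      rw [weylMajorant, Finset.mul_sum, h5, Finset.sum_Ico_eq_sum_range]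
      refine Finset.sum_congr (by simp) fun k _ => ?_
      simp only [hF, mul_one_div]
      push_cast
      rw [add_comm (k : ℝ) 1]
    rw [Nat.cast_zero, h4, two_nsmul]
    ring
  have h6 : F 0 = 3 * ((2 * L : ℕ) : ℝ) := by
    simp [hF]
    field_simp
  have h7 := le_weylMajorant (2 * L) (t / π)
  linarith

/-! ### The Weyl majorant on Dirichlet arcs -/

theorem sum_range_mul_natCast_zmod {q : ℕ} [NeZero q] (F : ZMod q → ℝ) (m : ℕ) :
    ∑ h ∈ Finset.range (m * q), F (h : ZMod q) = m * ∑ c, F c := by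
  induction m with
  | zero => simp
  | succ m ih =>
    rw [add_mul, one_mul, Finset.sum_range_add, ih]
    have h1 : ∑ r ∈ Finset.range q, F ((m * q + r : ℕ) : ZMod q) = ∑ c, F c := by
      refine Finset.sum_nbij' (fun r => (r : ZMod q)) (fun c => c.val) ?_ ?_ ?_ ?_ ?_
      · simp
      · intro c _
        exact Finset.mem_range.mpr (ZMod.val_lt c)
      · intro r hr
        exact ZMod.val_cast_of_lt (Finset.mem_range.mp hr)
      · intro c _
        exact ZMod.natCast_zmod_val c
      · intro r _
        simp
    rw [h1]
    push_cast
    ring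

/-- The integers `1, …, H` are covered by `⌊H / q⌋ + 1` complete residue systems modulo `q`. -/
theorem sum_Icc_natCast_zmod_le {q : ℕ} [NeZero q] {F : ZMod q → ℝ} (hF : ∀ c, 0 ≤ F c) (H : ℕ) :
    ∑ h ∈ Finset.Icc 1 H, F (h : ZMod q) ≤ ((H : ℝ) / q + 1) * ∑ c, F c := by
  have hq : 0 < q := Nat.pos_of_ne_zero (NeZero.ne q)
  calc _ ≤ ∑ h ∈ Finset.range ((H / q + 1) * q), F (h : ZMod q) := by
        refine Finset.sum_le_sum_of_subset_of_nonneg (fun h hh => ?_) fun _ _ _ => hF _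
        have h1 := (Finset.mem_Icc.mp hh).2
        have h2 := Nat.lt_div_mul_add hq (a := H)
        rw [Finset.mem_range]
        linarith
    _ = ((H / q + 1 : ℕ) : ℝ) * ∑ c, F c := sum_range_mul_natCast_zmod F _
    _ ≤ _ := by
        gcongr
        · exact Finset.sum_nonneg fun _ _ => hF _
        · push_cast
          gcongr
          exact Nat.cast_div_le

theorem min_le_norm_coe (x : ℝ) : min x (1 - x) ≤ ‖(x : UnitAddCircle)‖ := by
  rw [UnitAddCircle.norm_eq]
  rcases le_or_gt (round x) 0 with h | h
  · have : ((round x : ℤ) : ℝ) ≤ 0 := by exact_mod_cast h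
    refine (min_le_left _ _).trans (le_trans ?_ (le_abs_self _))
    linarith
  · have : (1 : ℝ) ≤ ((round x : ℤ) : ℝ) := by exact_mod_cast h
    refine (min_le_right _ _).trans (le_trans ?_ (neg_le_abs _))
    linarith

theorem toAddCircle_eq_val_div {q : ℕ} [NeZero q] (c : ZMod q) :
    ZMod.toAddCircle c = ((c.val / q : ℝ) : UnitAddCircle) := by
  rw [← ZMod.toAddCircle_natCast, ZMod.natCast_zmod_val]

theorem one_div_le_norm_toAddCircle {q : ℕ} [NeZero q] {c : ZMod q} (hc : c ≠ 0) :
    1 / (q : ℝ) ≤ ‖ZMod.toAddCircle c‖ := by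
  have hq : (0 : ℝ) < q := by exact_mod_cast Nat.pos_of_ne_zero (NeZero.ne q)
  rw [toAddCircle_eq_val_div]
  refine le_trans ?_ (min_le_norm_coe _)
  have h1 : (1 : ℝ) ≤ c.val := by
    exact_mod_cast Nat.one_le_iff_ne_zero.mpr ((ZMod.val_ne_zero c).mpr hc)
  have h2 : (c.val : ℝ) + 1 ≤ q := by exact_mod_cast ZMod.val_lt c
  refine le_min ?_ ?_
  · gcongr
  · rw [le_sub_iff_add_le, ← add_div, div_le_one hq]
    linarith

theorem cast_harmonic (n : ℕ) : ((harmonic n : ℚ) : ℝ) = ∑ i ∈ Finset.range n, 1 / ((i : ℝ) + 1) := by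
  simp [harmonic]

theorem sum_range_inv_le (n : ℕ) : ∑ i ∈ Finset.range n, 1 / ((i : ℝ) + 1) ≤ 1 + Real.log n := by
  rw [← cast_harmonic]
  exact harmonic_le_one_add_log n

theorem sum_Icc_inv_le (n : ℕ) : ∑ i ∈ Finset.Icc 1 n, 1 / (i : ℝ) ≤ 1 + Real.log n := by
  have h5 : Finset.Icc 1 n = Finset.Ico 1 (n + 1) := by
    ext k
    simp only [Finset.mem_Icc, Finset.mem_Ico]
    omega
  rw [h5, Finset.sum_Ico_eq_sum_range]
  refine le_trans (le_of_eq ?_) (sum_range_inv_le n)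
  refine Finset.sum_congr (by simp) fun k _ => ?_
  push_cast
  rw [add_comm (k : ℝ) 1]

/-- The nonzero residues modulo `q` are `1/q`-separated on the circle, so the sum of their inverse
distances to `0` is harmonic. The term `c = 0` is the junk value `0⁻¹ = 0`. -/
theorem sum_inv_norm_toAddCircle_le (q : ℕ) [NeZero q] :
    ∑ c : ZMod q, ‖ZMod.toAddCircle c‖⁻¹ ≤ 2 * q * (1 + Real.log q) := by
  have hq : (0 : ℝ) < q := by exact_mod_cast Nat.pos_of_ne_zero (NeZero.ne q)
  have h1 : ∀ c : ZMod q, ‖ZMod.toAddCircle c‖⁻¹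
      ≤ q * (1 / (c.val : ℝ) + 1 / (q - c.val : ℝ)) := by
    intro c
    have h2 : (c.val : ℝ) + 1 ≤ q := by exact_mod_cast ZMod.val_lt c
    have h3 : (0 : ℝ) < q - c.val := by linarith
    by_cases hc : c = 0
    · subst hc
      simp
    · have h1 : (1 : ℝ) ≤ c.val := by
        exact_mod_cast Nat.one_le_iff_ne_zero.mpr ((ZMod.val_ne_zero c).mpr hc)
      rw [toAddCircle_eq_val_div]
      have h4 := min_le_norm_coe ((c.val : ℝ) / q)
      have h5 : 1 - (c.val : ℝ) / q = (q - c.val) / q := by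
        field_simp
      rw [h5] at h4
      rw [mul_add, mul_one_div, mul_one_div]
      rcases min_choice ((c.val : ℝ) / q) ((q - c.val) / q) with h6 | h6
      · rw [h6] at h4
        calc _ ≤ ((c.val : ℝ) / q)⁻¹ := inv_anti₀ (by positivity) h4
          _ = q / c.val := inv_div _ _
          _ ≤ _ := le_add_of_nonneg_right (by positivity)
      · rw [h6] at h4
        calc _ ≤ ((q - c.val : ℝ) / q)⁻¹ := inv_anti₀ (by positivity) h4
          _ = q / (q - c.val) := inv_div _ _
          _ ≤ _ := le_add_of_nonneg_left (by positivity)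
  have h2 : ∑ c : ZMod q, (q : ℝ) * (1 / (c.val : ℝ) + 1 / (q - c.val : ℝ))
      = q * ∑ r ∈ Finset.range q, (1 / (r : ℝ) + 1 / (q - r : ℝ)) := by
    rw [← Finset.mul_sum]
    congr 1
    refine Finset.sum_nbij' (fun c => c.val) (fun r => (r : ZMod q)) ?_ ?_ ?_ ?_ ?_
    · intro c _
      exact Finset.mem_range.mpr (ZMod.val_lt c)
    · simp
    · intro c _
      exact ZMod.natCast_zmod_val c
    · intro r hr
      exact ZMod.val_cast_of_lt (Finset.mem_range.mp hr)
    · intro c _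
      rfl
  have h3 : ∑ r ∈ Finset.range q, 1 / (r : ℝ) ≤ 1 + Real.log q := by
    refine le_trans ?_ (sum_range_inv_le q)
    calc _ ≤ ∑ r ∈ Finset.range (q + 1), 1 / (r : ℝ) := by
          refine Finset.sum_le_sum_of_subset_of_nonneg (by simp) fun _ _ _ => by positivity
      _ = _ := by
          rw [Finset.sum_range_succ']
          simp
  have h4 : ∑ r ∈ Finset.range q, 1 / (q - r : ℝ) ≤ 1 + Real.log q := by
    refine le_trans (le_of_eq ?_) (sum_range_inv_le q)
    rw [← Finset.sum_range_reflect]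
    refine Finset.sum_congr rfl fun r hr => ?_
    have := Finset.mem_range.mp hr
    rw [Nat.cast_sub (by omega), Nat.cast_sub (by omega)]
    congr 1
    push_cast
    ring
  calc _ ≤ _ := Finset.sum_le_sum fun c _ => h1 c
    _ = _ := h2
    _ ≤ q * ((1 + Real.log q) + (1 + Real.log q)) := by
        rw [Finset.sum_add_distrib]
        gcongr
    _ = _ := by ring

/-- On a Dirichlet arc around `a/q`, the multiples of `q` contribute the main term of
`weylMajorant`, the one that depends on `θ - a/q`. For the remaining `h`, `‖hθ‖` is comparable to
`‖ha/q‖`, and the `ha` are equidistributed modulo `q`. -/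
theorem weylMajorant_le_of_abs_sub_le {H q : ℕ} (hH : 0 < H) (hq : 0 < q) (hqH : q ≤ 4 * H) {a : ℤ}
    (haq : IsCoprime a (q : ℤ)) {θ : ℝ} (hθ : |θ - a / q| ≤ 1 / (4 * H * q)) :
    weylMajorant H θ ≤ 14 * (1 + Real.log (4 * H)) *
      (H + 1 / (q * (1 / (H : ℝ) ^ 2 + |θ - a / q|))) := by
  have : NeZero q := ⟨hq.ne'⟩
  have hH0 : (0 : ℝ) < H := by exact_mod_cast hH
  have hq0 : (0 : ℝ) < q := by exact_mod_cast hq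
  have hq1 : (1 : ℝ) ≤ q := by exact_mod_cast hq
  have hH1 : (1 : ℝ) ≤ H := by exact_mod_cast hH
  have hqH' : (q : ℝ) ≤ 4 * H := by exact_mod_cast hqH
  set β := θ - a / q with hβ
  have hsplit : ∀ h : ℕ, ((h * θ : ℝ) : UnitAddCircle)
      = ZMod.toAddCircle ((h : ZMod q) * (a : ZMod q)) + ((h * β : ℝ) : UnitAddCircle) := by
    intro h
    have h1 : (h : ZMod q) * (a : ZMod q) = (((h : ℤ) * a : ℤ) : ZMod q) := by push_cast; rfl
    rw [h1, ZMod.toAddCircle_intCast, ← AddCircle.coe_add]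
    congr 1
    rw [hβ]
    push_cast
    ring
  -- A quarter of the separation `1/q` of the points `c/q`.
  have hsmall : ∀ h ∈ Finset.Icc 1 H, |h * β| ≤ 1 / (4 * q) := by
    intro h hh
    have h1 : (h : ℝ) ≤ H := by exact_mod_cast (Finset.mem_Icc.mp hh).2
    rw [abs_mul, Nat.abs_cast]
    calc _ ≤ (H : ℝ) * (1 / (4 * H * q)) := by gcongr
      _ = _ := by field_simp
  have hnorm : ∀ h ∈ Finset.Icc 1 H, ‖((h * β : ℝ) : UnitAddCircle)‖ = |h * β| := by
    intro h hh
    rw [AddCircle.norm_coe_eq_abs_iff 1 one_ne_zero, abs_one]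
    refine (hsmall h hh).trans ?_
    rw [div_le_div_iff₀ (by positivity) (by norm_num)]
    linarith
  have hnear : ∑ h ∈ Finset.Icc 1 H with q ∣ h,
      1 / (1 / (H : ℝ) + ‖((h * θ : ℝ) : UnitAddCircle)‖)
      ≤ (1 + Real.log (4 * H)) * (1 / (q * (1 / (H : ℝ) ^ 2 + |β|))) := by
    have h1 : ∀ h ∈ (Finset.Icc 1 H).filter (q ∣ ·),
        1 / (1 / (H : ℝ) + ‖((h * θ : ℝ) : UnitAddCircle)‖)
          ≤ 1 / h * (1 / (1 / (H : ℝ) ^ 2 + |β|)) := by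
      intro h hh
      rw [Finset.mem_filter] at hh
      have h0 : (h : ZMod q) = 0 := (ZMod.natCast_eq_zero_iff _ _).mpr hh.2
      have h2 : (h : ℝ) ≤ H := by exact_mod_cast (Finset.mem_Icc.mp hh.1).2
      have h3 : (1 : ℝ) ≤ h := by exact_mod_cast (Finset.mem_Icc.mp hh.1).1
      rw [hsplit, h0, zero_mul, map_zero, zero_add, hnorm h hh.1, abs_mul, Nat.abs_cast,
        one_div_mul_one_div]
      refine one_div_le_one_div_of_le (by positivity) ?_
      rw [mul_add]
      gcongr
      rw [mul_one_div, div_le_div_iff₀ (by positivity) hH0]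
      nlinarith
    refine (Finset.sum_le_sum h1).trans ?_
    rw [← Finset.sum_mul]
    have h2 : ∑ h ∈ Finset.Icc 1 H with q ∣ h, 1 / (h : ℝ) ≤ 1 / q * (1 + Real.log (4 * H)) := by
      calc _ ≤ ∑ h ∈ (Finset.Icc 1 H).image (q * ·), 1 / (h : ℝ) := by
            refine Finset.sum_le_sum_of_subset_of_nonneg (fun h hh => ?_) fun _ _ _ => by positivity
            rw [Finset.mem_filter, Finset.mem_Icc] at hh
            obtain ⟨⟨k1, k2⟩, b, rfl⟩ := hh
            refine Finset.mem_image.mpr ⟨b, Finset.mem_Icc.mpr ⟨?_, ?_⟩, rfl⟩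
            · exact Nat.pos_of_mul_pos_left k1
            · exact (Nat.le_mul_of_pos_left b hq).trans k2
        _ = ∑ b ∈ Finset.Icc 1 H, 1 / q * (1 / (b : ℝ)) := by
            rw [Finset.sum_image fun x _ y _ hxy => Nat.eq_of_mul_eq_mul_left hq hxy]
            refine Finset.sum_congr rfl fun b _ => ?_
            rw [one_div_mul_one_div]
            push_cast
            rfl
        _ ≤ 1 / q * (1 + Real.log H) := by
            rw [← Finset.mul_sum]
            gcongr
            exact sum_Icc_inv_le H
        _ ≤ _ := by
            gcongr
            linarith
    calc _ ≤ 1 / q * (1 + Real.log (4 * H)) * (1 / (1 / (H : ℝ) ^ 2 + |β|)) := by gcongr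
      _ = _ := by rw [← one_div_mul_one_div]; ring
  have hlog : 0 ≤ Real.log (4 * H) := Real.log_nonneg (by linarith)
  have hfar : ∑ h ∈ Finset.Icc 1 H with ¬ q ∣ h,
      1 / (1 / (H : ℝ) + ‖((h * θ : ℝ) : UnitAddCircle)‖) ≤ 14 * (1 + Real.log (4 * H)) * H := by
    obtain ⟨w, hw⟩ : IsUnit (a : ZMod q) := by
      have := haq.map (Int.castRingHom (ZMod q))
      simpa [isCoprime_zero_right] using this
    have h1 : ∀ h ∈ (Finset.Icc 1 H).filter (¬ q ∣ ·),
        1 / (1 / (H : ℝ) + ‖((h * θ : ℝ) : UnitAddCircle)‖)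
          ≤ 4 / 3 * ‖ZMod.toAddCircle ((h : ZMod q) * (a : ZMod q))‖⁻¹ := by
      intro h hh
      rw [Finset.mem_filter] at hh
      have h0 : (h : ZMod q) * (a : ZMod q) ≠ 0 := by
        rw [← hw, Ne, Units.mul_left_eq_zero, ZMod.natCast_eq_zero_iff]
        exact hh.2
      have h2 := one_div_le_norm_toAddCircle h0
      set d := ‖ZMod.toAddCircle ((h : ZMod q) * (a : ZMod q))‖ with hd
      have hd0 : 0 < d := lt_of_lt_of_le (by positivity) h2
      have h3 : d - |h * β| ≤ ‖((h * θ : ℝ) : UnitAddCircle)‖ := by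
        rw [hsplit, ← hnorm h hh.1]
        have := norm_sub_le (ZMod.toAddCircle ((h : ZMod q) * (a : ZMod q)) +
          ((h * β : ℝ) : UnitAddCircle)) ((h * β : ℝ) : UnitAddCircle)
        rw [add_sub_cancel_right] at this
        linarith
      have h4 : |h * β| ≤ d / 4 := by
        refine (hsmall h hh.1).trans ?_
        rw [← div_div, div_right_comm]
        gcongr
      calc _ ≤ 1 / (3 / 4 * d) := by
            refine one_div_le_one_div_of_le (by positivity) ?_
            have : 0 < 1 / (H : ℝ) := by positivity
            linarith
        _ = _ := by field_simp
    refine (Finset.sum_le_sum h1).trans ?_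
    rw [← Finset.mul_sum]
    calc _ ≤ 4 / 3 * ∑ h ∈ Finset.Icc 1 H,
          ‖ZMod.toAddCircle ((h : ZMod q) * (a : ZMod q))‖⁻¹ := by
          gcongr
          exact Finset.filter_subset _ _
      _ ≤ 4 / 3 * (((H : ℝ) / q + 1) * ∑ c : ZMod q, ‖ZMod.toAddCircle (c * (a : ZMod q))‖⁻¹) := by
          gcongr
          exact sum_Icc_natCast_zmod_le (F := fun c => ‖ZMod.toAddCircle (c * (a : ZMod q))‖⁻¹)
            (fun _ => by positivity) H
      _ = 4 / 3 * (((H : ℝ) / q + 1) * ∑ c : ZMod q, ‖ZMod.toAddCircle c‖⁻¹) := by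
          rw [← hw, ← Equiv.sum_comp w.mulRight fun c => ‖ZMod.toAddCircle c‖⁻¹]
          rfl
      _ ≤ 4 / 3 * (((H : ℝ) / q + 1) * (2 * q * (1 + Real.log (4 * H)))) := by
          gcongr
          refine (sum_inv_norm_toAddCircle_le q).trans ?_
          gcongr
      _ = 8 / 3 * (H + q) * (1 + Real.log (4 * H)) := by
          field_simp
          ring
      _ ≤ 14 * H * (1 + Real.log (4 * H)) := by
          refine mul_le_mul_of_nonneg_right ?_ (by linarith)
          linarith
      _ = _ := by ring
  rw [weylMajorant, ← Finset.sum_filter_add_sum_filter_not _ (q ∣ ·)]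
  have hpos : 0 ≤ (1 + Real.log (4 * H)) * (1 / (q * (1 / (H : ℝ) ^ 2 + |β|))) := by positivity
  linarith

/-! ### Moments of the Weyl majorant -/

theorem lintegral_rpow_add_abs_le {b s : ℝ} (hb : 0 < b) (hs : 1 < s) :
    ∫⁻ x : ℝ, ENNReal.ofReal ((b + |x|) ^ (-s)) ≤ ENNReal.ofReal (2 / (s - 1) * b ^ (1 - s)) := by
  have hs0 : 0 < s - 1 := by linarith
  have h1 : ∫⁻ x in Set.Ioi (0 : ℝ), ENNReal.ofReal ((b + |x|) ^ (-s))
      = ENNReal.ofReal (1 / (s - 1) * b ^ (1 - s)) := by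
    have e1 : ∫⁻ x in Set.Ioi (0 : ℝ), ENNReal.ofReal ((b + |x|) ^ (-s))
        = ∫⁻ x in Set.Ioi b, ENNReal.ofReal (x ^ (-s)) := by
      rw [← lintegral_indicator measurableSet_Ioi, ← lintegral_indicator measurableSet_Ioi,
        ← lintegral_add_left_eq_self ((Set.Ioi b).indicator fun x => ENNReal.ofReal (x ^ (-s))) b]
      refine lintegral_congr fun x => ?_
      by_cases hx : 0 < x
      · rw [Set.indicator_of_mem (Set.mem_Ioi.mpr hx),
          Set.indicator_of_mem (Set.mem_Ioi.mpr (by linarith)), abs_of_pos hx]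
      · rw [Set.indicator_of_notMem (by simpa using hx),
          Set.indicator_of_notMem (by simpa using hx)]
    rw [e1, ← ofReal_integral_eq_lintegral_ofReal
      (integrableOn_Ioi_rpow_of_lt (by linarith) hb), integral_Ioi_rpow_of_lt (by linarith) hb]
    · congr 1
      rw [show -s + 1 = 1 - s by ring, neg_div, ← div_neg, neg_sub]
      ring
    · filter_upwards [ae_restrict_mem measurableSet_Ioi] with x hx
      exact Real.rpow_nonneg (hb.trans hx).le _
  have h2 : ∫⁻ x in Set.Iio (0 : ℝ), ENNReal.ofReal ((b + |x|) ^ (-s))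
      = ∫⁻ x in Set.Ioi (0 : ℝ), ENNReal.ofReal ((b + |x|) ^ (-s)) := by
    rw [← lintegral_indicator measurableSet_Ioi, ← lintegral_indicator measurableSet_Iio,
      ← lintegral_neg_eq_self]
    refine lintegral_congr fun x => ?_
    simp only [Set.indicator, Set.mem_Iio, Set.mem_Ioi, Left.neg_neg_iff, abs_neg]
  calc _ ≤ ∫⁻ x in Set.Iio (0 : ℝ) ∪ Set.Ioi 0, ENNReal.ofReal ((b + |x|) ^ (-s)) := by
        rw [← setLIntegral_univ, Set.Iio_union_Ioi]
        refine le_of_eq (setLIntegral_congr ?_)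
        exact (ae_eq_univ.mpr (by simp)).symm
    _ ≤ _ := lintegral_union_le _ _ _
    _ = _ := by
        rw [h2, h1, ← ENNReal.ofReal_add (by positivity) (by positivity)]
        congr 1
        ring

theorem lintegral_sq_shift_le {b : ℝ} (hb : 0 < b) (c : ℝ) :
    ∫⁻ t : ℝ, ENNReal.ofReal ((1 / (b + |t / π - c|)) ^ 2) ≤ ENNReal.ofReal (32 / b) := by
  have h1 : ∀ t : ℝ, ENNReal.ofReal ((1 / (b + |t / π - c|)) ^ 2)
      ≤ ENNReal.ofReal 16 * ENNReal.ofReal ((b + |t - π * c|) ^ (-2 : ℝ)) := by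
    intro t
    rw [← ENNReal.ofReal_mul (by norm_num)]
    refine ENNReal.ofReal_le_ofReal ?_
    have h2 : |t - π * c| ≤ 4 * |t / π - c| := by
      have : t - π * c = π * (t / π - c) := by
        field_simp
      rw [this, abs_mul, abs_of_pos Real.pi_pos]
      gcongr
      exact Real.pi_le_four
    rw [Real.rpow_neg (by positivity), Real.rpow_two, one_div, inv_pow,
      show (16 : ℝ) * ((b + |t - π * c|) ^ 2)⁻¹ = (((b + |t - π * c|) / 4) ^ 2)⁻¹ by
        field_simp; norm_num]
    gcongr
    linarith
  calc _ ≤ _ := lintegral_mono h1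
    _ = ENNReal.ofReal 16 * ∫⁻ t : ℝ, ENNReal.ofReal ((b + |t|) ^ (-2 : ℝ)) := by
        rw [lintegral_const_mul' _ _ ENNReal.ofReal_ne_top,
          lintegral_sub_right_eq_self (fun t : ℝ => ENNReal.ofReal ((b + |t|) ^ (-2 : ℝ)))]
    _ ≤ ENNReal.ofReal 16 * ENNReal.ofReal (2 / (2 - 1) * b ^ (1 - 2 : ℝ)) := by
        gcongr
        exact lintegral_rpow_add_abs_le hb (by norm_num)
    _ = _ := by
        rw [← ENNReal.ofReal_mul (by norm_num)]
        congr 1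
        rw [show (1 - 2 : ℝ) = -1 by norm_num, Real.rpow_neg_one]
        ring

theorem weylMajorant_le_sq {H : ℕ} (hH : 0 < H) (θ : ℝ) : weylMajorant H θ ≤ (H : ℝ) ^ 2 := by
  have hH0 : (0 : ℝ) < H := by exact_mod_cast hH
  have h1 : ∀ h ∈ Finset.Icc 1 H, 1 / (1 / (H : ℝ) + ‖((h * θ : ℝ) : UnitAddCircle)‖) ≤ H := by
    intro h _
    rw [div_le_iff₀ (by positivity), mul_add, mul_one_div_cancel hH0.ne']
    have : 0 ≤ (H : ℝ) * ‖((h * θ : ℝ) : UnitAddCircle)‖ := by positivity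
    linarith
  refine (Finset.sum_le_card_nsmul _ _ _ h1).trans (le_of_eq ?_)
  simp
  ring

/-- The bound for `weylMajorant` near `θ = 0`. Here `‖hθ‖ = h|θ|`, and with `x = H⁻² + |θ|` one has
`(1/H + h|θ|)² ≥ h x / H`; the resulting sum of `h^{-1/2}` telescopes. Compared with
`weylMajorant_le_of_abs_sub_le` this is free of logarithms. -/
theorem weylMajorant_le_rpow {H : ℕ} (hH : 0 < H) {θ : ℝ} (hθ : |θ| ≤ 1 / (2 * H)) :
    weylMajorant H θ ≤ 2 * H * (1 / (H : ℝ) ^ 2 + |θ|) ^ (-(1 / 2) : ℝ) := by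
  have hH0 : (0 : ℝ) < H := by exact_mod_cast hH
  set x := 1 / (H : ℝ) ^ 2 + |θ| with hx
  have hx0 : 0 < x := by positivity
  have h1 : ∀ h ∈ Finset.Icc 1 H, 1 / (1 / (H : ℝ) + ‖((h * θ : ℝ) : UnitAddCircle)‖)
      ≤ √H * (√x)⁻¹ * (2 * (√h - √(h - 1 : ℝ))) := by
    intro h hh
    have h2 : (h : ℝ) ≤ H := by exact_mod_cast (Finset.mem_Icc.mp hh).2
    have h3 : (1 : ℝ) ≤ h := by exact_mod_cast (Finset.mem_Icc.mp hh).1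
    have h0 : (0 : ℝ) < h := by linarith
    have h4 : ‖((h * θ : ℝ) : UnitAddCircle)‖ = h * |θ| := by
      rw [(AddCircle.norm_coe_eq_abs_iff 1 one_ne_zero).mpr, abs_mul, Nat.abs_cast]
      rw [abs_one, abs_mul, Nat.abs_cast]
      calc _ ≤ (H : ℝ) * (1 / (2 * H)) := by gcongr
        _ = _ := by field_simp
    have h5 : √(h * x / H) ≤ 1 / (H : ℝ) + h * |θ| := by
      rw [Real.sqrt_le_left (by positivity)]
      have h6 : h * x ≤ 1 / (H : ℝ) + h * |θ| := by
        rw [hx, mul_add]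
        gcongr
        rw [mul_one_div, div_le_div_iff₀ (by positivity) hH0]
        nlinarith
      have h7 : 1 / (H : ℝ) ≤ 1 / (H : ℝ) + h * |θ| := le_add_of_nonneg_right (by positivity)
      rw [sq, div_eq_mul_one_div]
      gcongr
    have h8 : 1 / √h ≤ 2 * (√h - √(h - 1 : ℝ)) := by
      have hs : 0 < √(h : ℝ) := Real.sqrt_pos.mpr h0
      have e1 : √(h : ℝ) ^ 2 = h := Real.sq_sqrt h0.le
      have e2 : √(h - 1 : ℝ) ^ 2 = h - 1 := Real.sq_sqrt (by linarith)
      rw [div_le_iff₀ hs]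
      nlinarith [sq_nonneg (√(h : ℝ) - √(h - 1 : ℝ))]
    rw [h4]
    calc _ ≤ 1 / √(h * x / H) := by
          refine one_div_le_one_div_of_le ?_ h5
          positivity
      _ = √H * (√x)⁻¹ * (1 / √h) := by
          rw [Real.sqrt_div (by positivity), Real.sqrt_mul h0.le]
          field_simp
      _ ≤ _ := by gcongr
  have h2 : ∑ h ∈ Finset.Icc 1 H, (√(h : ℝ) - √(h - 1 : ℝ)) = √H := by
    have : ∀ n : ℕ, ∑ h ∈ Finset.Icc 1 n, (√(h : ℝ) - √(h - 1 : ℝ)) = √n := by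
      intro n
      induction n with
      | zero => simp
      | succ n ih =>
        rw [Finset.sum_Icc_succ_top (by omega), ih]
        push_cast
        rw [add_sub_cancel_right]
        ring
    exact this H
  calc _ ≤ _ := Finset.sum_le_sum h1
    _ = 2 * (√H * √H) * (√x)⁻¹ := by
        rw [← Finset.mul_sum, ← Finset.mul_sum, h2]
        ring
    _ = _ := by
        rw [Real.mul_self_sqrt hH0.le, Real.rpow_neg hx0.le, ← Real.sqrt_eq_rpow]

/-- Second moment of `weylMajorant`. By Dirichlet's approximation theorem every `t / π` lies in an
arc around some `a/q` with `q ≤ 4H`, where `weylMajorant_le_of_abs_sub_le` applies; the bound is then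
summed over all arcs. An arc contributes `H² / q²`, and there are at most `3q` numerators for each
`q`, so the sum over `q` is harmonic. -/
theorem lintegral_weylMajorant_sq_le {H : ℕ} (hH : 0 < H) :
    ∫⁻ t in Set.Icc (-2 : ℝ) 2, ENNReal.ofReal (weylMajorant H (t / π) ^ 2)
      ≤ ENNReal.ofReal (39200 * (1 + Real.log (4 * H)) ^ 3 * (H : ℝ) ^ 2) := by
  have hH0 : (0 : ℝ) < H := by exact_mod_cast hH
  have hH1 : (1 : ℝ) ≤ H := by exact_mod_cast hH
  set ℓ := 1 + Real.log (4 * H) with hℓ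
  have hℓ1 : 1 ≤ ℓ := le_add_of_nonneg_right (Real.log_nonneg (by linarith))
  -- The constant is `392 = 2 * 14 ^ 2`, from `(H + y) ^ 2 ≤ 2 * (H ^ 2 + y ^ 2)`.
  have hptw : ∀ t ∈ Set.Icc (-2 : ℝ) 2, weylMajorant H (t / π) ^ 2 ≤ 392 * ℓ ^ 2 * ((H : ℝ) ^ 2 +
      ∑ q ∈ Finset.Icc 1 (4 * H), ∑ a ∈ Finset.Icc (-(q : ℤ)) q,
        1 / (q : ℝ) ^ 2 * (1 / (1 / (H : ℝ) ^ 2 + |t / π - a / q|)) ^ 2) := by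
    intro t ht
    have hθ1 : |t / π| ≤ 1 := by
      rw [abs_div, abs_of_pos Real.pi_pos, div_le_one Real.pi_pos]
      exact (abs_le.mpr ht).trans Real.two_le_pi
    set θ := t / π with hθ
    obtain ⟨w, hw1, hw2⟩ := Real.exists_rat_abs_sub_le_and_den_le θ (n := 4 * H) (by omega)
    have hq0 : (0 : ℝ) < w.den := by exact_mod_cast w.pos
    have hq1 : (1 : ℝ) ≤ w.den := by exact_mod_cast w.pos
    have hcast : (w : ℝ) = (w.num : ℝ) / (w.den : ℝ) := by exact_mod_cast (Rat.num_div_den w).symm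
    rw [hcast] at hw1
    have hd : |θ - w.num / w.den| ≤ 1 / (4 * H * w.den) := by
      refine hw1.trans ?_
      push_cast
      gcongr
      linarith
    have hcop : IsCoprime w.num (w.den : ℤ) := by
      rw [Int.isCoprime_iff_nat_coprime, Int.natAbs_natCast]
      exact w.reduced
    have hV := weylMajorant_le_of_abs_sub_le hH w.pos hw2 hcop hd
    have ha : w.num ∈ Finset.Icc (-(w.den : ℤ)) w.den := by
      have h1 : |(w.num : ℝ) / w.den| < 1 + 1 / w.den := by
        have h2 : |(w.num : ℝ) / w.den| ≤ |θ| + |θ - w.num / w.den| := by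
          have := abs_sub_abs_le_abs_sub ((w.num : ℝ) / w.den) θ
          rw [abs_sub_comm] at this
          linarith
        have h3 : 1 / (4 * H * w.den) < 1 / (w.den : ℝ) := by
          refine one_div_lt_one_div_of_lt hq0 ?_
          nlinarith
        linarith
      rw [abs_div, Nat.abs_cast, div_lt_iff₀ hq0, add_mul, one_div_mul_cancel hq0.ne', one_mul] at h1
      have h4 : |w.num| < (w.den : ℤ) + 1 := by exact_mod_cast h1
      rw [Finset.mem_Icc, ← abs_le]
      omega
    have hq : w.den ∈ Finset.Icc 1 (4 * H) := Finset.mem_Icc.mpr ⟨w.pos, hw2⟩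
    set y := 1 / (w.den * (1 / (H : ℝ) ^ 2 + |θ - w.num / w.den|)) with hy
    have hy2 : y ^ 2 ≤ ∑ q ∈ Finset.Icc 1 (4 * H), ∑ a ∈ Finset.Icc (-(q : ℤ)) q,
        1 / (q : ℝ) ^ 2 * (1 / (1 / (H : ℝ) ^ 2 + |θ - a / q|)) ^ 2 := by
      calc y ^ 2 = 1 / (w.den : ℝ) ^ 2 *
            (1 / (1 / (H : ℝ) ^ 2 + |θ - w.num / w.den|)) ^ 2 := by
            rw [hy, ← one_div_mul_one_div, mul_pow, one_div_pow (w.den : ℝ)]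
        _ ≤ ∑ a ∈ Finset.Icc (-(w.den : ℤ)) w.den,
            1 / (w.den : ℝ) ^ 2 * (1 / (1 / (H : ℝ) ^ 2 + |θ - a / w.den|)) ^ 2 :=
            Finset.single_le_sum (f := fun a : ℤ =>
              1 / (w.den : ℝ) ^ 2 * (1 / (1 / (H : ℝ) ^ 2 + |θ - a / w.den|)) ^ 2)
              (fun _ _ => by positivity) ha
        _ ≤ _ := Finset.single_le_sum (f := fun q : ℕ => ∑ a ∈ Finset.Icc (-(q : ℤ)) q,
              1 / (q : ℝ) ^ 2 * (1 / (1 / (H : ℝ) ^ 2 + |θ - a / q|)) ^ 2)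
              (fun _ _ => Finset.sum_nonneg fun _ _ => by positivity) hq
    calc weylMajorant H θ ^ 2 ≤ (14 * ℓ * (H + y)) ^ 2 :=
          pow_le_pow_left₀ (weylMajorant_nonneg H θ) hV 2
      _ ≤ 392 * ℓ ^ 2 * ((H : ℝ) ^ 2 + y ^ 2) := by
          nlinarith [mul_nonneg (sq_nonneg ℓ) (sq_nonneg (H - y))]
      _ ≤ _ := by gcongr
  have hmeas : ∀ (q : ℕ) (a : ℤ), Measurable fun t : ℝ =>
      ENNReal.ofReal ((1 / (1 / (H : ℝ) ^ 2 + |t / π - a / q|)) ^ 2) := fun q a => by fun_prop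
  have hterm : ∀ (q : ℕ) (a : ℤ), ∫⁻ t in Set.Icc (-2 : ℝ) 2,
      ENNReal.ofReal (1 / (q : ℝ) ^ 2 * (1 / (1 / (H : ℝ) ^ 2 + |t / π - a / q|)) ^ 2)
      ≤ ENNReal.ofReal (32 * (H : ℝ) ^ 2 / (q : ℝ) ^ 2) := by
    intro q a
    have e1 : ∀ t : ℝ,
        ENNReal.ofReal (1 / (q : ℝ) ^ 2 * (1 / (1 / (H : ℝ) ^ 2 + |t / π - a / q|)) ^ 2)
        = ENNReal.ofReal (1 / (q : ℝ) ^ 2) *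
          ENNReal.ofReal ((1 / (1 / (H : ℝ) ^ 2 + |t / π - a / q|)) ^ 2) := fun t =>
      ENNReal.ofReal_mul (by positivity)
    simp only [e1]
    rw [lintegral_const_mul' _ _ ENNReal.ofReal_ne_top]
    calc _ ≤ ENNReal.ofReal (1 / (q : ℝ) ^ 2) * ENNReal.ofReal (32 / (1 / (H : ℝ) ^ 2)) := by
          gcongr
          exact (setLIntegral_le_lintegral _ _).trans (lintegral_sq_shift_le (by positivity) _)
      _ = _ := by
          rw [← ENNReal.ofReal_mul (by positivity)]
          congr 1
          field_simp
  have hsum : ∫⁻ t in Set.Icc (-2 : ℝ) 2, ENNReal.ofReal (∑ q ∈ Finset.Icc 1 (4 * H),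
      ∑ a ∈ Finset.Icc (-(q : ℤ)) q,
        1 / (q : ℝ) ^ 2 * (1 / (1 / (H : ℝ) ^ 2 + |t / π - a / q|)) ^ 2)
      ≤ ENNReal.ofReal (96 * (H : ℝ) ^ 2 * ℓ) := by
    have e1 : ∀ t : ℝ, ENNReal.ofReal (∑ q ∈ Finset.Icc 1 (4 * H), ∑ a ∈ Finset.Icc (-(q : ℤ)) q,
        1 / (q : ℝ) ^ 2 * (1 / (1 / (H : ℝ) ^ 2 + |t / π - a / q|)) ^ 2)
        = ∑ q ∈ Finset.Icc 1 (4 * H), ∑ a ∈ Finset.Icc (-(q : ℤ)) q,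
        ENNReal.ofReal (1 / (q : ℝ) ^ 2 * (1 / (1 / (H : ℝ) ^ 2 + |t / π - a / q|)) ^ 2) := by
      intro t
      rw [ENNReal.ofReal_sum_of_nonneg fun _ _ => Finset.sum_nonneg fun _ _ => by positivity]
      refine Finset.sum_congr rfl fun q _ => ?_
      rw [ENNReal.ofReal_sum_of_nonneg fun _ _ => by positivity]
    simp only [e1]
    rw [lintegral_finsetSum _ fun q _ => Finset.measurable_sum _ fun a _ => by fun_prop]
    calc _ ≤ ∑ q ∈ Finset.Icc 1 (4 * H), ENNReal.ofReal (96 * (H : ℝ) ^ 2 * (1 / (q : ℝ))) := by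
          refine Finset.sum_le_sum fun q hq => ?_
          have hq1 : (1 : ℝ) ≤ q := by exact_mod_cast (Finset.mem_Icc.mp hq).1
          rw [lintegral_finsetSum _ fun a _ => by fun_prop]
          refine (Finset.sum_le_card_nsmul _ _ _ fun a _ => hterm q a).trans ?_
          rw [nsmul_eq_mul, ← ENNReal.ofReal_natCast, ← ENNReal.ofReal_mul (by positivity)]
          refine ENNReal.ofReal_le_ofReal ?_
          rw [Int.card_Icc]
          have : (((q : ℤ) + 1 - -(q : ℤ)).toNat : ℝ) = 2 * q + 1 := by
            have : ((q : ℤ) + 1 - -(q : ℤ)).toNat = 2 * q + 1 := by omega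
            rw [this]
            push_cast
            ring
          rw [this, mul_one_div, mul_div_assoc', div_le_div_iff₀ (by positivity) (by positivity)]
          have h3 : 2 * (q : ℝ) + 1 ≤ 3 * q := by linarith
          calc _ ≤ 3 * (q : ℝ) * (32 * (H : ℝ) ^ 2) * q := by gcongr
            _ = _ := by ring
      _ = ENNReal.ofReal (96 * (H : ℝ) ^ 2 * ∑ q ∈ Finset.Icc 1 (4 * H), 1 / (q : ℝ)) := by
          rw [Finset.mul_sum, ENNReal.ofReal_sum_of_nonneg fun _ _ => by positivity]
      _ ≤ _ := by
          refine ENNReal.ofReal_le_ofReal ?_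
          gcongr
          refine (sum_Icc_inv_le _).trans (le_of_eq ?_)
          rw [hℓ]
          push_cast
          rfl
  calc _ ≤ ∫⁻ t in Set.Icc (-2 : ℝ) 2, ENNReal.ofReal (392 * ℓ ^ 2) * (ENNReal.ofReal ((H : ℝ) ^ 2) +
      ENNReal.ofReal (∑ q ∈ Finset.Icc 1 (4 * H), ∑ a ∈ Finset.Icc (-(q : ℤ)) q,
        1 / (q : ℝ) ^ 2 * (1 / (1 / (H : ℝ) ^ 2 + |t / π - a / q|)) ^ 2)) := by
        refine setLIntegral_mono' measurableSet_Icc fun t ht => ?_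
        rw [← ENNReal.ofReal_add (by positivity) (Finset.sum_nonneg fun _ _ =>
          Finset.sum_nonneg fun _ _ => by positivity), ← ENNReal.ofReal_mul (by positivity)]
        exact ENNReal.ofReal_le_ofReal (hptw t ht)
    _ ≤ ENNReal.ofReal (392 * ℓ ^ 2) * (ENNReal.ofReal ((H : ℝ) ^ 2) * ENNReal.ofReal 4 +
        ENNReal.ofReal (96 * (H : ℝ) ^ 2 * ℓ)) := by
        rw [lintegral_const_mul' _ _ ENNReal.ofReal_ne_top, lintegral_add_left measurable_const,
          setLIntegral_const, Real.volume_Icc]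
        gcongr
        norm_num
    _ ≤ _ := by
        rw [← ENNReal.ofReal_mul (by positivity), ← ENNReal.ofReal_add (by positivity)
          (by positivity), ← ENNReal.ofReal_mul (by positivity)]
        refine ENNReal.ofReal_le_ofReal ?_
        have : 0 ≤ (ℓ - 1) * (ℓ ^ 2 * (H : ℝ) ^ 2) := mul_nonneg (by linarith) (by positivity)
        nlinarith

/-! ### The dispersive bound and its moments -/

/-- The dispersive bound at frequency scale `H` on `ℝ × 𝕋³`: the line contributes
`(H⁻² + |t|)^{-1/2}`, each of the three circles a Weyl sum bounded by `weylMajorant ^ (1/2)`. -/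
noncomputable def decayBound (H : ℕ) (t : ℝ) : ℝ :=
  (1 / (H : ℝ) ^ 2 + |t|) ^ (-(1 / 2) : ℝ) * weylMajorant H (t / π) ^ (3 / 2 : ℝ)

theorem decayBound_nonneg (H : ℕ) (t : ℝ) : 0 ≤ decayBound H t :=
  mul_nonneg (Real.rpow_nonneg (by positivity) _) (Real.rpow_nonneg (weylMajorant_nonneg _ _) _)

theorem measurable_decayBound {H : ℕ} (hH : 0 < H) : Measurable (decayBound H) := by
  have := (continuous_weylMajorant hH).measurable
  unfold decayBound
  fun_prop

/-- Near `t = 0` the majorant of each Weyl sum is at most a multiple of `H^{1/2} x^{-1/4}` with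
`x = H⁻² + |t|`, so `decayBound H t ≲ H^{3/2} x^{-5/4}`. -/
theorem decayBound_rpow_le_near {H : ℕ} (hH : 0 < H) {r : ℝ} (hr : 0 ≤ r) {t : ℝ}
    (ht : |t / π| ≤ 1 / (2 * H)) :
    decayBound H t ^ r ≤ 8 ^ r * (H : ℝ) ^ (3 * r / 2) *
      (1 / (H : ℝ) ^ 2 + |t|) ^ (-(5 * r / 4)) := by
  have hH0 : (0 : ℝ) < H := by exact_mod_cast hH
  set x := 1 / (H : ℝ) ^ 2 + |t| with hx
  have hx0 : 0 < x := by positivity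
  have h1 : x / 4 ≤ 1 / (H : ℝ) ^ 2 + |t / π| := by
    rw [abs_div, abs_of_pos Real.pi_pos]
    have h2 : |t| / 4 ≤ |t| / π := by
      gcongr
      exact Real.pi_le_four
    have h3 : 0 < 1 / (H : ℝ) ^ 2 := by positivity
    linarith
  have hV : weylMajorant H (t / π) ≤ 4 * (H * x ^ (-(1 / 2) : ℝ)) := by
    refine (weylMajorant_le_rpow hH ht).trans ?_
    have h4 : (1 / (H : ℝ) ^ 2 + |t / π|) ^ (-(1 / 2) : ℝ) ≤ (x / 4) ^ (-(1 / 2) : ℝ) :=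
      Real.rpow_le_rpow_of_nonpos (by positivity) h1 (by norm_num)
    have h5 : (x / 4) ^ (-(1 / 2) : ℝ) = 2 * x ^ (-(1 / 2) : ℝ) := by
      rw [Real.div_rpow hx0.le (by norm_num), Real.rpow_neg (by norm_num : (0 : ℝ) ≤ 4),
        show (4 : ℝ) = 2 ^ (2 : ℝ) by norm_num, ← Real.rpow_mul (by norm_num)]
      norm_num
      ring
    calc _ ≤ 2 * H * (2 * x ^ (-(1 / 2) : ℝ)) := by
          rw [← h5]
          gcongr
      _ = _ := by ring
  have hD : decayBound H t ≤ 8 * ((H : ℝ) ^ (3 / 2 : ℝ) * x ^ (-(5 / 4) : ℝ)) := by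
    calc decayBound H t ≤ x ^ (-(1 / 2) : ℝ) * (4 * (H * x ^ (-(1 / 2) : ℝ))) ^ (3 / 2 : ℝ) := by
          rw [decayBound, ← hx]
          gcongr
          exact weylMajorant_nonneg _ _
      _ = 8 * ((H : ℝ) ^ (3 / 2 : ℝ) * (x ^ (-(1 / 2) : ℝ) * x ^ (-(3 / 4) : ℝ))) := by
          rw [Real.mul_rpow (by norm_num) (by positivity), Real.mul_rpow hH0.le (by positivity),
            ← Real.rpow_mul hx0.le, show (4 : ℝ) = 2 ^ (2 : ℝ) by norm_num,
            ← Real.rpow_mul (by norm_num)]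
          norm_num
          ring
      _ = _ := by
          rw [← Real.rpow_add hx0]
          norm_num
  calc _ ≤ (8 * ((H : ℝ) ^ (3 / 2 : ℝ) * x ^ (-(5 / 4) : ℝ))) ^ r :=
        Real.rpow_le_rpow (decayBound_nonneg _ _) hD hr
    _ = _ := by
        rw [Real.mul_rpow (by norm_num) (by positivity), Real.mul_rpow (by positivity)
          (by positivity), ← Real.rpow_mul hH0.le, ← Real.rpow_mul hx0.le, mul_assoc]
        congr 3 <;> ring

/-- Away from `t = 0`, where `x = H⁻² + |t| ≥ 1/H` and `V = weylMajorant H (t / π) ≤ H²`, the powers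
`x^{-2/5}` and `V^{6/5}` of `decayBound ^ (4/5)` are separated by Young's inequality with exponents
`5/2` and `5/3`, which produces the second power of `V`. The excess of `r` over `4/5` costs at most
`H^{7(r - 4/5)/2}`. -/
theorem decayBound_rpow_le_far {H : ℕ} (hH : 0 < H) {r : ℝ} (hr : 4 / 5 < r) {t : ℝ}
    (ht : 1 / (2 * H) < |t / π|) :
    decayBound H t ^ r ≤ (H : ℝ) ^ (6 / 5 + 7 / 2 * (r - 4 / 5)) *
      ((1 / (H : ℝ) ^ 2 + |t|)⁻¹ + weylMajorant H (t / π) ^ 2 / (H : ℝ) ^ 2) := by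
  have hH0 : (0 : ℝ) < H := by exact_mod_cast hH
  set x := 1 / (H : ℝ) ^ 2 + |t| with hx
  have hx0 : 0 < x := by positivity
  set V := weylMajorant H (t / π) with hV
  have hV0 : 0 < V := lt_of_lt_of_le (by positivity) (le_weylMajorant H (t / π))
  set ε := r - 4 / 5 with hε
  have hε0 : 0 < ε := by rw [hε]; linarith
  have hxH : 1 / (H : ℝ) ≤ x := by
    rw [abs_div, abs_of_pos Real.pi_pos, lt_div_iff₀ Real.pi_pos] at ht
    have h1 : 1 / (H : ℝ) ≤ 1 / (2 * H) * π := by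
      rw [div_mul_eq_mul_div, div_le_div_iff₀ hH0 (by positivity)]
      nlinarith [Real.two_le_pi]
    have h2 : 0 < 1 / (H : ℝ) ^ 2 := by positivity
    linarith
  have hx1 : x ^ (-(ε / 2)) ≤ (H : ℝ) ^ (ε / 2) := by
    calc _ ≤ (1 / (H : ℝ)) ^ (-(ε / 2)) :=
          Real.rpow_le_rpow_of_nonpos (by positivity) hxH (by linarith)
      _ = _ := by rw [one_div, Real.inv_rpow hH0.le, Real.rpow_neg hH0.le, inv_inv]
  have hV1 : V ^ (3 / 2 * ε) ≤ (H : ℝ) ^ (3 * ε) := by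
    calc _ ≤ ((H : ℝ) ^ 2) ^ (3 / 2 * ε) :=
          Real.rpow_le_rpow hV0.le (weylMajorant_le_sq hH _) (by positivity)
      _ = _ := by
          rw [← Real.rpow_natCast, ← Real.rpow_mul hH0.le]
          congr 1
          push_cast
          ring
  have hyoung : x ^ (-(2 / 5) : ℝ) * (V / H) ^ (6 / 5 : ℝ) ≤ x⁻¹ + V ^ 2 / (H : ℝ) ^ 2 := by
    have h1 := Real.geom_mean_le_arith_mean2_weighted (w₁ := 2 / 5) (w₂ := 3 / 5) (p₁ := x⁻¹)
      (p₂ := (V / H) ^ 2) (by norm_num) (by norm_num) (by positivity) (by positivity) (by norm_num)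
    have h2 : (x⁻¹) ^ (2 / 5 : ℝ) = x ^ (-(2 / 5) : ℝ) := by
      rw [Real.inv_rpow hx0.le, Real.rpow_neg hx0.le]
    have h3 : ((V / H) ^ 2) ^ (3 / 5 : ℝ) = (V / H) ^ (6 / 5 : ℝ) := by
      rw [← Real.rpow_natCast, ← Real.rpow_mul (by positivity)]
      norm_num
    rw [h2, h3] at h1
    refine h1.trans ?_
    rw [div_pow]
    have h4 : 0 < x⁻¹ := by positivity
    have h5 : 0 < V ^ 2 / (H : ℝ) ^ 2 := by positivity
    linarith
  have hD : decayBound H t ^ r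
      = x ^ (-(ε / 2)) * V ^ (3 / 2 * ε) * ((H : ℝ) ^ (6 / 5 : ℝ) *
        (x ^ (-(2 / 5) : ℝ) * (V / H) ^ (6 / 5 : ℝ))) := by
    have h1 : decayBound H t ^ r = x ^ (-(ε / 2) + -(2 / 5)) * V ^ (3 / 2 * ε + 6 / 5) := by
      rw [decayBound, ← hx, ← hV, Real.mul_rpow (by positivity) (by positivity),
        ← Real.rpow_mul hx0.le, ← Real.rpow_mul hV0.le]
      congr 2 <;> rw [hε] <;> ring
    rw [h1, Real.rpow_add hx0, Real.rpow_add hV0, Real.div_rpow hV0.le hH0.le]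
    field_simp
  calc decayBound H t ^ r ≤ (H : ℝ) ^ (ε / 2) * (H : ℝ) ^ (3 * ε) * ((H : ℝ) ^ (6 / 5 : ℝ) *
        (x⁻¹ + V ^ 2 / (H : ℝ) ^ 2)) := by
        rw [hD]
        gcongr
    _ = _ := by
        rw [← mul_assoc, ← Real.rpow_add hH0, ← Real.rpow_add hH0]
        congr 2
        ring

theorem one_div_sq_rpow {h : ℝ} (hh : 0 < h) (a : ℝ) : (1 / h ^ 2) ^ a = h ^ (-2 * a) := by
  rw [one_div, Real.inv_rpow (by positivity), ← Real.rpow_natCast, ← Real.rpow_mul hh.le,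
    ← Real.rpow_neg hh.le]
  congr 1
  push_cast
  ring

/-- Logarithms are absorbed by any positive power. -/
theorem exists_one_add_log_pow_le {δ : ℝ} (hδ : 0 < δ) :
    ∃ C : ℝ, 0 ≤ C ∧ ∀ h : ℝ, 1 ≤ h → (1 + Real.log (4 * h)) ^ 3 ≤ C * h ^ δ := by
  set d := δ / 3 with hd
  have hd0 : 0 < d := by positivity
  refine ⟨((1 + 1 / d) * 4 ^ d) ^ 3, by positivity, fun h hh => ?_⟩
  have h0 : 0 < h := by linarith
  have hl0 : 0 ≤ Real.log (4 * h) := Real.log_nonneg (by linarith)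
  have h1 : Real.log (4 * h) ≤ (4 * h) ^ d / d := Real.log_le_rpow_div (by positivity) hd0
  have h2 : 1 ≤ (4 * h) ^ d := Real.one_le_rpow (by linarith) hd0.le
  calc _ ≤ ((4 * h) ^ d + (4 * h) ^ d / d) ^ 3 := by gcongr
    _ = ((1 + 1 / d) * 4 ^ d) ^ 3 * (h ^ d) ^ 3 := by
        rw [Real.mul_rpow (by norm_num) h0.le]
        ring
    _ = _ := by
        rw [← Real.rpow_natCast (h ^ d), ← Real.rpow_mul h0.le, hd]
        congr 2
        push_cast
        ring

/-- The moment of the dispersive bound which controls the Strichartz constant. With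
`ε = r - 4/5`, the region near `t = 0` gives the full power `H^{4r - 2} = H^{6/5 + 4ε}`; elsewhere
the power is `H^{6/5 + 7ε/2}`, and the remaining `H^{ε/2}` absorbs the logarithms. -/
theorem exists_lintegral_decayBound_rpow_le {r : ℝ} (hr : 4 / 5 < r) :
    ∃ C : ℝ, 0 ≤ C ∧ ∀ H : ℕ, 0 < H →
      ∫⁻ t in Set.Icc (-2 : ℝ) 2, ENNReal.ofReal (decayBound H t ^ r)
        ≤ ENNReal.ofReal (C * (H : ℝ) ^ (4 * r - 2)) := by
  set ε := r - 4 / 5 with hε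
  have hε0 : 0 < ε := by rw [hε]; linarith
  obtain ⟨C₁, hC₁, hlog⟩ := exists_one_add_log_pow_le (half_pos hε0)
  -- The factor `(b + |t|)⁻¹` is bounded by `3^δ (b + |t|)^{-1-δ}`, whose integral is of order `H^{2δ}`.
  set δ := ε / 4 with hδ
  have hδ0 : 0 < δ := by positivity
  have hs : 1 < 5 * r / 4 := by linarith
  refine ⟨8 ^ r * (2 / (5 * r / 4 - 1)) + (3 ^ δ * (2 / δ) + 39200 * C₁), ?_, fun H hH => ?_⟩
  · have : 0 < 5 * r / 4 - 1 := by linarith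
    positivity
  have hH0 : (0 : ℝ) < H := by exact_mod_cast hH
  have hH1 : (1 : ℝ) ≤ H := by exact_mod_cast hH
  set b := 1 / (H : ℝ) ^ 2 with hb
  have hb0 : 0 < b := by positivity
  have hb1 : b ≤ 1 := by
    rw [hb, div_le_one (by positivity)]
    exact one_le_pow₀ hH1
  set G := (H : ℝ) ^ (6 / 5 + 7 / 2 * ε) with hG
  have hG0 : 0 ≤ G := by positivity
  have hptw : ∀ t ∈ Set.Icc (-2 : ℝ) 2, ENNReal.ofReal (decayBound H t ^ r) ≤
      ENNReal.ofReal (8 ^ r * (H : ℝ) ^ (3 * r / 2)) * ENNReal.ofReal ((b + |t|) ^ (-(5 * r / 4))) +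
      (ENNReal.ofReal (G * 3 ^ δ) * ENNReal.ofReal ((b + |t|) ^ (-(1 + δ))) +
      ENNReal.ofReal (G / (H : ℝ) ^ 2) * ENNReal.ofReal (weylMajorant H (t / π) ^ 2)) := by
    intro t ht
    have hx0 : 0 < b + |t| := by positivity
    have hx3 : b + |t| ≤ 3 := by
      have := abs_le.mpr ht
      linarith
    rw [← ENNReal.ofReal_mul (by positivity), ← ENNReal.ofReal_mul (by positivity),
      ← ENNReal.ofReal_mul (by positivity), ← ENNReal.ofReal_add (by positivity) (by positivity),
      ← ENNReal.ofReal_add (by positivity) (by positivity)]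
    refine ENNReal.ofReal_le_ofReal ?_
    rcases le_or_gt |t / π| (1 / (2 * H)) with hn | hf
    · exact (decayBound_rpow_le_near hH (by linarith) hn).trans
        (le_add_of_nonneg_right (by positivity))
    · refine (decayBound_rpow_le_far hH hr hf).trans
        (le_trans ?_ (le_add_of_nonneg_left (by positivity)))
      rw [← hε, ← hG, ← hb, mul_add]
      refine add_le_add ?_ (le_of_eq (by ring))
      rw [mul_assoc]
      gcongr
      have h1 : (b + |t|)⁻¹ = (b + |t|) ^ δ * (b + |t|) ^ (-(1 + δ)) := by
        rw [← Real.rpow_add hx0, ← Real.rpow_neg_one]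
        congr 1
        ring
      rw [h1]
      gcongr
  have hI1 : ∫⁻ t in Set.Icc (-2 : ℝ) 2, ENNReal.ofReal ((b + |t|) ^ (-(5 * r / 4)))
      ≤ ENNReal.ofReal (2 / (5 * r / 4 - 1) * (H : ℝ) ^ (5 * r / 2 - 2)) := by
    refine ((setLIntegral_le_lintegral _ _).trans (lintegral_rpow_add_abs_le hb0 hs)).trans
      (le_of_eq ?_)
    rw [hb, one_div_sq_rpow hH0]
    congr 3
    ring
  have hI2 : ∫⁻ t in Set.Icc (-2 : ℝ) 2, ENNReal.ofReal ((b + |t|) ^ (-(1 + δ)))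
      ≤ ENNReal.ofReal (2 / δ * (H : ℝ) ^ (ε / 2)) := by
    refine ((setLIntegral_le_lintegral _ _).trans
      (lintegral_rpow_add_abs_le hb0 (by linarith))).trans (le_of_eq ?_)
    rw [hb, one_div_sq_rpow hH0, add_sub_cancel_left]
    congr 3
    rw [hδ]
    ring
  have hI3 : ∫⁻ t in Set.Icc (-2 : ℝ) 2, ENNReal.ofReal (weylMajorant H (t / π) ^ 2)
      ≤ ENNReal.ofReal (39200 * (C₁ * (H : ℝ) ^ (ε / 2)) * (H : ℝ) ^ 2) := by
    refine (lintegral_weylMajorant_sq_le hH).trans (ENNReal.ofReal_le_ofReal ?_)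
    gcongr
    exact hlog H hH1
  have hm : Measurable fun t => weylMajorant H (t / π) :=
    (continuous_weylMajorant hH).measurable.comp (by fun_prop)
  have hs0 : 0 < 5 * r / 4 - 1 := by linarith
  calc _ ≤ _ := setLIntegral_mono' measurableSet_Icc hptw
    _ ≤ ENNReal.ofReal (8 ^ r * (H : ℝ) ^ (3 * r / 2)) *
          ENNReal.ofReal (2 / (5 * r / 4 - 1) * (H : ℝ) ^ (5 * r / 2 - 2)) +
        (ENNReal.ofReal (G * 3 ^ δ) * ENNReal.ofReal (2 / δ * (H : ℝ) ^ (ε / 2)) +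
        ENNReal.ofReal (G / (H : ℝ) ^ 2) *
          ENNReal.ofReal (39200 * (C₁ * (H : ℝ) ^ (ε / 2)) * (H : ℝ) ^ 2)) := by
        rw [lintegral_add_left (by fun_prop), lintegral_add_left (by fun_prop),
          lintegral_const_mul' _ _ ENNReal.ofReal_ne_top,
          lintegral_const_mul' _ _ ENNReal.ofReal_ne_top,
          lintegral_const_mul' _ _ ENNReal.ofReal_ne_top]
        gcongr
    _ = _ := by
        rw [← ENNReal.ofReal_mul (by positivity), ← ENNReal.ofReal_mul (by positivity),
          ← ENNReal.ofReal_mul (by positivity), ← ENNReal.ofReal_add (by positivity)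
          (by positivity), ← ENNReal.ofReal_add (by positivity) (by positivity)]
        congr 1
        have e1 : (H : ℝ) ^ (3 * r / 2) * (H : ℝ) ^ (5 * r / 2 - 2) = (H : ℝ) ^ (4 * r - 2) := by
          rw [← Real.rpow_add hH0]
          congr 1
          ring
        have e2 : G * (H : ℝ) ^ (ε / 2) = (H : ℝ) ^ (4 * r - 2) := by
          rw [hG, ← Real.rpow_add hH0, hε]
          congr 1
          ring
        have e3 : G / (H : ℝ) ^ 2 * (39200 * (C₁ * (H : ℝ) ^ (ε / 2)) * (H : ℝ) ^ 2)
            = 39200 * C₁ * (G * (H : ℝ) ^ (ε / 2)) := by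
          field_simp
        rw [e3, e2]
        linear_combination (8 ^ r * (2 / (5 * r / 4 - 1))) * e1 + 3 ^ δ * (2 / δ) * e2

/-! ### Plane waves on the semiperiodic space -/

/-- The Gaussian measure `e^{-(s/L)²} ds` on the line. -/
noncomputable def lineMeasure (L : ℕ) : Measure ℝ :=
  (volume : Measure ℝ).withDensity fun s => ENNReal.ofReal (Real.exp (-(s / L) ^ 2))

/-- The integer points of the cube `[-L, L]³`. -/
noncomputable def freqBox (L : ℕ) : Finset (Fin 3 → ℤ) :=
  Fintype.piFinset fun _ => Finset.Icc (-L : ℤ) L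

/-- The frequency measure: a Gaussian at scale `L` on the line, counting measure on the integer
points of the cube. The first coordinate `s` corresponds to the frequency `ξ₁ = 2πs`. The Gaussian
weight makes the line factor of the kernel explicit; it is undone in `amplitude`. -/
noncomputable def freqMeasure (L : ℕ) : Measure Freq :=
  ∑ n ∈ freqBox L, (lineMeasure L).map fun s => (s, n)

/-- The characters `(x, y) ↦ e^{2πixs} e^{in·y}` of `ℝ × 𝕋³`. -/
noncomputable def planeWave (x : Space) (ξ : Freq) : ℂ :=
  Complex.exp (2 * π * Complex.I * (x.1 * ξ.1)) * mode ξ.2 x.2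

/-- The symbol `(2πs)² + |n|²` of `-Δ`. -/
noncomputable def dispersion (ξ : Freq) : ℝ := freqSq (2 * π * ξ.1, ξ.2)

theorem integrable_exp_neg_div_sq {L : ℕ} (hL : 0 < L) :
    Integrable fun s : ℝ => Real.exp (-(s / L) ^ 2) := by
  have hL0 : (0 : ℝ) < L := by exact_mod_cast hL
  have := integrable_exp_neg_mul_sq (b := 1 / (L : ℝ) ^ 2) (by positivity)
  refine this.congr (ae_of_all _ fun s => ?_)
  simp only
  congr 1
  field_simp

theorem lineMeasure_univ {L : ℕ} (hL : 0 < L) :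
    lineMeasure L Set.univ = ENNReal.ofReal (√π * L) := by
  have hL0 : (0 : ℝ) < L := by exact_mod_cast hL
  rw [lineMeasure, withDensity_apply _ MeasurableSet.univ, setLIntegral_univ,
    ← ofReal_integral_eq_lintegral_ofReal (integrable_exp_neg_div_sq hL)
      (ae_of_all _ fun _ => (Real.exp_pos _).le)]
  congr 1
  have h := integral_gaussian (1 / (L : ℝ) ^ 2)
  rw [div_div_eq_mul_div, div_one, Real.sqrt_mul Real.pi_pos.le, Real.sqrt_sq hL0.le] at h
  rw [← h]
  congr 1
  ext s
  congr 1
  field_simp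

theorem card_freqBox (L : ℕ) : (freqBox L).card = (2 * L + 1) ^ 3 := by
  rw [freqBox, Fintype.card_piFinset_const, Int.card_Icc]
  congr 1
  omega

theorem freqMeasure_univ {L : ℕ} (hL : 0 < L) :
    freqMeasure L Set.univ = ENNReal.ofReal ((2 * L + 1) ^ 3 * (√π * L)) := by
  have h1 : ∀ n ∈ freqBox L, (lineMeasure L).map (fun s => (s, n)) Set.univ
      = ENNReal.ofReal (√π * L) := by
    intro n _
    rw [Measure.map_apply (by fun_prop) MeasurableSet.univ, Set.preimage_univ, lineMeasure_univ hL]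
  rw [freqMeasure, Measure.finsetSum_apply, Finset.sum_congr rfl h1, Finset.sum_const,
    card_freqBox, nsmul_eq_mul, ← ENNReal.ofReal_natCast, ← ENNReal.ofReal_mul (by positivity)]
  push_cast
  rfl

theorem isFiniteMeasure_freqMeasure {L : ℕ} (hL : 0 < L) : IsFiniteMeasure (freqMeasure L) :=
  ⟨by rw [freqMeasure_univ hL]; exact ENNReal.ofReal_lt_top⟩

theorem lintegral_freqMeasure (L : ℕ) {F : Freq → ℝ≥0∞} (hF : Measurable F) :
    ∫⁻ ξ, F ξ ∂(freqMeasure L)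
      = ∑ n ∈ freqBox L, ∫⁻ s : ℝ, ENNReal.ofReal (Real.exp (-(s / L) ^ 2)) * F (s, n) := by
  rw [freqMeasure, lintegral_finsetSum_measure]
  refine Finset.sum_congr rfl fun n _ => ?_
  have hFn : Measurable fun s : ℝ => F (s, n) := hF.comp (by fun_prop)
  rw [lintegral_map hF (by fun_prop), lineMeasure, lintegral_withDensity_eq_lintegral_mul _
    (by fun_prop) hFn]
  rfl

theorem integral_freqMeasure (L : ℕ) {F : Freq → ℂ} (hF : Measurable F)
    (hi : Integrable F (freqMeasure L)) :
    ∫ ξ, F ξ ∂(freqMeasure L)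
      = ∑ n ∈ freqBox L, ∫ s : ℝ, Real.exp (-(s / L) ^ 2) * F (s, n) := by
  rw [freqMeasure] at hi ⊢
  rw [integral_finsetSum_measure (integrable_finsetSum_measure.mp hi)]
  refine Finset.sum_congr rfl fun n _ => ?_
  rw [integral_map (by fun_prop) hF.aestronglyMeasurable, lineMeasure,
    integral_withDensity_eq_integral_toReal_smul (by fun_prop)
      (ae_of_all _ fun _ => ENNReal.ofReal_lt_top)]
  refine integral_congr_ae (ae_of_all _ fun s => ?_)
  simp only [ENNReal.toReal_ofReal (Real.exp_pos _).le, Complex.real_smul]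

theorem measurable_planeWave : Measurable (Function.uncurry planeWave) := by
  have h1 : Measurable fun q : Torus3 × (Fin 3 → ℤ) => mode q.2 q.1 :=
    measurable_from_prod_countable_left fun n => (continuous_mode n).measurable
  have h2 : Measurable fun q : Space × Freq => mode q.2.2 q.1.2 :=
    h1.comp (f := fun q : Space × Freq => (q.1.2, q.2.2)) (by fun_prop)
  have h3 : Measurable fun q : Space × Freq =>
      Complex.exp (2 * π * Complex.I * (q.1.1 * q.2.1)) := by fun_prop
  exact h3.mul h2

theorem norm_planeWave (x : Space) (ξ : Freq) : ‖planeWave x ξ‖ = 1 := by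
  rw [planeWave, norm_mul, norm_mode, mul_one, Complex.norm_exp]
  simp

theorem continuous_dispersion : Continuous dispersion :=
  continuous_freqSq.comp (by fun_prop)

/-- The line factor of the kernel is an explicit complex Gaussian. -/
theorem norm_integral_gaussian_le {L : ℕ} (hL : 0 < L) (x t : ℝ) :
    ‖∫ s : ℝ, Complex.exp (Complex.I * x * s) *
        Complex.exp (-((1 / L ^ 2 : ℝ) + (4 * π ^ 2 * t : ℝ) * Complex.I) * s ^ 2)‖
      ≤ 2 * (1 / ((2 * L : ℕ) : ℝ) ^ 2 + |t|) ^ (-(1 / 2) : ℝ) := by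
  have hL0 : (0 : ℝ) < L := by exact_mod_cast hL
  set b : ℂ := (1 / L ^ 2 : ℝ) + (4 * π ^ 2 * t : ℝ) * Complex.I with hb
  have hbre : b.re = 1 / (L : ℝ) ^ 2 := by
    rw [hb, Complex.add_re, Complex.re_ofReal_mul, Complex.I_re, Complex.ofReal_re, mul_zero,
      add_zero]
  have hbim : b.im = 4 * π ^ 2 * t := by
    rw [hb, Complex.add_im, Complex.im_ofReal_mul, Complex.I_im, Complex.ofReal_im, mul_one,
      zero_add]
  have hb0 : 0 < b.re := by rw [hbre]; positivity
  rw [fourierIntegral_gaussian hb0, norm_mul]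
  have h1 : ‖Complex.exp (-(x : ℂ) ^ 2 / (4 * b))‖ ≤ 1 := by
    rw [Complex.norm_exp, Real.exp_le_one_iff]
    have e1 : (-(x : ℂ) ^ 2 / (4 * b)) = ((-(x ^ 2 / 4) : ℝ) : ℂ) * b⁻¹ := by
      push_cast
      rw [div_eq_mul_inv, mul_inv]
      ring
    rw [e1, Complex.re_ofReal_mul, Complex.inv_re]
    have : 0 ≤ b.re / Complex.normSq b := div_nonneg hb0.le (Complex.normSq_nonneg _)
    nlinarith [sq_nonneg x]
  have h2 : 1 / ((2 * L : ℕ) : ℝ) ^ 2 + |t| ≤ ‖b‖ := by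
    have e1 := Complex.abs_re_le_norm b
    have e2 := Complex.abs_im_le_norm b
    rw [hbre, abs_of_pos (by positivity)] at e1
    rw [hbim, abs_mul, abs_of_pos (by positivity)] at e2
    have e3 : 1 / ((2 * L : ℕ) : ℝ) ^ 2 = 1 / (L : ℝ) ^ 2 / 4 := by
      push_cast
      field_simp
      norm_num
    have e4 : 4 * |t| ≤ 4 * π ^ 2 * |t| := by
      have : 1 ≤ π ^ 2 := one_le_pow₀ (by linarith [Real.two_le_pi])
      nlinarith [abs_nonneg t]
    have e5 : 0 < 1 / (L : ℝ) ^ 2 := by positivity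
    rw [e3]
    linarith
  have h3 : ‖((π : ℂ) / b) ^ (1 / 2 : ℂ)‖ = √π * ‖b‖ ^ (-(1 / 2) : ℝ) := by
    have : (1 / 2 : ℂ) = ((1 / 2 : ℝ) : ℂ) := by push_cast; rfl
    rw [this, Complex.norm_cpow_real, norm_div, Complex.norm_real,
      Real.norm_of_nonneg Real.pi_pos.le, Real.div_rpow Real.pi_pos.le (norm_nonneg _),
      ← Real.sqrt_eq_rpow, Real.rpow_neg (norm_nonneg _), div_eq_mul_inv]
  have h4 : √π ≤ 2 := by
    rw [Real.sqrt_le_left (by norm_num)]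
    linarith [Real.pi_le_four]
  have h5 : ‖b‖ ^ (-(1 / 2) : ℝ) ≤ (1 / ((2 * L : ℕ) : ℝ) ^ 2 + |t|) ^ (-(1 / 2) : ℝ) :=
    Real.rpow_le_rpow_of_nonpos (by positivity) h2 (by norm_num)
  calc _ ≤ √π * ‖b‖ ^ (-(1 / 2) : ℝ) * 1 := by
        rw [h3]
        gcongr
    _ ≤ _ := by
        rw [mul_one]
        gcongr

/-- The torus factor of the kernel is a product of three quadratic Weyl sums. -/
theorem norm_sum_freqBox_le {L : ℕ} (hL : 0 < L) (y : Torus3) (t : ℝ) :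
    ‖∑ n ∈ freqBox L, ∏ k, fourier (n k) (y k) * Complex.exp (-Complex.I * t * (n k : ℂ) ^ 2)‖
      ≤ 40 * weylMajorant (2 * L) (t / π) ^ (3 / 2 : ℝ) := by
  rw [freqBox, ← Finset.prod_univ_sum (fun _ => Finset.Icc (-L : ℤ) L)
    (fun k m => fourier m (y k) * Complex.exp (-Complex.I * t * (m : ℂ) ^ 2)), norm_prod]
  set V := weylMajorant (2 * L) (t / π) with hV
  have hV0 : 0 ≤ V := weylMajorant_nonneg _ _
  have h1 : ∀ k, ‖∑ m ∈ Finset.Icc (-L : ℤ) L,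
      fourier m (y k) * Complex.exp (-Complex.I * t * (m : ℂ) ^ 2)‖ ≤ √(11 * V) := by
    intro k
    obtain ⟨α, hα⟩ := QuotientAddGroup.mk_surjective (y k)
    have e1 : ∀ m : ℤ, fourier m (y k) * Complex.exp (-Complex.I * t * (m : ℂ) ^ 2)
        = Complex.exp (Complex.I * (m * α - t * m ^ 2)) := by
      intro m
      have e2 : y k = ((α : ℝ) : AddCircle (2 * π)) := hα.symm
      rw [e2, fourier_coe_apply, ← Complex.exp_add]
      congr 1
      have := Real.pi_ne_zero
      push_cast
      field_simp
      ring
    simp only [e1]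
    exact Real.le_sqrt_of_sq_le (norm_sq_sum_quadratic_le hL α t)
  calc _ ≤ ∏ _k : Fin 3, √(11 * V) := Finset.prod_le_prod (fun _ _ => norm_nonneg _) fun k _ => h1 k
    _ = 11 * √11 * V ^ (3 / 2 : ℝ) := by
        rw [Finset.prod_const, Finset.card_univ, Fintype.card_fin, Real.sqrt_mul (by norm_num),
          mul_pow, show (3 / 2 : ℝ) = (1 / 2 : ℝ) * (3 : ℕ) by norm_num, Real.rpow_mul hV0,
          Real.rpow_natCast, ← Real.sqrt_eq_rpow, pow_succ √11, Real.sq_sqrt (by norm_num)]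
    _ ≤ _ := by
        gcongr
        have : √11 ≤ 3.4 := by
          rw [Real.sqrt_le_left (by norm_num)]
          norm_num
        linarith

/-- The kernel of `T T*` is the product of a Gaussian integral on the line and three Weyl sums. -/
theorem norm_kernel_le_decayBound {L : ℕ} (hL : 0 < L) (x x' : Space) (t : ℝ) :
    ‖∫ ξ, planeWave x ξ * conj (planeWave x' ξ) * timePhase dispersion t ξ ∂(freqMeasure L)‖
      ≤ 80 * decayBound (2 * L) t := by
  have := isFiniteMeasure_freqMeasure hL
  have hpw : ∀ x, Measurable (planeWave x) := fun x =>
    measurable_planeWave.comp (f := fun ξ : Freq => (x, ξ)) (by fun_prop)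
  have hph : Measurable (timePhase dispersion t) :=
    (measurable_timePhase continuous_dispersion.measurable).comp (f := fun ξ => (t, ξ))
      (by fun_prop)
  have hm : Measurable fun ξ =>
      planeWave x ξ * conj (planeWave x' ξ) * timePhase dispersion t ξ :=
    ((hpw x).mul (RCLike.continuous_conj.measurable.comp (hpw x'))).mul hph
  rw [integral_freqMeasure L hm (Integrable.of_bound hm.aestronglyMeasurable 1
    (ae_of_all _ fun ξ => by
      rw [norm_mul, norm_mul, RCLike.norm_conj, norm_planeWave, norm_planeWave, norm_timePhase]
      norm_num))]
  set G : ℝ → ℂ := fun s => Complex.exp (Complex.I * (2 * π * (x.1 - x'.1) : ℝ) * s) *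
    Complex.exp (-((1 / L ^ 2 : ℝ) + (4 * π ^ 2 * t : ℝ) * Complex.I) * s ^ 2) with hG
  have hfac : ∀ n ∈ freqBox L, ∫ s : ℝ, Real.exp (-(s / L) ^ 2) *
      (planeWave x (s, n) * conj (planeWave x' (s, n)) * timePhase dispersion t (s, n))
      = (∏ k, fourier (n k) (x.2 k - x'.2 k) * Complex.exp (-Complex.I * t * (n k : ℂ) ^ 2)) *
        ∫ s, G s := by
    intro n _
    rw [← integral_const_mul]
    congr 1
    ext s
    have e1 : ∏ k, fourier (n k) (x.2 k - x'.2 k) * Complex.exp (-Complex.I * t * (n k : ℂ) ^ 2)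
        = mode n x.2 * conj (mode n x'.2) *
          Complex.exp (-Complex.I * t * ∑ k, (n k : ℂ) ^ 2) := by
      rw [Finset.mul_sum, Complex.exp_sum, mode, mode, map_prod, ← Finset.prod_mul_distrib,
        ← Finset.prod_mul_distrib]
      refine Finset.prod_congr rfl fun k _ => ?_
      congr 1
      rw [sub_eq_add_neg, fourier_apply, zsmul_add, AddCircle.toCircle_add, Circle.coe_mul,
        zsmul_neg, AddCircle.toCircle_neg, Circle.coe_inv_eq_conj]
      rfl
    rw [e1, planeWave, planeWave, timePhase, dispersion, freqSq, hG]
    simp only [map_mul, ← Complex.exp_conj, Complex.ofReal_exp]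
    have e2 : ∀ p a c d q e f m m' : ℂ, p + a + c + d = q + e + f →
        Complex.exp p * (Complex.exp a * m * (Complex.exp c * m') * Complex.exp d)
          = m * m' * Complex.exp q * (Complex.exp e * Complex.exp f) := by
      intro p a c d q e f m m' h
      have h2 := congrArg Complex.exp h
      simp only [Complex.exp_add] at h2
      linear_combination m * m' * h2
    refine e2 _ _ _ _ _ _ _ _ _ ?_
    have hL0 : (L : ℂ) ≠ 0 := by exact_mod_cast hL.ne'
    simp only [Complex.conj_I, Complex.conj_ofReal, map_ofNat]
    push_cast
    field_simp
    ring
  rw [Finset.sum_congr rfl hfac, ← Finset.sum_mul, norm_mul]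
  calc _ ≤ 40 * weylMajorant (2 * L) (t / π) ^ (3 / 2 : ℝ) *
        (2 * (1 / ((2 * L : ℕ) : ℝ) ^ 2 + |t|) ^ (-(1 / 2) : ℝ)) := by
        exact mul_le_mul (norm_sum_freqBox_le hL (fun k => x.2 k - x'.2 k) t)
          (norm_integral_gaussian_le hL _ t) (norm_nonneg _)
          (mul_nonneg (by norm_num) (Real.rpow_nonneg (weylMajorant_nonneg _ _) _))
    _ = _ := by
        rw [decayBound]
        ring

/-! ### The Bessel inequality for plane waves -/

theorem lintegral_enorm_sq_Lp {α : Type*} [MeasurableSpace α] {μ : Measure α} (f : Lp ℂ 2 μ) :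
    ∫⁻ x, ‖f x‖ₑ ^ 2 ∂μ = ENNReal.ofReal (‖f‖ ^ 2) := by
  rw [ENNReal.ofReal_pow (norm_nonneg _), ofReal_norm, Lp.enorm_def,
    eLpNorm_eq_lintegral_rpow_enorm_toReal (by simp) (by simp)]
  simp only [ENNReal.toReal_ofNat, ENNReal.rpow_ofNat]
  rw [← ENNReal.rpow_natCast, ← ENNReal.rpow_mul]
  norm_num

/-- Bessel's inequality in the periodic variables. -/
theorem sum_norm_sq_partialCoeff_le (f : L2Space) (s : Finset (Fin 3 → ℤ)) :
    ∑ n ∈ s, ‖partialCoeff f n‖ ^ 2 ≤ (2 * π) ^ 3 * ‖f‖ ^ 2 := by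
  set Q := ∑ n ∈ s, ‖partialCoeff f n‖ ^ 2 with hQ
  set S := ∑ n ∈ s, tensorMode (partialCoeff f n) n with hS
  have h1 : inner ℂ S f = (Q : ℂ) := by
    rw [hS, sum_inner, hQ, Complex.ofReal_sum]
    refine Finset.sum_congr rfl fun n _ => ?_
    rw [inner_tensorMode, inner_self_eq_norm_sq_to_K]
    push_cast
    rfl
  have hQ0 : 0 ≤ Q := Finset.sum_nonneg fun n _ => sq_nonneg _
  have h2 : Q ≤ ‖S‖ * ‖f‖ := by
    have := norm_inner_le_norm (𝕜 := ℂ) S f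
    rwa [h1, Complex.norm_real, Real.norm_of_nonneg hQ0] at this
  have h3 : ‖S‖ ^ 2 = (2 * π) ^ 3 * Q := norm_sq_sum_tensorMode _ s
  rcases hQ0.eq_or_lt with h0 | h0
  · rw [← h0]
    positivity
  · have h4 : Q ^ 2 ≤ (‖S‖ * ‖f‖) ^ 2 := pow_le_pow_left₀ hQ0 h2 2
    rw [mul_pow, h3] at h4
    nlinarith

theorem measurable_integral_mul_planeWave {Θ : Space → ℂ} (hΘ : Measurable Θ) :
    Measurable fun ξ : Freq => ∫ x, Θ x * planeWave x ξ := by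
  have hp : Measurable fun q : Freq × Space => planeWave q.2 q.1 :=
    measurable_planeWave.comp (f := fun q : Freq × Space => (q.2, q.1)) measurable_swap
  have h1 : Measurable fun q : Freq × Space => Θ q.2 * planeWave q.2 q.1 :=
    (hΘ.comp measurable_snd).mul hp
  have h2 : StronglyMeasurable fun q : Freq × Space => Θ q.2 * planeWave q.2 q.1 :=
    h1.stronglyMeasurable
  have h3 : StronglyMeasurable fun ξ : Freq => ∫ x, Θ x * planeWave x ξ :=
    h2.integral_prod_right'
  exact h3.measurable

/-- The adjoint of the synthesis by plane waves is the conjugate of the Fourier transform of the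
conjugate. -/
theorem integral_mul_planeWave {Θ : Space → ℂ} (hΘ : Integrable Θ) (ξ : Freq) :
    ∫ x, Θ x * planeWave x ξ = conj (∫ x : ℝ, Complex.exp (((-2 * π * x * ξ.1 : ℝ) : ℂ) * Complex.I)
      * ∫ y : Torus3, conj (mode ξ.2 y) * conj (Θ (x, y))) := by
  have hpw : Integrable fun z : Space => Θ z * planeWave z ξ := by
    refine Integrable.mul_bdd (c := 1) hΘ ?_ (ae_of_all _ fun z => (norm_planeWave _ _).le)
    exact (measurable_planeWave.comp
      (f := fun z : Space => (z, ξ)) (by fun_prop)).aestronglyMeasurable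
  rw [← integral_conj]
  refine (integral_prod _ hpw).trans ?_
  congr 1
  ext x
  rw [map_mul, ← integral_conj, ← integral_const_mul]
  congr 1
  ext y
  rw [planeWave, map_mul, ← Complex.exp_conj, RCLike.conj_conj, RCLike.conj_conj, map_mul,
    Complex.conj_I, Complex.conj_ofReal]
  have : ((-2 * π * x * ξ.1 : ℝ) : ℂ) * -Complex.I = 2 * π * Complex.I * (x * ξ.1) := by
    push_cast
    ring
  rw [this]
  ring

theorem integrable_conj {α : Type*} [MeasurableSpace α] {μ : Measure α} {g : α → ℂ}
    (hg : Integrable g μ) : Integrable (fun x => conj (g x)) μ := by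
  refine hg.norm.mono' (RCLike.continuous_conj.comp_aestronglyMeasurable hg.1)
    (ae_of_all _ fun z => ?_)
  rw [RCLike.norm_conj]

/-- Plancherel on the line, for each Fourier mode on the torus. -/
theorem lintegral_enorm_sq_integral_mul_planeWave {Θ : Space → ℂ} (hΘ : Integrable Θ)
    {f : L2Space} (hf : f =ᵐ[volume] fun x => conj (Θ x)) (n : Fin 3 → ℤ) :
    ∫⁻ s : ℝ, ‖∫ x, Θ x * planeWave x (s, n)‖ₑ ^ 2
      = ENNReal.ofReal (‖partialCoeff f n‖ ^ 2) := by
  have hΘm : Integrable fun z : Space => conj (mode n z.2) * conj (Θ z) := by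
    refine (integrable_conj hΘ).bdd_mul (c := 1) ?_ (ae_of_all _ fun z => ?_)
    · have := continuous_mode n
      exact Continuous.aestronglyMeasurable (by fun_prop)
    · rw [RCLike.norm_conj, norm_mode]
  have hae : partialCoeff f n =ᵐ[volume] fun x : ℝ =>
      ∫ y : Torus3, conj (mode n y) * conj (Θ (x, y)) := by
    have hz : ∀ᵐ x : ℝ, ∀ᵐ y : Torus3, f (x, y) = conj (Θ (x, y)) :=
      Measure.ae_ae_of_ae_prod hf
    filter_upwards [hz, (memLp_partialCoeff f n).coeFn_toLp] with x hx hc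
    rw [partialCoeff, hc]
    refine integral_congr_ae ?_
    filter_upwards [hx] with y hy
    rw [hy]
  have hci : Integrable (partialCoeff f n) := by
    refine Integrable.congr ?_ hae.symm
    exact Integrable.integral_prod_left hΘm
  rw [← Lp.norm_fourier_eq, ← lintegral_enorm_sq_Lp]
  refine lintegral_congr_ae ?_
  filter_upwards [L2Line.fourier_ae_eq _ hci] with s hs
  rw [hs, integral_mul_planeWave hΘ, Real.fourier_real_eq_integral_exp_smul, ← ofReal_norm,
    ← ofReal_norm, RCLike.norm_conj]
  congr 3
  refine integral_congr_ae ?_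
  filter_upwards [hae] with x hx
  rw [hx, smul_eq_mul]

/-- Restriction of the Fourier transform to a frequency box is bounded on `L²`; the weight of
`freqMeasure` is at most one. -/
theorem lintegral_freqMeasure_integral_mul_planeWave_le (L : ℕ) {Θ : Space → ℂ} (hΘ : Measurable Θ)
    (hΘi : Integrable Θ) {f : L2Space} (hf : f =ᵐ[volume] fun x => conj (Θ x)) :
    ∫⁻ ξ, ‖∫ x, Θ x * planeWave x ξ‖ₑ ^ 2 ∂(freqMeasure L)
      ≤ ENNReal.ofReal ((2 * π) ^ 3 * ‖f‖ ^ 2) := by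
  rw [lintegral_freqMeasure L ((measurable_integral_mul_planeWave hΘ).enorm.pow_const 2)]
  calc _ ≤ ∑ n ∈ freqBox L, ENNReal.ofReal (‖partialCoeff f n‖ ^ 2) := by
        refine Finset.sum_le_sum fun n _ => ?_
        rw [← lintegral_enorm_sq_integral_mul_planeWave hΘi hf n]
        refine lintegral_mono fun s => ?_
        refine mul_le_of_le_one_left' ?_
        rw [ENNReal.ofReal_le_one, Real.exp_le_one_iff]
        linarith [sq_nonneg (s / L)]
    _ = ENNReal.ofReal (∑ n ∈ freqBox L, ‖partialCoeff f n‖ ^ 2) :=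
        (ENNReal.ofReal_sum_of_nonneg fun _ _ => sq_nonneg _).symm
    _ ≤ _ := ENNReal.ofReal_le_ofReal (sum_norm_sq_partialCoeff_le f _)

theorem planeWave_bessel (L : ℕ) {Θ : Space → ℂ} {A : Set Space} (hΘ : Measurable Θ)
    (hA : MeasurableSet A) (hfin : volume A < ⊤) (hΘA : ∀ x, ‖Θ x‖ ≤ A.indicator 1 x) :
    ∫⁻ ξ, ‖∫ x, Θ x * planeWave x ξ‖ₑ ^ 2 ∂(freqMeasure L)
      ≤ ENNReal.ofReal ((2 * π) ^ 3) * volume A := by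
  have hΘi : Integrable Θ := by
    refine Integrable.mono' ((integrableOn_const (C := (1 : ℝ)) hfin.ne).integrable_indicator hA)
      hΘ.aestronglyMeasurable (ae_of_all _ hΘA)
  have hconj : Measurable fun x => conj (Θ x) := RCLike.continuous_conj.measurable.comp hΘ
  have hsq : ∫⁻ x, ‖conj (Θ x)‖ₑ ^ 2 ≤ volume A := by
    rw [← lintegral_indicator_one hA]
    refine lintegral_mono fun x => ?_
    have h1 : ‖conj (Θ x)‖ₑ ≤ A.indicator 1 x := by
      rw [← ofReal_norm, RCLike.norm_conj]
      refine (ENNReal.ofReal_le_ofReal (hΘA x)).trans (le_of_eq ?_)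
      by_cases hx : x ∈ A <;> simp [Set.indicator, hx]
    refine (pow_le_pow_left₀ zero_le h1 2).trans (le_of_eq ?_)
    by_cases hx : x ∈ A <;> simp [Set.indicator, hx]
  have hL2 : MemLp (fun x => conj (Θ x)) 2 volume := by
    refine ⟨hconj.aestronglyMeasurable, ?_⟩
    rw [eLpNorm_lt_top_iff_lintegral_rpow_enorm_lt_top (by simp) (by simp)]
    simp only [ENNReal.toReal_ofNat, ENNReal.rpow_ofNat]
    exact hsq.trans_lt hfin
  obtain ⟨f, hf⟩ : ∃ f : L2Space, f =ᵐ[volume] fun x => conj (Θ x) :=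
    ⟨hL2.toLp _, hL2.coeFn_toLp⟩
  have hfn : ‖f‖ ^ 2 ≤ (volume A).toReal := by
    rw [← ENNReal.ofReal_le_ofReal_iff ENNReal.toReal_nonneg, ← lintegral_enorm_sq_Lp,
      ENNReal.ofReal_toReal hfin.ne]
    refine le_trans (le_of_eq (lintegral_congr_ae ?_)) hsq
    filter_upwards [hf] with x hx
    rw [hx]
  refine (lintegral_freqMeasure_integral_mul_planeWave_le L hΘ hΘi hf).trans ?_
  rw [ENNReal.ofReal_mul (by positivity)]
  gcongr
  exact ENNReal.ofReal_le_of_le_toReal hfn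

theorem dispersiveSystem_planeWave {L : ℕ} (hL : 0 < L) :
    DispersiveSystem (volume : Measure Space) (freqMeasure L) planeWave dispersion
      (fun t => 80 * decayBound (2 * L) t) ((2 * π) ^ 3) where
  measurable_wave := measurable_planeWave
  norm_wave_le x ξ := (norm_planeWave x ξ).le
  measurable_phase := continuous_dispersion.measurable
  measurable_decay := (measurable_decayBound (by omega)).const_mul _
  norm_kernel_le := norm_kernel_le_decayBound hL
  bessel _ _ hΘ hA hfin hΘA := planeWave_bessel L hΘ hA hfin hΘA

/-! ### Fourier multipliers with symbols supported in a box -/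

theorem coeFn_symbolMul (m : Freq →ᵇ ℂ) (n : Fin 3 → ℤ) (h : L2Line) :
    symbolMul m n h =ᵐ[volume] fun s => m (2 * π * s, n) * h s :=
  (memLp_symbolMul m n h).coeFn_toLp

theorem coeFn_tensorMode (g : L2Line) (n : Fin 3 → ℤ) :
    tensorMode g n =ᵐ[volume] fun z : Space => g z.1 * mode n z.2 :=
  (memLp_tensorMode g n).coeFn_toLp

theorem symbolMul_sub (m₁ m₂ : Freq →ᵇ ℂ) (n : Fin 3 → ℤ) (h : L2Line) :
    symbolMul (m₁ - m₂) n h = symbolMul m₁ n h - symbolMul m₂ n h := by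
  apply Lp.ext
  filter_upwards [coeFn_symbolMul (m₁ - m₂) n h, coeFn_symbolMul m₁ n h, coeFn_symbolMul m₂ n h,
    Lp.coeFn_sub (symbolMul m₁ n h) (symbolMul m₂ n h)] with s h1 h2 h3 h4
  rw [h4, Pi.sub_apply, h1, h2, h3, BoundedContinuousFunction.sub_apply, sub_mul]

theorem tensorMode_sub (g h : L2Line) (n : Fin 3 → ℤ) :
    tensorMode (g - h) n = tensorMode g n - tensorMode h n := by
  apply Lp.ext
  have hs : ∀ᵐ z : Space, (g - h : L2Line) z.1 = g z.1 - h z.1 :=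
    Measure.quasiMeasurePreserving_fst.ae (Lp.coeFn_sub g h)
  filter_upwards [coeFn_tensorMode (g - h) n, coeFn_tensorMode g n, coeFn_tensorMode h n,
    Lp.coeFn_sub (tensorMode g n) (tensorMode h n), hs] with z h1 h2 h3 h4 h5
  rw [h4, Pi.sub_apply, h1, h2, h3, h5, sub_mul]

theorem tensorMode_zero (n : Fin 3 → ℤ) : tensorMode 0 n = 0 := by
  simpa using tensorMode_sub 0 0 n

theorem fourierMultiplier_sub (m₁ m₂ : Freq →ᵇ ℂ) (f : L2Space) :
    fourierMultiplier (m₁ - m₂) f = fourierMultiplier m₁ f - fourierMultiplier m₂ f := by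
  have hinv : ∀ g h : L2Line, (𝓕⁻ (g - h) : L2Line) = 𝓕⁻ g - 𝓕⁻ h :=
    (Lp.fourierTransformₗᵢ ℝ ℂ).symm.map_sub
  simp only [fourierMultiplier, symbolMul_sub, hinv, tensorMode_sub]
  rw [Summable.tsum_sub (summable_fourierMultiplier m₁ f) (summable_fourierMultiplier m₂ f),
    smul_sub]

/-- The symbol `m` vanishes outside the box `[-L, L]⁴`. -/
def SupportedInBox (L : ℕ) (m : Freq →ᵇ ℂ) : Prop :=
  ∀ ξ : Freq, m ξ ≠ 0 → |ξ.1| ≤ L ∧ ∀ k, |(ξ.2 k : ℝ)| ≤ L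

theorem SupportedInBox.sub {L : ℕ} {m₁ m₂ : Freq →ᵇ ℂ} (h₁ : SupportedInBox L m₁)
    (h₂ : SupportedInBox L m₂) : SupportedInBox L (m₁ - m₂) := by
  intro ξ hξ
  by_cases h : m₁ ξ = 0
  · refine h₂ ξ fun h' => hξ ?_
    rw [BoundedContinuousFunction.sub_apply, h, h', sub_zero]
  · exact h₁ ξ h

theorem norm_lowSymbol_le (η : Cutoff) (M : ℝ) (ξ : Freq) : ‖η.lowSymbol M ξ‖ ≤ 1 :=
  (BoundedContinuousFunction.norm_coe_le_norm _ ξ).trans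
    (BoundedContinuousFunction.norm_ofNormedAddCommGroup_le _ zero_le_one _)

theorem supportedInBox_lowSymbol (η : Cutoff) {M : ℝ} (hM : 0 < M) {L : ℕ} (hL : 2 * M ≤ L) :
    SupportedInBox L (η.lowSymbol M) := by
  have hη : ∀ y : ℝ, η.toFun (y / M) ≠ 0 → |y| ≤ L := by
    intro y hy
    have h : |y / M| < 2 := not_le.mp fun h => hy (η.eq_zero _ h)
    rw [abs_div, abs_of_pos hM, div_lt_iff₀ hM] at h
    exact h.le.trans hL
  intro ξ hξ
  have hξ' : ((η.toFun (ξ.1 / M) ^ 2 * ∏ k, η.toFun (ξ.2 k / M) ^ 2 : ℝ) : ℂ) ≠ 0 := hξ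
  rw [Complex.ofReal_ne_zero] at hξ'
  obtain ⟨h1, h2⟩ := mul_ne_zero_iff.mp hξ'
  exact ⟨hη _ (pow_ne_zero_iff two_ne_zero |>.mp h1), fun k =>
    hη _ (pow_ne_zero_iff two_ne_zero |>.mp (Finset.prod_ne_zero_iff.mp h2 k (Finset.mem_univ k)))⟩

theorem exists_dyadicProj_eq_fourierMultiplier (η : Cutoff) (j : ℕ) :
    ∃ m : Freq →ᵇ ℂ, SupportedInBox (2 ^ (j + 1)) m ∧ (∀ ξ, ‖m ξ‖ ≤ 2) ∧
      ∀ f, dyadicProj η j f = fourierMultiplier m f := by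
  cases j with
  | zero =>
    exact ⟨η.lowSymbol 1, supportedInBox_lowSymbol η one_pos (by norm_num),
      fun ξ => (norm_lowSymbol_le η 1 ξ).trans one_le_two, fun f => rfl⟩
  | succ j =>
    have hpos : (0 : ℝ) < 2 ^ (j + 1) := by positivity
    refine ⟨η.lowSymbol (2 ^ (j + 1)) - η.lowSymbol (2 ^ (j + 1) / 2),
      (supportedInBox_lowSymbol η hpos ?_).sub (supportedInBox_lowSymbol η (half_pos hpos) ?_),
      fun ξ => ?_, fun f => (fourierMultiplier_sub _ _ f).symm⟩
    · push_cast
      rw [pow_succ _ (j + 1)]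
      linarith
    · push_cast
      rw [pow_succ _ (j + 1)]
      linarith
    · rw [BoundedContinuousFunction.sub_apply]
      linarith [norm_sub_le (η.lowSymbol (2 ^ (j + 1)) ξ) (η.lowSymbol (2 ^ (j + 1) / 2) ξ),
        norm_lowSymbol_le η (2 ^ (j + 1)) ξ, norm_lowSymbol_le η (2 ^ (j + 1) / 2) ξ]

/-! ### The evolution as a superposition of plane waves -/

/-- The amplitude, relative to the Gaussian weight of `freqMeasure L`, that represents
`fourierMultiplier m f` as a superposition of plane waves: the Fourier transform of
`fourierMultiplier m f`, normalised and divided by the weight. -/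
noncomputable def amplitude (L : ℕ) (m : Freq →ᵇ ℂ) (f : L2Space) (ξ : Freq) : ℂ :=
  (((2 * π) ^ 3)⁻¹ : ℂ) * (Real.exp ((ξ.1 / L) ^ 2) : ℝ) *
    (m (2 * π * ξ.1, ξ.2) * (𝓕 (partialCoeff f ξ.2) : L2Line) ξ.1)

theorem measurable_amplitude (L : ℕ) (m : Freq →ᵇ ℂ) (f : L2Space) :
    Measurable (amplitude L m f) := by
  have h1 : Measurable fun ξ : Freq => (𝓕 (partialCoeff f ξ.2) : L2Line) ξ.1 :=
    measurable_from_prod_countable_left fun n =>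
      (Lp.stronglyMeasurable (𝓕 (partialCoeff f n) : L2Line)).measurable
  have h2 : Measurable fun ξ : Freq => m (2 * π * ξ.1, ξ.2) :=
    Continuous.measurable (by fun_prop)
  have h3 : Measurable fun ξ : Freq => ((Real.exp ((ξ.1 / L) ^ 2) : ℝ) : ℂ) := by fun_prop
  exact (h3.const_mul _).mul (h2.mul h1)

theorem sq_div_le_one_of_supportedInBox {L : ℕ} (hL : 0 < L) {m : Freq →ᵇ ℂ}
    (hm : SupportedInBox L m) {s : ℝ} {n : Fin 3 → ℤ} (h : m (2 * π * s, n) ≠ 0) :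
    |s| ≤ L ∧ (s / L) ^ 2 ≤ 1 := by
  have hL' : (0 : ℝ) < L := by exact_mod_cast hL
  have h1 : |2 * π * s| ≤ L := (hm _ h).1
  rw [abs_mul, abs_of_pos two_pi_pos] at h1
  have h2 : |s| ≤ L := by
    nlinarith [Real.pi_gt_three, abs_nonneg s]
  refine ⟨h2, ?_⟩
  rw [sq_le_one_iff_abs_le_one, abs_div, abs_of_pos hL', div_le_one hL']
  exact h2

/-- On the support of `m` the inverse weight is at most `e ≤ (2π)³`. -/
theorem enorm_amplitude_sq_mul_le {L : ℕ} (hL : 0 < L) {m : Freq →ᵇ ℂ}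
    (hm : SupportedInBox L m) (hm2 : ∀ ξ, ‖m ξ‖ ≤ 2) (f : L2Space) (s : ℝ) (n : Fin 3 → ℤ) :
    ENNReal.ofReal (Real.exp (-(s / L) ^ 2)) * ‖amplitude L m f (s, n)‖ₑ ^ 2
      ≤ ENNReal.ofReal (4 * ((2 * π) ^ 3)⁻¹)
        * ‖(𝓕 (partialCoeff f n) : L2Line) s‖ₑ ^ 2 := by
  simp only [← ofReal_norm]
  rw [← ENNReal.ofReal_pow (norm_nonneg _), ← ENNReal.ofReal_pow (norm_nonneg _),
    ← ENNReal.ofReal_mul (by positivity), ← ENNReal.ofReal_mul (by positivity)]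
  refine ENNReal.ofReal_le_ofReal ?_
  by_cases h0 : m (2 * π * s, n) = 0
  · rw [amplitude, h0]
    simp only [zero_mul, mul_zero, norm_zero, ne_eq, two_ne_zero, not_false_eq_true, zero_pow]
    positivity
  have h1 := (sq_div_le_one_of_supportedInBox hL hm h0).2
  set K : ℝ := (2 * π) ^ 3 with hK
  have hK3 : 3 ≤ K := by
    have h6 : (6 : ℝ) ≤ 2 * π := by linarith [Real.pi_gt_three]
    calc (3 : ℝ) ≤ 6 ^ 3 := by norm_num
      _ ≤ K := pow_le_pow_left₀ (by norm_num) h6 3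
  have hE : Real.exp ((s / L) ^ 2) ≤ K :=
    (Real.exp_le_exp.mpr h1).trans (Real.exp_one_lt_three.le.trans hK3)
  have hKc : ‖(((2 * π) ^ 3)⁻¹ : ℂ)‖ = K⁻¹ := by
    rw [hK]
    have : (((2 * π) ^ 3)⁻¹ : ℂ) = (((2 * π) ^ 3)⁻¹ : ℝ) := by push_cast; ring
    rw [this, Complex.norm_real, Real.norm_of_nonneg (by positivity)]
  rw [amplitude, norm_mul, norm_mul, norm_mul, hKc, Complex.norm_real,
    Real.norm_of_nonneg (Real.exp_nonneg _), Real.exp_neg]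
  set E := Real.exp ((s / L) ^ 2) with hEdef
  have hE0 : 0 < E := Real.exp_pos _
  have hm4 : ‖m (2 * π * s, n)‖ ^ 2 ≤ 4 := by
    have := pow_le_pow_left₀ (norm_nonneg _) (hm2 (2 * π * s, n)) 2
    linarith
  have hK0 : 0 < K := by linarith
  calc E⁻¹ * (K⁻¹ * E * (‖m (2 * π * s, n)‖ * ‖(𝓕 (partialCoeff f n) : L2Line) s‖)) ^ 2
      = ‖m (2 * π * s, n)‖ ^ 2 * (K⁻¹ * (E * K⁻¹))
        * ‖(𝓕 (partialCoeff f n) : L2Line) s‖ ^ 2 := by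
        field_simp
    _ ≤ 4 * (K⁻¹ * 1) * ‖(𝓕 (partialCoeff f n) : L2Line) s‖ ^ 2 := by
        gcongr
        rw [← div_eq_mul_inv]
        exact (div_le_one hK0).mpr hE
    _ = _ := by rw [mul_one]

theorem lintegral_enorm_amplitude_sq_le {L : ℕ} (hL : 0 < L) {m : Freq →ᵇ ℂ}
    (hm : SupportedInBox L m) (hm2 : ∀ ξ, ‖m ξ‖ ≤ 2) (f : L2Space) :
    ∫⁻ ξ, ‖amplitude L m f ξ‖ₑ ^ 2 ∂(freqMeasure L) ≤ ENNReal.ofReal ((2 * ‖f‖) ^ 2) := by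
  rw [lintegral_freqMeasure L ((measurable_amplitude L m f).enorm.pow_const 2)]
  calc _ ≤ ∑ n ∈ freqBox L, ENNReal.ofReal (4 * ((2 * π) ^ 3)⁻¹ * ‖partialCoeff f n‖ ^ 2) := by
        refine Finset.sum_le_sum fun n _ => ?_
        refine (lintegral_mono fun s => enorm_amplitude_sq_mul_le hL hm hm2 f s n).trans ?_
        rw [lintegral_const_mul' _ _ ENNReal.ofReal_ne_top, lintegral_enorm_sq_Lp,
          Lp.norm_fourier_eq, ← ENNReal.ofReal_mul (by positivity)]
    _ = ENNReal.ofReal (4 * ((2 * π) ^ 3)⁻¹ * ∑ n ∈ freqBox L, ‖partialCoeff f n‖ ^ 2) := by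
        rw [Finset.mul_sum, ENNReal.ofReal_sum_of_nonneg fun _ _ => by positivity]
    _ ≤ _ := by
        refine ENNReal.ofReal_le_ofReal ?_
        have hpos : 0 < (2 * π) ^ 3 := by positivity
        calc _ ≤ 4 * ((2 * π) ^ 3)⁻¹ * ((2 * π) ^ 3 * ‖f‖ ^ 2) := by
              gcongr
              exact sum_norm_sq_partialCoeff_le f _
          _ = _ := by field_simp; ring

theorem memLp_amplitude {L : ℕ} (hL : 0 < L) {m : Freq →ᵇ ℂ}
    (hm : SupportedInBox L m) (hm2 : ∀ ξ, ‖m ξ‖ ≤ 2) (f : L2Space) :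
    MemLp (amplitude L m f) 2 (freqMeasure L) := by
  refine ⟨(measurable_amplitude L m f).aestronglyMeasurable, ?_⟩
  rw [eLpNorm_lt_top_iff_lintegral_rpow_enorm_lt_top (by simp) (by simp)]
  simp only [ENNReal.toReal_ofNat, ENNReal.rpow_ofNat]
  exact (lintegral_enorm_amplitude_sq_le hL hm hm2 f).trans_lt ENNReal.ofReal_lt_top

/-- A Fourier multiplier whose symbol is supported in a box produces integrable line spectra. -/
theorem integrable_symbol_mul {L : ℕ} (hL : 0 < L) {m : Freq →ᵇ ℂ} (hm : SupportedInBox L m)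
    (M : Freq →ᵇ ℂ) (n : Fin 3 → ℤ) (h : L2Line) :
    Integrable fun s : ℝ => M (2 * π * s, n) * (m (2 * π * s, n) * h s) := by
  have h1 : MemLp (fun s : ℝ => (M * m) (2 * π * s, n) * h s) 2 volume :=
    memLp_symbolMul (M * m) n h
  have h2 : IntegrableOn (fun s : ℝ => (M * m) (2 * π * s, n) * h s)
      (Set.Icc (-(L : ℝ)) L) volume :=
    (h1.restrict _).integrable one_le_two
  rw [integrableOn_iff_integrable_of_support_subset] at h2
  · refine h2.congr (ae_of_all _ fun s => ?_)
    simp only [BoundedContinuousFunction.mul_apply]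
    ring
  · intro s hs
    have h0 : m (2 * π * s, n) ≠ 0 := by
      intro h0
      refine hs ?_
      simp only [BoundedContinuousFunction.mul_apply, h0, mul_zero, zero_mul]
    exact abs_le.mp (sq_div_le_one_of_supportedInBox hL hm h0).1

theorem symbolMul_eq_zero_of_notMem {L : ℕ} {m : Freq →ᵇ ℂ} (hm : SupportedInBox L m)
    {n : Fin 3 → ℤ} (hn : n ∉ freqBox L) (h : L2Line) : symbolMul m n h = 0 := by
  apply Lp.ext
  filter_upwards [coeFn_symbolMul m n h, Lp.coeFn_zero ℂ 2 (volume : Measure ℝ)] with s h1 h2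
  have h0 : m (2 * π * s, n) = 0 := by
    by_contra h0
    refine hn (Fintype.mem_piFinset.mpr fun k => Finset.mem_Icc.mpr ?_)
    exact_mod_cast abs_le.mp ((hm _ h0).2 k)
  rw [h1, h2, h0, zero_mul]
  rfl

theorem symbolMul_zero (m : Freq →ᵇ ℂ) (n : Fin 3 → ℤ) : symbolMul m n 0 = 0 := by
  have := norm_symbolMul_le m n 0
  rw [norm_zero, mul_zero] at this
  exact norm_le_zero_iff.mp this

theorem schrodingerPropagator_fourierMultiplier {L : ℕ} {m : Freq →ᵇ ℂ} (hm : SupportedInBox L m)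
    (t : ℝ) (f : L2Space) :
    schrodingerPropagator t (fourierMultiplier m f) = (((2 * π) ^ 3)⁻¹ : ℂ) •
      ∑ n ∈ freqBox L, tensorMode (𝓕⁻ (symbolMul (schrodingerSymbol t) n
        (symbolMul m n (𝓕 (partialCoeff f n))))) n := by
  have hinv : (𝓕⁻ (0 : L2Line) : L2Line) = 0 := (Lp.fourierTransformₗᵢ ℝ ℂ).symm.map_zero
  rw [schrodingerPropagator, fourierMultiplier]
  simp only [fourier_partialCoeff_fourierMultiplier]
  rw [tsum_eq_sum]
  intro n hn
  rw [symbolMul_eq_zero_of_notMem hm hn, symbolMul_zero, hinv, tensorMode_zero]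

theorem waveSum_amplitude {L : ℕ} (hL : 0 < L) {m : Freq →ᵇ ℂ}
    (hm : SupportedInBox L m) (hm2 : ∀ ξ, ‖m ξ‖ ≤ 2) (f : L2Space) (t : ℝ) (x : Space) :
    waveSum (freqMeasure L) planeWave dispersion (amplitude L m f) (x, t)
      = (((2 * π) ^ 3)⁻¹ : ℂ) * ∑ n ∈ freqBox L,
        𝓕⁻ (fun s : ℝ => schrodingerSymbol t (2 * π * s, n) *
          (m (2 * π * s, n) * (𝓕 (partialCoeff f n) : L2Line) s)) x.1 * mode n x.2 := by
  have := isFiniteMeasure_freqMeasure hL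
  have ha : Integrable (amplitude L m f) (freqMeasure L) :=
    (memLp_amplitude hL hm hm2 f).integrable one_le_two
  have hp : Measurable fun ξ : Freq => planeWave x ξ * timePhase dispersion t ξ :=
    (measurable_planeWave.comp (f := fun ξ : Freq => (x, ξ)) (by fun_prop)).mul
      (measurable_timePhase continuous_dispersion.measurable |>.comp
        (f := fun ξ : Freq => (t, ξ)) (by fun_prop))
  have hi : Integrable (fun ξ => amplitude L m f ξ * (planeWave x ξ * timePhase dispersion t ξ))
      (freqMeasure L) := by
    refine ha.mul_bdd (c := 1) hp.aestronglyMeasurable (ae_of_all _ fun ξ => ?_)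
    rw [norm_mul, norm_planeWave, norm_timePhase, mul_one]
  have hF : Measurable fun ξ => amplitude L m f ξ * (planeWave x ξ * timePhase dispersion t ξ) :=
    (measurable_amplitude L m f).mul hp
  rw [waveSum, integral_freqMeasure L hF hi, Finset.mul_sum]
  refine Finset.sum_congr rfl fun n _ => ?_
  rw [Real.fourierInv_eq', ← integral_mul_const, ← integral_const_mul]
  congr 1
  ext s
  have hE : ((Real.exp (-(s / L) ^ 2) : ℝ) : ℂ) * ((Real.exp ((s / L) ^ 2) : ℝ) : ℂ) = 1 := by
    rw [← Complex.ofReal_mul, ← Real.exp_add, neg_add_cancel, Real.exp_zero, Complex.ofReal_one]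
  have hS : schrodingerSymbol t (2 * π * s, n) = timePhase dispersion t (s, n) := rfl
  have hW : Complex.exp ((2 * π * inner ℝ s x.1 : ℝ) * Complex.I) * mode n x.2
      = planeWave x (s, n) := by
    rw [planeWave]
    congr 2
    rw [RCLike.inner_apply, conj_trivial]
    push_cast
    ring
  rw [hS, ← hW, amplitude, smul_eq_mul]
  linear_combination (((2 * π : ℂ) ^ 3)⁻¹ * (m (2 * π * s, n) *
    (𝓕 (partialCoeff f n) : L2Line) s) *
    (Complex.exp ((2 * π * inner ℝ s x.1 : ℝ) * Complex.I) * mode n x.2 *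
      timePhase dispersion t (s, n))) * hE

/-- At every time, the superposition of plane waves is a representative of the evolution. -/
theorem waveSum_amplitude_ae_eq {L : ℕ} (hL : 0 < L) {m : Freq →ᵇ ℂ}
    (hm : SupportedInBox L m) (hm2 : ∀ ξ, ‖m ξ‖ ≤ 2) (f : L2Space) (t : ℝ) :
    (fun x => waveSum (freqMeasure L) planeWave dispersion (amplitude L m f) (x, t))
      =ᵐ[volume] schrodingerPropagator t (fourierMultiplier m f) := by
  rw [schrodingerPropagator_fourierMultiplier hm]
  set V : (Fin 3 → ℤ) → L2Line := fun n => symbolMul (schrodingerSymbol t) n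
    (symbolMul m n (𝓕 (partialCoeff f n))) with hV
  set v : (Fin 3 → ℤ) → ℝ → ℂ := fun n s => schrodingerSymbol t (2 * π * s, n) *
    (m (2 * π * s, n) * (𝓕 (partialCoeff f n) : L2Line) s) with hv
  have hVv : ∀ n, V n =ᵐ[volume] v n := by
    intro n
    filter_upwards [coeFn_symbolMul (schrodingerSymbol t) n (symbolMul m n (𝓕 (partialCoeff f n))),
      coeFn_symbolMul m n (𝓕 (partialCoeff f n))] with s h1 h2
    rw [hV, hv, h1, h2]
  have hinv : ∀ n, ∀ᵐ z : Space, tensorMode (𝓕⁻ (V n)) n z = 𝓕⁻ (v n) z.1 * mode n z.2 := by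
    intro n
    have h1 : Integrable (V n) := (integrable_symbol_mul hL hm _ n _).congr (hVv n).symm
    have h2 : ∀ᵐ z : Space, (𝓕⁻ (V n) : L2Line) z.1 = 𝓕⁻ (V n : ℝ → ℂ) z.1 :=
      Measure.quasiMeasurePreserving_fst.ae (L2Line.fourierInv_ae_eq (V n) h1)
    filter_upwards [coeFn_tensorMode (𝓕⁻ (V n)) n, h2] with z h3 h4
    rw [h3, h4]
    congr 1
    rw [Real.fourierInv_eq', Real.fourierInv_eq']
    refine integral_congr_ae ?_
    filter_upwards [hVv n] with s hs
    rw [hs]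
  have hall : ∀ᵐ z : Space, ∀ n ∈ freqBox L,
      tensorMode (𝓕⁻ (V n)) n z = 𝓕⁻ (v n) z.1 * mode n z.2 :=
    (ae_all_iff.mpr hinv).mono fun z hz n _ => hz n
  filter_upwards [hall, Lp.coeFn_smul (((2 * π) ^ 3)⁻¹ : ℂ)
    (∑ n ∈ freqBox L, tensorMode (𝓕⁻ (V n)) n),
    Lp.coeFn_fun_finsetSum (freqBox L) (fun n => tensorMode (𝓕⁻ (V n)) n)] with z h1 h2 h3
  rw [waveSum_amplitude hL hm hm2, h2, Pi.smul_apply, h3, smul_eq_mul]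
  congr 1
  exact Finset.sum_congr rfl fun n hn => (h1 n hn).symm

/-! ### The Strichartz estimate -/

section Strichartz

variable {L : ℕ} {m : Freq →ᵇ ℂ}

/-- The pointwise bound behind the endpoint `p = ∞`: Cauchy–Schwarz over the frequency box, whose
mass is comparable to `L ^ 4`. -/
theorem norm_waveSum_amplitude_le (hL : 0 < L) (hm : SupportedInBox L m) (hm2 : ∀ ξ, ‖m ξ‖ ≤ 2)
    (f : L2Space) (z : Space × ℝ) :
    ‖waveSum (freqMeasure L) planeWave dispersion (amplitude L m f) z‖
      ≤ 16 * (L : ℝ) ^ 2 * ‖f‖ := by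
  have := isFiniteMeasure_freqMeasure hL
  have ha := memLp_amplitude hL hm hm2 f
  have hai : Integrable (amplitude L m f) (freqMeasure L) := ha.integrable one_le_two
  refine ((dispersiveSystem_planeWave hL).norm_waveSum_le hai z).trans ?_
  have hL1 : (1 : ℝ) ≤ L := by exact_mod_cast hL
  have hmass : (2 * (L : ℝ) + 1) ^ 3 * (√π * L) ≤ 54 * (L : ℝ) ^ 4 := by
    have h1 : (2 * (L : ℝ) + 1) ^ 3 ≤ (3 * L) ^ 3 :=
      pow_le_pow_left₀ (by positivity) (by linarith) 3
    have h2 : √π ≤ 2 := by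
      rw [Real.sqrt_le_left (by norm_num)]
      linarith [Real.pi_le_four]
    calc _ ≤ (3 * (L : ℝ)) ^ 3 * (2 * L) := by gcongr
      _ = _ := by ring
  have hcs := sq_lintegral_mul_le (ν := freqMeasure L) (f := fun ξ => ‖amplitude L m f ξ‖ₑ)
    (g := fun _ => 1) (measurable_amplitude L m f).enorm.aemeasurable aemeasurable_const
  simp only [mul_one, one_pow, lintegral_const, one_mul] at hcs
  rw [freqMeasure_univ hL] at hcs
  have h1 : (∫⁻ ξ, ‖amplitude L m f ξ‖ₑ ∂(freqMeasure L)) ^ 2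
      ≤ ENNReal.ofReal ((16 * (L : ℝ) ^ 2 * ‖f‖) ^ 2) := by
    refine hcs.trans ?_
    calc _ ≤ ENNReal.ofReal ((2 * ‖f‖) ^ 2) * ENNReal.ofReal (54 * (L : ℝ) ^ 4) := by
          gcongr
          exact lintegral_enorm_amplitude_sq_le hL hm hm2 f
      _ = ENNReal.ofReal ((2 * ‖f‖) ^ 2 * (54 * (L : ℝ) ^ 4)) :=
          (ENNReal.ofReal_mul (by positivity)).symm
      _ ≤ _ := by
          refine ENNReal.ofReal_le_ofReal ?_
          have : 0 ≤ (L : ℝ) ^ 4 * ‖f‖ ^ 2 := by positivity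
          nlinarith
  rw [ENNReal.ofReal_pow (by positivity)] at h1
  have h2 : ∫⁻ ξ, ‖amplitude L m f ξ‖ₑ ∂(freqMeasure L)
      ≤ ENNReal.ofReal (16 * (L : ℝ) ^ 2 * ‖f‖) :=
    (ENNReal.pow_le_pow_left_iff two_ne_zero).mp h1
  rw [integral_norm_eq_lintegral_enorm hai.1]
  exact ENNReal.toReal_le_of_le_ofReal (by positivity) h2

/-- The Strichartz estimate in integrated form; the exponents are `r = q / 2 - 1` for the decay
and `4 r - 2 = 2 q - 6` for the frequency scale. -/
theorem exists_lintegral_rpow_waveSum_amplitude_le {q : ℝ} (hq : 18 / 5 < q) :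
    ∃ K : ℝ, 0 ≤ K ∧ ∀ (L : ℕ) (m : Freq →ᵇ ℂ) (f : L2Space), 0 < L → SupportedInBox L m →
      (∀ ξ, ‖m ξ‖ ≤ 2) → f ≠ 0 →
      ∫⁻ z, ENNReal.ofReal (‖waveSum (freqMeasure L) planeWave dispersion (amplitude L m f) z‖ ^ q)
          ∂((volume : Measure Space).prod DispersiveSystem.timeMeasure)
        ≤ ENNReal.ofReal (K * (‖f‖ ^ q * (L : ℝ) ^ (2 * q - 6))) := by
  set r := q / 2 - 1 with hr
  obtain ⟨C, hC, hdecay⟩ := exists_lintegral_decayBound_rpow_le (r := r) (by rw [hr]; linarith)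
  have hq2 : 0 < q - 2 := by linarith
  set K := 16 * (2 * π) ^ 3 * q / (q - 2) * (640 ^ r * C * 2 ^ (4 * r - 2)) with hK
  refine ⟨K, by positivity, fun L m f hL hm hm2 hf => ?_⟩
  have := isFiniteMeasure_freqMeasure hL
  have hF : 0 < ‖f‖ := norm_pos_iff.mpr hf
  have hL0 : (0 : ℝ) < L := by exact_mod_cast hL
  refine ((dispersiveSystem_planeWave hL).lintegral_rpow_waveSum_le (by positivity)
    (memLp_amplitude hL hm hm2 f) (A := 2 * ‖f‖) (by positivity)
    (lintegral_enorm_amplitude_sq_le hL hm hm2 f) (by linarith : 2 < q)).trans ?_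
  have hpt : ∀ t, √(2 * (2 * ‖f‖) ^ 2 * (80 * decayBound (2 * L) t)) ^ (q - 2)
      = (640 * ‖f‖ ^ 2) ^ r * decayBound (2 * L) t ^ r := by
    intro t
    have hd := decayBound_nonneg (2 * L) t
    rw [Real.sqrt_eq_rpow, ← Real.rpow_mul (by positivity),
      ← Real.mul_rpow (by positivity) hd]
    congr 1
    · ring
    · rw [hr]; ring
  have hint : ∫⁻ t in Set.Icc (-2 : ℝ) 2,
      ENNReal.ofReal (√(2 * (2 * ‖f‖) ^ 2 * (80 * decayBound (2 * L) t)) ^ (q - 2))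
      ≤ ENNReal.ofReal ((640 * ‖f‖ ^ 2) ^ r * (C * ((2 * L : ℕ) : ℝ) ^ (4 * r - 2))) := by
    simp only [hpt]
    have h1 : ∀ t, ENNReal.ofReal ((640 * ‖f‖ ^ 2) ^ r * decayBound (2 * L) t ^ r)
        = ENNReal.ofReal ((640 * ‖f‖ ^ 2) ^ r) * ENNReal.ofReal (decayBound (2 * L) t ^ r) :=
      fun t => ENNReal.ofReal_mul (by positivity)
    simp only [h1]
    rw [lintegral_const_mul' _ _ ENNReal.ofReal_ne_top, ENNReal.ofReal_mul (by positivity)]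
    gcongr
    exact hdecay (2 * L) (by omega)
  refine (mul_le_mul_right hint _).trans ?_
  rw [← ENNReal.ofReal_mul (by have : 0 < q := by linarith
                               positivity)]
  refine ENNReal.ofReal_le_ofReal (le_of_eq ?_)
  have e1 : (640 * ‖f‖ ^ 2) ^ r * ‖f‖ ^ 2 = 640 ^ r * ‖f‖ ^ q := by
    rw [Real.mul_rpow (by norm_num) (by positivity), ← Real.rpow_natCast, ← Real.rpow_mul hF.le,
      mul_assoc, ← Real.rpow_add hF]
    congr 2
    rw [hr]
    push_cast
    ring
  have e2 : ((2 * L : ℕ) : ℝ) ^ (4 * r - 2) = 2 ^ (4 * r - 2) * (L : ℝ) ^ (2 * q - 6) := by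
    rw [Nat.cast_mul, Real.mul_rpow (by positivity) hL0.le]
    congr 2
    rw [hr]
    ring
  rw [e2, hK]
  linear_combination (16 * (2 * π) ^ 3 * q / (q - 2)) *
    (C * (2 ^ (4 * r - 2) * (L : ℝ) ^ (2 * q - 6))) * e1

/-- The Strichartz estimate for frequencies in a box of size `L`. -/
theorem exists_eLpNorm_waveSum_amplitude_le {p : ℝ≥0∞} (hp : 18 / 5 < p) :
    ∃ C : ℝ, ∀ (L : ℕ) (m : Freq →ᵇ ℂ) (f : L2Space), 0 < L → SupportedInBox L m →
      (∀ ξ, ‖m ξ‖ ≤ 2) →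
      eLpNorm (waveSum (freqMeasure L) planeWave dispersion (amplitude L m f)) p
          ((volume : Measure Space).prod DispersiveSystem.timeMeasure)
        ≤ ENNReal.ofReal (C * (L : ℝ) ^ (2 - (6 / p).toReal) * ‖f‖) := by
  by_cases hpt : p = ⊤
  · refine ⟨16, fun L m f hL hm hm2 => ?_⟩
    rw [hpt, eLpNorm_exponent_top, ENNReal.div_top, ENNReal.toReal_zero, sub_zero,
      Real.rpow_ofNat]
    refine eLpNormEssSup_le_of_ae_bound (ae_of_all _ fun z => ?_)
    exact norm_waveSum_amplitude_le hL hm hm2 f z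
  set q := p.toReal with hq
  have hq5 : 18 / 5 < q := by
    have h := (ENNReal.toReal_lt_toReal (by finiteness) hpt).mpr hp
    rw [ENNReal.toReal_div] at h
    exact_mod_cast h
  have hq0 : 0 < q := by linarith
  have h6 : (6 / p).toReal = 6 / q := by
    rw [ENNReal.toReal_div]
    rfl
  obtain ⟨K, hK, hest⟩ := exists_lintegral_rpow_waveSum_amplitude_le hq5
  refine ⟨K ^ (1 / q), fun L m f hL hm hm2 => ?_⟩
  rw [h6]
  have hL0 : (0 : ℝ) < L := by exact_mod_cast hL
  by_cases hf : f = 0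
  · have h0 : waveSum (freqMeasure L) planeWave dispersion (amplitude L m f) = 0 := by
      ext z
      have := norm_waveSum_amplitude_le hL hm hm2 f z
      rw [hf, norm_zero, mul_zero] at this
      rw [hf]
      exact norm_le_zero_iff.mp this
    rw [h0, eLpNorm_zero]
    exact zero_le
  have hp0 : p ≠ 0 := (zero_le.trans_lt hp).ne'
  rw [eLpNorm_eq_lintegral_rpow_enorm_toReal hp0 hpt, ← hq]
  have h1 : ∀ z : ℂ, ‖z‖ₑ ^ q = ENNReal.ofReal (‖z‖ ^ q) := fun z => by
    rw [← ofReal_norm, ENNReal.ofReal_rpow_of_nonneg (norm_nonneg _) hq0.le]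
  simp only [h1]
  refine (ENNReal.rpow_le_rpow (hest L m f hL hm hm2 hf) (by positivity)).trans (le_of_eq ?_)
  rw [ENNReal.ofReal_rpow_of_nonneg (by positivity) (by positivity),
    Real.mul_rpow hK (by positivity), Real.mul_rpow (by positivity) (by positivity),
    ← Real.rpow_mul (norm_nonneg _), ← Real.rpow_mul hL0.le, mul_one_div_cancel hq0.ne',
    Real.rpow_one]
  have h2 : (2 * q - 6) * (1 / q) = 2 - 6 / q := by field_simp
  rw [h2]
  congr 1
  ring

end Strichartz

theorem proposition2p1 (η : Cutoff) (p : ℝ≥0∞) (hp : 18 / 5 < p) :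
    ∃ C : ℝ, ∀ (j : ℕ) (f : L2Space),
      ∃ u : Space × ℝ → ℂ,
        AEStronglyMeasurable u ((volume : Measure Space).prod
          ((volume : Measure ℝ).restrict (Set.Icc (-1) 1))) ∧
        (∀ t ∈ Set.Icc (-1 : ℝ) 1,
          (fun x => u (x, t)) =ᵐ[volume] schrodingerPropagator t (dyadicProj η j f)) ∧
        eLpNorm u p ((volume : Measure Space).prod
            ((volume : Measure ℝ).restrict (Set.Icc (-1) 1))) ≤
          ENNReal.ofReal (C * ((2 : ℝ) ^ j) ^ (2 - (6 / p).toReal) * ‖f‖) := by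
  obtain ⟨C, hC⟩ := exists_eLpNorm_waveSum_amplitude_le hp
  refine ⟨C * 2 ^ (2 - (6 / p).toReal), fun j f => ?_⟩
  obtain ⟨m, hm, hm2, hmf⟩ := exists_dyadicProj_eq_fourierMultiplier η j
  have hL : 0 < 2 ^ (j + 1) := by positivity
  have := isFiniteMeasure_freqMeasure hL
  refine ⟨waveSum (freqMeasure (2 ^ (j + 1))) planeWave dispersion (amplitude (2 ^ (j + 1)) m f),
    ((dispersiveSystem_planeWave hL).stronglyMeasurable_waveSum
      (memLp_amplitude hL hm hm2 f).1).aestronglyMeasurable, fun t _ => ?_, ?_⟩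
  · rw [hmf]
    exact waveSum_amplitude_ae_eq hL hm hm2 f t
  · refine (hC _ m f hL hm hm2).trans (le_of_eq ?_)
    congr 2
    push_cast
    rw [pow_succ', Real.mul_rpow (by norm_num) (by positivity), mul_assoc]
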